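/- Let $n\ge 0$, let $M\cong\mathbb Z^{n+1}$ and let $N=\operatorname{Hom}(M,\mathbb Z)$. Let $\Delta\subset M_{\mathbb R}$ be an $(n+1)$-dimensional reflexive polytope (a lattice polytope defined by finitely many inequalities $\langle v,\cdot\rangle\le 1$ with $v\in N$) and $\Delta^\circ=\{u\in N_{\mathbb R}:\langle u,v\rangle\le 1\ \forall v\in\Delta\}$ its dual. Let $T$ and $T^\circ$ be unimodular triangulations of $\Delta$ and $\Delta^\circ$ that are central (every simplex is $\{0\}$, a lattice simplex $\sigma$ contained in the boundary, or the join of such a $\sigma$ with $0$) and convex, i.e. induced by integral functions $\mu:\Delta\cap M\to\mathbb Z$ and $\mu^\circ:\Delta^\circ\cap N\to\mathbb Z$: the vertex sets of the simplices of $T$ are exactly the sets of points of $\Delta\cap M$ at which $\langle x,\cdot\rangle-\mu$ is maximal, for $x\in N_{\mathbb R}$, and likewise for $T^\circ$. Let $V_\mu\subset N_{\mathbb R}$ be the tropical hypersurface of points $x$ at which $\max_{y\in\Delta\cap M}(\langle x,y\rangle-\mu(y))$ is attained at least twice, and let $X_{\mathrm{trop}}$ be its closure in the tropical toric variety $\mathbb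 T\Sigma_{T^\circ}$ of the fan of cones $C(\tau)$ over the simplices $\tau\ni 0$ of $T^\circ$ (with the convention that $x+tv$ tends to a point of the orbit $N_{\mathbb R}/\langle C(\tau)\rangle_{\mathbb R}$ as $t\to+\infty$ when $v$ is in the relative interior of $C(\tau)$). Define $X^\circ_{\mathrm{trop}}\subset\mathbb T\Sigma_T$ in the same way from $\mu^\circ$. The cells of the subdivision of $\mathbb T\Sigma_{T^\circ}$ induced by $X_{\mathrm{trop}}$ are the nonempty sets $F(\tau,\sigma)$ ($0\in\tau\in T^\circ$, $\sigma\in T$) obtained by intersecting the closure of the cell of $N_{\mathbb R}$ dual to $\sigma$ with the closure of the orbit of $C(\tau)$; they are ordered by $(\tau,\sigma)\le(\tau',\sigma')$ iff $\tau'\subset\tau$ and $\sigma'\subset\sigma$, and $\dim F(\tau,\sigma)=\operatorname{codim}\tau-\dim\sigma$. Let $\mathcal F_p$ be the cosheaf $$\mathcal F_p(\tau,\sigma)=\sum_{\lambda\subset\sigma,\ \dim\lambda=1}\ \bigwedge\nolimits^p\bigl(\lambda^\perp/\langle C(\tau)\rangle\bigr)\subset\bigwedge\nolimits^p\bigl(N/\langle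 C(\tau)\rangle\bigr),$$ where $\lambda^\perp\subset N$ is the sublattice orthogonal to the edge $\lambda$ and $\langle C(\tau)\rangle$ is the sublattice generated by $C(\tau)\cap N$, with cosheaf maps induced by the projections $N/\langle C(\tau')\rangle\to N/\langle C(\tau)\rangle$ for $\tau'\subset\tau$. Let $H_q(X_{\mathrm{trop}};\mathcal F_p\otimes\mathbb Q)$ be the cellular homology of $\mathcal F_p\otimes\mathbb Q$ on the cells contained in $X_{\mathrm{trop}}$, with signs given by any balanced signature on the poset of cells of $\mathbb T\Sigma_{T^\circ}$ (a choice of sign for each cover relation such that every interval of length two contains an odd number of $-1$'s); define $H_q(X^\circ_{\mathrm{trop}};\mathcal F_p\otimes\mathbb Q)$ in the same way, exchanging the roles of $(\Delta,T,\mu,M)$ and $(\Delta^\circ,T^\circ,\mu^\circ,N)$. Then, for any such $\mu,\mu^\circ$ and any such signatures, and for all $q\ge 0$ and $0\le p\le n$, $$\dim_{\mathbb Q} H_q(X_{\mathrm{trop}};\mathcal F_p\otimes\mathbb Q)=\dim_{\mathbb Q} H_q(X^\circ_{\mathrm{trop}};\mathcal F_{n-p}\otimes\mathbb Q).$$ 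-/

import Mathlib

open scoped DirectSum TensorProduct

noncomputable section

namespace TropicalMirror

/-! ### Lattices and reflexive polytopes

Both lattices `M` and `N` are `Fin d → ℤ`, dual to each other through the dot product. -/

/-- The inclusion of the lattice `ℤ^d` into `ℝ^d`. -/
def toReal {d : ℕ} (v : Fin d → ℤ) : Fin d → ℝ := fun i => (v i : ℝ)

/-- The convex hull in `ℝ^d` of a finite set of lattice points. -/
def hull {d : ℕ} (s : Finset (Fin d → ℤ)) : Set (Fin d → ℝ) :=
  convexHull ℝ (toReal '' (s : Set (Fin d → ℤ)))

/-- A reflexive polytope: a full-dimensional lattice polytope which is defined by a (finite) system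
of inequalities `⟨v, u⟩ ≤ 1` with `v` in the dual lattice. -/
structure IsReflexive {d : ℕ} (Δ : Set (Fin d → ℝ)) : Prop where
  lattice : ∃ S : Finset (Fin d → ℤ), Δ = hull S
  fullDim : (interior Δ).Nonempty
  ineq : ∃ V : Finset (Fin d → ℤ), Δ = {u | ∀ v ∈ V, toReal v ⬝ᵥ u ≤ 1}

/-- The dual polytope `Δ° = {u | ⟨u, v⟩ ≤ 1 for all v ∈ Δ}`. -/
def polarDual {d : ℕ} (Δ : Set (Fin d → ℝ)) : Set (Fin d → ℝ) :=
  {u | ∀ v ∈ Δ, u ⬝ᵥ v ≤ 1}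

/-! ### Central unimodular triangulations -/

/-- A central unimodular triangulation of `Δ` with vertices in the lattice. A simplex is given by
the set of its vertices. -/
structure Triangulation {d : ℕ} (Δ : Set (Fin d → ℝ)) where
  /-- the (nonempty) simplices of the triangulation -/
  faces : Finset (Finset (Fin d → ℤ))
  nonempty : ∀ s ∈ faces, s.Nonempty
  down_closed : ∀ s ∈ faces, ∀ t ⊆ s, t.Nonempty → t ∈ faces
  indep : ∀ s ∈ faces, AffineIndependent ℝ (fun v : s => toReal (v : Fin d → ℤ))
  inter : ∀ s ∈ faces, ∀ t ∈ faces, hull s ∩ hull t ⊆ hull (s ∩ t)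
  space : ⋃ s ∈ faces, hull s = Δ
  /-- unimodularity: every lattice vector that is parallel to a simplex is an integral combination
  of the differences of its vertices -/
  unimodular : ∀ s ∈ faces, ∀ x : Fin d → ℤ,
    toReal x ∈ vectorSpan ℝ (toReal '' (s : Set (Fin d → ℤ))) →
      x ∈ vectorSpan ℤ (s : Set (Fin d → ℤ))
  /-- centrality: the simplices are the origin, simplices in the boundary of `Δ`, and the joins of
  the latter with the origin -/
  zero_mem : {0} ∈ faces
  insert_zero : ∀ s ∈ faces, insert 0 s ∈ faces
  boundary : ∀ s ∈ faces, 0 ∉ s → hull s ⊆ frontier Δ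

section Hypersurface

variable {d : ℕ}

/-- `y` is a lattice point of `Δ` at which the maximum defining the Legendre transform
`μ^*(x) = max_{z ∈ Δ ∩ M} (⟨x, z⟩ - μ(z))` is attained. -/
def IsMaximizer (Δ : Set (Fin d → ℝ)) (μ : (Fin d → ℤ) → ℤ) (x : Fin d → ℝ)
    (y : Fin d → ℤ) : Prop :=
  toReal y ∈ Δ ∧ ∀ z : Fin d → ℤ, toReal z ∈ Δ →
    x ⬝ᵥ toReal z - (μ z : ℝ) ≤ x ⬝ᵥ toReal y - (μ y : ℝ)

/-- `T` is the convex (regular) subdivision of `Δ` induced by the integral function `μ` on the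
lattice points of `Δ`: the simplices of `T` are exactly the projections of the faces of the lower
convex hull of the graph of `μ`, i.e. the sets of lattice points of `Δ` at which
`⟨x, ·⟩ - μ` is maximal, for the various `x`. Only the values of `μ` on `Δ` matter. -/
def Triangulation.IsInducedBy {Δ : Set (Fin d → ℝ)} (T : Triangulation Δ)
    (μ : (Fin d → ℤ) → ℤ) : Prop :=
  ∀ s : Finset (Fin d → ℤ), s ∈ T.faces ↔
    ∃ x : Fin d → ℝ, ∀ y : Fin d → ℤ, y ∈ s ↔ IsMaximizer Δ μ x y

/-- The tropical hypersurface `V_μ` in `N_ℝ`: the maximum is attained at least twice. -/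
def hypersurface (Δ : Set (Fin d → ℝ)) (μ : (Fin d → ℤ) → ℤ) : Set (Fin d → ℝ) :=
  {x | ∃ y₁ y₂ : Fin d → ℤ, y₁ ≠ y₂ ∧ IsMaximizer Δ μ x y₁ ∧ IsMaximizer Δ μ x y₂}

/-- The closed cell of the subdivision of `N_ℝ` defined by `V_μ` that is dual to `σ`. -/
def dualCell (Δ : Set (Fin d → ℝ)) (μ : (Fin d → ℤ) → ℤ) (σ : Finset (Fin d → ℤ)) :
    Set (Fin d → ℝ) :=
  {x | ∀ y ∈ σ, IsMaximizer Δ μ x y}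

/-! ### The tropical toric variety of the fan of cones over a central triangulation

The cones of the fan are indexed by the simplices that contain the origin. -/

/-- The cone over a simplex. -/
def cone (τ : Finset (Fin d → ℤ)) : Set (Fin d → ℝ) :=
  {x | ∃ c : (Fin d → ℤ) → ℝ, (∀ v ∈ τ, 0 ≤ c v) ∧ x = ∑ v ∈ τ, c v • toReal v}

/-- The semigroup `S_τ` of lattice points of the dual cone. -/
def dualSemigroup (τ : Finset (Fin d → ℤ)) : Set (Fin d → ℤ) :=
  {m | ∀ x ∈ cone τ, 0 ≤ toReal m ⬝ᵥ x}

/-- The lattice points that are orthogonal to the cone over `τ`. -/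
def conePerp (τ : Finset (Fin d → ℤ)) : AddSubgroup (Fin d → ℤ) where
  carrier := {m | ∀ x ∈ cone τ, toReal m ⬝ᵥ x = 0}
  zero_mem' := by
    intro x _
    simp [toReal, dotProduct]
  add_mem' := by
    intro a b ha hb x hx
    have h : toReal (a + b) = toReal a + toReal b := by
      funext i
      simp [toReal]
    rw [h, add_dotProduct, ha x hx, hb x hx, add_zero]
  neg_mem' := by
    intro a ha x hx
    have h : toReal (-a) = -toReal a := by
      funext i
      simp [toReal]
    rw [h, neg_dotProduct, ha x hx, neg_zero]

variable {Q Δ : Set (Fin d → ℝ)}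

/-- The points of the tropical toric variety of the fan of cones over `T`. A point of the orbit of
the cone `C(τ)` is a homomorphism `C(τ)^⊥ ∩ M → ℝ`, i.e. an element of `N_ℝ / ⟨C(τ)⟩`. -/
structure ToricPoint (T : Triangulation Q) where
  /-- the simplex `τ ∋ 0` whose cone indexes the orbit of the point -/
  simplex : Finset (Fin d → ℤ)
  mem_faces : simplex ∈ T.faces
  zero_mem : 0 ∈ simplex
  /-- the coordinates of the point in its orbit -/
  val : conePerp simplex →+ ℝ

open scoped Classical in
/-- The value of a point at a lattice vector `m`. On the chart of a cone `C(τ)`, for `m` in `S_τ`,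
it is the value at `m` of the corresponding semigroup homomorphism from `S_τ` to the tropical
numbers; the infinite tropical number is written `⊤`, so that `x + t v` converges to a point of the
orbit of `C(τ)` when `v` is in the relative interior of `C(τ)` and `t → +∞`. -/
def ToricPoint.eval {T : Triangulation Q} (q : ToricPoint T) (m : Fin d → ℤ) : EReal :=
  if h : m ∈ conePerp q.simplex then ((q.val ⟨m, h⟩ : ℝ) : EReal) else ⊤

/-- The affine chart of the cone over `τ`: the union of the orbits of its faces. -/
def chart (T : Triangulation Q) (τ : Finset (Fin d → ℤ)) : Set (ToricPoint T) :=
  {q | q.simplex ⊆ τ}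

/-- The topology of the tropical toric variety: the charts are open, and each chart carries the
coarsest topology for which the evaluations at the elements of its semigroup are continuous. -/
instance toricTopology (T : Triangulation Q) : TopologicalSpace (ToricPoint T) :=
  TopologicalSpace.generateFrom
    {W | ∃ τ ∈ T.faces, 0 ∈ τ ∧ ∃ m ∈ dualSemigroup τ, ∃ O : Set EReal, IsOpen O ∧
      W = {q ∈ chart T τ | q.eval m ∈ O}}

/-- The inclusion of the dense orbit `N_ℝ` into the tropical toric variety. -/
def torusPoint (T : Triangulation Q) (x : Fin d → ℝ) : ToricPoint T where
  simplex := {0}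
  mem_faces := T.zero_mem
  zero_mem := Finset.mem_singleton_self 0
  val :=
    { toFun := fun m => x ⬝ᵥ toReal (m : Fin d → ℤ)
      map_zero' := by simp [toReal, dotProduct]
      map_add' := by
        intro a b
        simp [toReal, dotProduct, mul_add, Finset.sum_add_distrib] }

/-- The orbit of the cone over `τ`. -/
def orbit (T : Triangulation Q) (τ : Finset (Fin d → ℤ)) : Set (ToricPoint T) :=
  {q | q.simplex = τ}

/-- The tropical Calabi–Yau hypersurface: the compactification of `V_μ` in the tropical toric
variety of the fan of cones over the triangulation `T'` of the dual polytope. -/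
def tropicalCY (T' : Triangulation Q) (Δ : Set (Fin d → ℝ)) (μ : (Fin d → ℤ) → ℤ) :
    Set (ToricPoint T') :=
  closure (torusPoint T' '' hypersurface Δ μ)

/-- The part of the closure of the cell dual to `σ` lying in the closure of the orbit of `τ`. -/
def closedCell (T' : Triangulation Q) (Δ : Set (Fin d → ℝ)) (μ : (Fin d → ℤ) → ℤ)
    (τ σ : Finset (Fin d → ℤ)) : Set (ToricPoint T') :=
  closure (torusPoint T' '' dualCell Δ μ σ) ∩ closure (orbit T' τ)

/-- The (nonempty) cells `F(τ, σ)` of the subdivision of the tropical toric variety induced by the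
tropical hypersurface, for `τ ∈ T'` containing the origin and `σ ∈ T`. -/
@[ext]
structure Cell (T' : Triangulation Q) (T : Triangulation Δ) (μ : (Fin d → ℤ) → ℤ) where
  τ : Finset (Fin d → ℤ)
  σ : Finset (Fin d → ℤ)
  τ_mem : τ ∈ T'.faces
  zero_mem : 0 ∈ τ
  σ_mem : σ ∈ T.faces
  nonempty : (closedCell T' Δ μ τ σ).Nonempty

variable {T' : Triangulation Q} {T : Triangulation Δ} {μ : (Fin d → ℤ) → ℤ}

/-- The order on the face poset: `(τ, σ) ≤ (τ', σ')` iff `τ' ⊆ τ` and `σ' ⊆ σ`. -/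
instance : PartialOrder (Cell T' T μ) where
  le a b := b.τ ⊆ a.τ ∧ b.σ ⊆ a.σ
  le_refl a := ⟨subset_rfl, subset_rfl⟩
  le_trans a b c hab hbc := ⟨hbc.1.trans hab.1, hbc.2.trans hab.2⟩
  le_antisymm a b hab hba :=
    Cell.ext (Finset.Subset.antisymm hba.1 hab.1) (Finset.Subset.antisymm hba.2 hab.2)

instance : Finite (Cell T' T μ) :=
  Finite.of_injective
    (fun c : Cell T' T μ => ((⟨c.τ, c.τ_mem⟩, ⟨c.σ, c.σ_mem⟩) : T'.faces × T.faces))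
    (by
      intro a b h
      simp only [Prod.mk.injEq, Subtype.mk.injEq] at h
      exact Cell.ext h.1 h.2)

/-- The dimension of the cell `F(τ, σ)`, namely `codim τ - dim σ`. -/
def Cell.dim (c : Cell T' T μ) : ℤ :=
  ((d : ℤ) - ((c.τ.card : ℤ) - 1)) - ((c.σ.card : ℤ) - 1)

variable (T' T μ) in
/-- The cells of the tropical hypersurface. -/
def HypersurfaceCell : Type :=
  {c : Cell T' T μ // closedCell T' Δ μ c.τ c.σ ⊆ tropicalCY T' Δ μ}

instance : PartialOrder (HypersurfaceCell T' T μ) :=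
  inferInstanceAs (PartialOrder {c : Cell T' T μ //
    closedCell T' Δ μ c.τ c.σ ⊆ tropicalCY T' Δ μ})

instance : Finite (HypersurfaceCell T' T μ) :=
  inferInstanceAs (Finite {c : Cell T' T μ //
    closedCell T' Δ μ c.τ c.σ ⊆ tropicalCY T' Δ μ})

end Hypersurface

/-! ### Homology of cosheaves on graded posets -/

/-- A cosheaf of `R`-modules on a poset: a contravariant functor to `R`-modules. -/
structure Cosheaf (R : Type) [CommRing R] (P : Type) [PartialOrder P] where
  obj : P → Type
  [addCommGroup : ∀ x, AddCommGroup (obj x)]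
  [module : ∀ x, Module R (obj x)]
  map : ∀ {x y : P}, x ≤ y → obj y →ₗ[R] obj x
  map_refl : ∀ x : P, map (le_refl x) = LinearMap.id
  map_trans : ∀ {x y z : P} (hxy : x ≤ y) (hyz : y ≤ z),
    map (hxy.trans hyz) = map hxy ∘ₗ map hyz

attribute [instance] Cosheaf.addCommGroup Cosheaf.module

/-- The cosheaf `F ⊗ A`. -/
def Cosheaf.baseChange {R : Type} [CommRing R] {P : Type} [PartialOrder P] (F : Cosheaf R P)
    (A : Type) [CommRing A] [Algebra R A] : Cosheaf A P where
  obj x := A ⊗[R] F.obj x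
  map h := (F.map h).baseChange A
  map_refl x := by rw [F.map_refl, LinearMap.baseChange_id]
  map_trans hxy hyz := by rw [F.map_trans hxy hyz, LinearMap.baseChange_comp]

/-- The restriction of a cosheaf along a monotone map, e.g. the inclusion of a subposet. -/
def Cosheaf.restrict {R : Type} [CommRing R] {P P' : Type} [PartialOrder P] [PartialOrder P']
    (F : Cosheaf R P) (f : P' → P) (hf : Monotone f) : Cosheaf R P' where
  obj x := F.obj (f x)
  map h := F.map (hf h)
  map_refl x := F.map_refl (f x)
  map_trans hxy hyz := F.map_trans (hf hxy) (hf hyz)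

/-- A signature `s` (`s y x` is the sign of the cover relation `y ⋖ x`; other values are
irrelevant) on a thin poset graded by `dim` is balanced if every interval of length two contains an
odd number of negative signs. Here `w₁`, `w₂` are the two middle elements of the interval. -/
def IsBalanced {P : Type} [PartialOrder P] (dim : P → ℤ) (s : P → P → ℤˣ) : Prop :=
  ∀ x y w₁ w₂ : P, dim y - dim x = 2 → w₁ ≠ w₂ → x ⋖ w₁ → w₁ ⋖ y → x ⋖ w₂ → w₂ ⋖ y →
    s x w₁ * s w₁ y * (s x w₂ * s w₂ y) = -1

section Homology

variable {R : Type} [CommRing R] {P : Type} [PartialOrder P] [Finite P]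

/-- The chains `C_q(P; F)`: the direct sum of the `F(x)` with `dim x = q`. -/
abbrev Chains (F : Cosheaf R P) (dim : P → ℤ) (q : ℤ) : Type :=
  ⨁ x : {x : P // dim x = q}, F.obj x

open scoped Classical in
/-- The boundary map `C_q → C_r` (used for `r = q - 1`): on `F(x)` it is the sum over the cover
relations `y ⋖ x` of the maps `F(x) → F(y)`, with the sign given by the signature. -/
def boundaryMap (F : Cosheaf R P) (dim : P → ℤ) (s : P → P → ℤˣ) (q r : ℤ) :
    Chains F dim q →ₗ[R] Chains F dim r :=
  letI : Fintype {y : P // dim y = r} := Fintype.ofFinite _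
  DirectSum.toModule R {x : P // dim x = q} (Chains F dim r) fun x =>
    ∑ y : {y : P // dim y = r},
      if h : (y : P) ⋖ (x : P) then
        ((s y x : ℤˣ) : ℤ) •
          ((DirectSum.lof R {y : P // dim y = r} (fun y => F.obj y) y) ∘ₗ F.map h.le)
      else 0

/-- The homology `H_q(P; F)`: cycles modulo boundaries. -/
abbrev Homology (F : Cosheaf R P) (dim : P → ℤ) (s : P → P → ℤˣ) (q : ℤ) : Type :=
  (LinearMap.ker (boundaryMap F dim s q (q - 1))) ⧸
    ((LinearMap.range (boundaryMap F dim s (q + 1) q)).comap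
      (LinearMap.ker (boundaryMap F dim s q (q - 1))).subtype)

end Homology

/-! ### Tropical homology -/

section Multitangent

variable {R L : Type} [CommRing R] [AddCommGroup L] [Module R L]

/-- The sum, inside the exterior power of `L / C`, of the exterior powers of the images `V / C` of
the submodules `V` in the set `E`. -/
def multitangent (p : ℕ) (C : Submodule R L) (E : Set (Submodule R L)) :
    Submodule R (⋀[R]^p (L ⧸ C)) :=
  ⨆ V ∈ E, LinearMap.range (exteriorPower.map p (V.map C.mkQ).subtype)

theorem multitangent_map (p : ℕ) {C C' : Submodule R L} {E E' : Set (Submodule R L)}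
    (hC : C ≤ C') (hE : E ⊆ E') :
    ∀ x ∈ multitangent p C E,
      exteriorPower.map p (Submodule.factor hC) x ∈ multitangent p C' E' := by
  change multitangent p C E ≤
    (multitangent p C' E').comap (exteriorPower.map p (Submodule.factor hC))
  refine iSup₂_le fun V hV => ?_
  rintro _ ⟨y, rfl⟩
  have hle : ∀ z ∈ V.map C.mkQ, Submodule.factor hC z ∈ V.map C'.mkQ := by
    rintro _ ⟨u, hu, rfl⟩
    exact ⟨u, hu, rfl⟩
  have key : exteriorPower.map p (Submodule.factor hC)
        (exteriorPower.map p (V.map C.mkQ).subtype y) =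
      exteriorPower.map p (V.map C'.mkQ).subtype
        (exteriorPower.map p ((Submodule.factor hC).restrict hle) y) := by
    rw [← LinearMap.comp_apply, ← LinearMap.comp_apply, ← exteriorPower.map_comp,
      ← exteriorPower.map_comp]
    rfl
  rw [Submodule.mem_comap, key]
  exact (le_iSup₂_of_le V (hE hV) le_rfl :
    LinearMap.range (exteriorPower.map p (V.map C'.mkQ).subtype) ≤ multitangent p C' E') ⟨_, rfl⟩

/-- The module underlying `multitangent p C E`. -/
def MultitangentModule (p : ℕ) (C : Submodule R L) (E : Set (Submodule R L)) : Type :=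
  multitangent p C E

instance (p : ℕ) (C : Submodule R L) (E : Set (Submodule R L)) :
    AddCommGroup (MultitangentModule p C E) :=
  inferInstanceAs (AddCommGroup (multitangent p C E))

instance (p : ℕ) (C : Submodule R L) (E : Set (Submodule R L)) :
    Module R (MultitangentModule p C E) :=
  inferInstanceAs (Module R (multitangent p C E))

/-- The map induced by the projection `L / C → L / C'` for `C ≤ C'`. -/
def multitangentMap (p : ℕ) {C C' : Submodule R L} {E E' : Set (Submodule R L)}
    (hC : C ≤ C') (hE : E ⊆ E') :
    MultitangentModule p C E →ₗ[R] MultitangentModule p C' E' :=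
  (exteriorPower.map p (Submodule.factor hC)).restrict (multitangent_map p hC hE)

theorem multitangentMap_refl (p : ℕ) (C : Submodule R L) (E : Set (Submodule R L)) :
    multitangentMap p (le_refl C) (subset_refl E) = LinearMap.id := by
  refine LinearMap.ext fun x => Subtype.ext ?_
  have h : Submodule.factor (le_refl C) = LinearMap.id := Submodule.linearMap_qext _ rfl
  change exteriorPower.map p (Submodule.factor (le_refl C)) x.val = x.val
  rw [h, exteriorPower.map_id, LinearMap.id_apply]

theorem multitangentMap_trans (p : ℕ) {C₁ C₂ C₃ : Submodule R L} {E₁ E₂ E₃ : Set (Submodule R L)}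
    (hC : C₁ ≤ C₂) (hE : E₁ ⊆ E₂) (hC' : C₂ ≤ C₃) (hE' : E₂ ⊆ E₃) :
    multitangentMap p (hC.trans hC') (hE.trans hE') =
      multitangentMap p hC' hE' ∘ₗ multitangentMap p hC hE := by
  refine LinearMap.ext fun x => Subtype.ext ?_
  have h : Submodule.factor (hC.trans hC') = Submodule.factor hC' ∘ₗ Submodule.factor hC :=
    Submodule.linearMap_qext _ rfl
  change exteriorPower.map p (Submodule.factor (hC.trans hC')) x.val =
    exteriorPower.map p (Submodule.factor hC') (exteriorPower.map p (Submodule.factor hC) x.val)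
  rw [h, exteriorPower.map_comp, LinearMap.comp_apply]

end Multitangent

section TropicalHomology

variable {d : ℕ}

/-- The sublattice `⟨C(τ)⟩` generated by the lattice points of the cone over `τ`. -/
def coneSpan (τ : Finset (Fin d → ℤ)) : Submodule ℤ (Fin d → ℤ) :=
  Submodule.span ℤ {u | toReal u ∈ cone τ}

/-- The sublattice `λ^⊥` orthogonal to the edge `λ` with endpoints `a` and `b`. -/
def edgePerp (a b : Fin d → ℤ) : Submodule ℤ (Fin d → ℤ) where
  carrier := {u | u ⬝ᵥ (a - b) = 0}
  zero_mem' := by simp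
  add_mem' := by
    intro u v hu hv
    simp only [Set.mem_ofPred_eq] at *
    rw [add_dotProduct, hu, hv, add_zero]
  smul_mem' := by
    intro c u hu
    simp only [Set.mem_ofPred_eq] at *
    rw [smul_dotProduct, hu, smul_zero]

/-- The sublattices `λ^⊥` for the edges `λ` of `σ`. -/
def edgePerps (σ : Finset (Fin d → ℤ)) : Set (Submodule ℤ (Fin d → ℤ)) :=
  {V | ∃ a ∈ σ, ∃ b ∈ σ, a ≠ b ∧ V = edgePerp a b}

theorem coneSpan_mono {τ τ' : Finset (Fin d → ℤ)} (h : τ ⊆ τ') : coneSpan τ ≤ coneSpan τ' := by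
  classical
  refine Submodule.span_mono ?_
  rintro u ⟨c, hc, hu⟩
  refine ⟨fun v => if v ∈ τ then c v else 0, ?_, ?_⟩
  · intro v _
    by_cases hv : v ∈ τ
    · simpa [hv] using hc v hv
    · simp [hv]
  · rw [hu]
    simp only [ite_smul, zero_smul]
    rw [← Finset.sum_filter, Finset.filter_mem_eq_inter, Finset.inter_eq_right.mpr h]

theorem edgePerps_mono {σ σ' : Finset (Fin d → ℤ)} (h : σ ⊆ σ') : edgePerps σ ⊆ edgePerps σ' := by
  rintro V ⟨a, ha, b, hb, hab, hV⟩
  exact ⟨a, h ha, b, h hb, hab, hV⟩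

variable {Q Δ : Set (Fin d → ℝ)} (T' : Triangulation Q) (T : Triangulation Δ)
  (μ : (Fin d → ℤ) → ℤ)

/-- The `p`-multitangent cosheaf on the cells of the tropical toric variety: `F_p(τ, σ)` is the sum
over the edges `λ` of `σ` of the `p`-th exterior powers of `λ^⊥ / ⟨C(τ)⟩`, and the cosheaf maps are
induced by the projections `N / ⟨C(τ')⟩ → N / ⟨C(τ)⟩` for `τ' ⊆ τ`. -/
def multitangentCosheaf (p : ℕ) : Cosheaf ℤ (Cell T' T μ) where
  obj c := MultitangentModule p (coneSpan c.τ) (edgePerps c.σ)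
  map h := multitangentMap p (coneSpan_mono h.1) (edgePerps_mono h.2)
  map_refl c := multitangentMap_refl p (coneSpan c.τ) (edgePerps c.σ)
  map_trans hab hbc := multitangentMap_trans p (coneSpan_mono hbc.1) (edgePerps_mono hbc.2)
    (coneSpan_mono hab.1) (edgePerps_mono hab.2)

/-- The tropical homology `H_q(X_trop; F_p ⊗ ℚ)` of the hypersurface `tropicalCY T' Δ μ`: cellular
homology over the cells contained in it, with signs given by a signature on the cells of the
ambient tropical toric variety. -/
abbrev TropicalHomology (s : Cell T' T μ → Cell T' T μ → ℤˣ) (p : ℕ) (q : ℤ) : Type :=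
  Homology (P := HypersurfaceCell T' T μ)
    (((multitangentCosheaf T' T μ p).baseChange ℚ).restrict
      (fun c : HypersurfaceCell T' T μ => c.val) (fun _ _ h => h))
    (fun c => c.val.dim) (fun y x => s y.val x.val) q

end TropicalHomology

end TropicalMirror

end

/-! Put d = n + 1 and place a lattice vector v at height one, `lift v` = (v, 1), in ℚ^d × ℚ with the
form ⟨x, y⟩ - s t. Then ⟨`lift u`, `lift v`⟩ = u·v - 1, so the incidence u·v = 1 between points of
the two polar polytopes is orthogonality, and the two sides enter symmetrically. By polarity
(`closedCell_nonempty_iff`, `closedCell_subset_tropicalCY_iff`), the cells are the pairs (α, σ) with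
τ = α ∪ {0}, σ ∈ T nonempty and u·b = 1 for all u ∈ α, b ∈ σ; those in the hypersurface have |σ| ≥
2. On the exterior algebra of the extended lattice (`Fock`), multiplication by `lift u`, u ∈ α,
anticommutes with contraction with `lift b`, b ∈ σ.

Multiplication by `lift 0` and the `lift u`, u ∈ α, identifies ⋀^p(N/⟨C(τ)⟩) ⊗ ℚ with the elements
of degree p + 1 + |α| killed by these vectors (`tangentCoeff`), and the projections between
quotients become multiplications (`theta_factor`). Inside this space, F_p ⊗ ℚ is the kernel of the
product of the contractions with `lift b`, b ∈ σ (`mem_range_thetaRat_iff`). This product maps onto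
the elements of degree p + 1 + |α| - |σ| killed by multiplication with α and by contraction with σ
(`mixedCoeff`). Hence the chain complex of F_p is, up to signs and reindexing, the kernel of a
surjection of complexes on all cells of the ambient toric variety, and tropical homology is the
cohomology of its mapping cone (`rank_tropicalHomology`).

The source of this surjection has coefficients depending on α only. For fixed α, the simplices σ
triangulate a face of Δ (all of Δ if α is empty), which is acyclic, so the source can be replaced by
its constants, placed at σ = ∅. The cone thus becomes one complex on the pairs (α, σ) with σ
possibly empty (`rank_augmentedComplex`). If 0 ∈ σ then α = ∅, and contraction with `lift 0` cancels
these pairs against those without 0 (`rank_symmetricComplex`). What remains lives on the pairs (α,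
β) of boundary simplices of the two triangulations, not both empty, with conditions that are
exchanged when the two polytopes, and multiplication and contraction, are exchanged. The Hodge star
does the latter and sends degree k to d + 1 - k, hence p to n - p, while the cohomological degree is
unchanged (`rank_symmetricComplex_symm`).

Two further inputs are needed. Acyclicity of the triangulated faces comes from convexity of the
triangulation, through a matching of simplices as in discrete Morse theory (`isAcyclic_of_toggle`,
`isAcyclic_dualComplex`). Independence of the signature holds because every sign cocycle on the
poset of cells is a coboundary (`IsPairCocycle.exists_eq_mul`). -/

set_option linter.unusedSectionVars false

noncomputable section

namespace TropicalMirror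

/-! ### Signs of ordered finite sets -/

section OrderedProducts

variable {V : Type*} [Encodable V]

/-- The sign of the permutation that moves `v` to its place among the elements of `σ`. -/
def insertSign (v : V) (σ : Finset V) : ℤˣ :=
  (-1) ^ (σ.filter fun u => Encodable.encode u < Encodable.encode v).card

@[simp]
theorem insertSign_empty (v : V) : insertSign v ∅ = 1 := by
  simp [insertSign]

variable {A : Type*} [Ring A]

/-- The product of the elements `o v`, `v ∈ σ`, of a ring, in increasing order. -/
def orderedProd (o : V → A) (σ : Finset V) : A :=
  (((σ.image Encodable.encode).sort (· ≤ ·)).map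
    fun k => ((Encodable.decode k : Option V).map o).getD 1).prod

@[simp]
theorem orderedProd_empty (o : V → A) : orderedProd o ∅ = 1 := by
  simp [orderedProd]

variable [DecidableEq V]

theorem insertSign_insert_of_lt {u v : V} {σ : Finset V} (hu : u ∉ σ)
    (h : Encodable.encode u < Encodable.encode v) :
    insertSign v (insert u σ) = -insertSign v σ := by
  rw [insertSign, insertSign, Finset.filter_insert, if_pos h, Finset.card_insert_of_notMem
    (fun h' => hu (Finset.mem_filter.1 h').1), pow_succ, mul_neg_one]

theorem insertSign_insert_of_gt {u v : V} {σ : Finset V}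
    (h : Encodable.encode v < Encodable.encode u) :
    insertSign v (insert u σ) = insertSign v σ := by
  rw [insertSign, insertSign, Finset.filter_insert, if_neg h.not_gt]

/-- Exactly one of u, v precedes the other, so exactly one of the two orders of insertion counts one
more inversion. This is the source of every identity d² = 0 for simplicial coboundaries below. -/
theorem insertSign_mul_insertSign {u v : V} {σ : Finset V} (huv : u ≠ v) (hu : u ∉ σ)
    (hv : v ∉ σ) :
    insertSign u σ * insertSign v (insert u σ) =
      -(insertSign v σ * insertSign u (insert v σ)) := by
  rcases lt_or_gt_of_ne (fun h => huv (Encodable.encode_injective h)) with h | h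
  · rw [insertSign_insert_of_lt hu h, insertSign_insert_of_gt h, mul_neg, mul_comm]
  · rw [insertSign_insert_of_gt h, insertSign_insert_of_lt hv h, mul_neg, neg_neg, mul_comm]

theorem orderedProd_insert_of_lt (o : V → A) {v : V} {σ : Finset V}
    (h : ∀ u ∈ σ, Encodable.encode v < Encodable.encode u) :
    orderedProd o (insert v σ) = o v * orderedProd o σ := by
  rw [orderedProd, Finset.image_insert, Finset.sort_insert]
  · simp [orderedProd]
  · intro b hb
    obtain ⟨u, hu, rfl⟩ := Finset.mem_image.1 hb
    exact (h u hu).le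
  · intro hb
    obtain ⟨u, hu, h'⟩ := Finset.mem_image.1 hb
    exact absurd h' (h u hu).ne'

/-- To reach the front, the factor at v passes the factors of the smaller elements, each at the cost
of a sign. -/
theorem orderedProd_insert {o : V → A} (ho : ∀ u v, o u * o v = -(o v * o u)) {v : V}
    {σ : Finset V} (hv : v ∉ σ) :
    orderedProd o (insert v σ) = ((insertSign v σ : ℤˣ) : ℤ) • (o v * orderedProd o σ) := by
  induction σ using Finset.induction_on_min_value (Encodable.encode (α := V)) with
  | empty => rw [orderedProd_insert_of_lt o (by simp)]; simp
  | insert m s hm hmin ih =>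
    have hvm : v ≠ m := fun h => hv (h ▸ Finset.mem_insert_self _ _)
    have hvs : v ∉ s := fun h => hv (Finset.mem_insert_of_mem h)
    have hlt : ∀ u ∈ s, Encodable.encode m < Encodable.encode u := fun u hu =>
      lt_of_le_of_ne (hmin u hu) fun h => hm (Encodable.encode_injective h ▸ hu)
    rcases lt_or_gt_of_ne (fun h => hvm (Encodable.encode_injective h)) with h | h
    · rw [orderedProd_insert_of_lt, insertSign, Finset.filter_false_of_mem]
      · simp
      · intro u hu
        rcases Finset.mem_insert.1 hu with rfl | hu
        · exact h.not_gt
        · exact (h.trans (hlt u hu)).not_gt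
      · intro u hu
        rcases Finset.mem_insert.1 hu with rfl | hu
        · exact h
        · exact h.trans (hlt u hu)
    · rw [Finset.insert_comm, orderedProd_insert_of_lt o (v := m), ih hvs,
        insertSign_insert_of_lt hm h, orderedProd_insert_of_lt o hlt, ← mul_assoc, ho v m]
      · simp only [Units.val_neg, neg_smul, mul_smul_comm, neg_mul, smul_neg, mul_assoc, neg_neg]
      · intro u hu
        rcases Finset.mem_insert.1 hu with rfl | hu
        · exact h
        · exact hlt u hu

end OrderedProducts

/-! ### The Fock space of the extended lattice -/

/-- The rational extended lattice `ℚ^d × ℚ`. -/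
abbrev Extended (d : ℕ) : Type := (Fin d → ℚ) × ℚ

/-- The symmetric bilinear form `⟨(x, s), (y, t)⟩ = ⟨x, y⟩ - s t`. -/
def extendedForm (d : ℕ) : Extended d →ₗ[ℚ] Extended d →ₗ[ℚ] ℚ :=
  LinearMap.mk₂ ℚ (fun x y => x.1 ⬝ᵥ y.1 - x.2 * y.2)
    (by intro a b c; simp [add_dotProduct]; ring) (by intro a b c; simp; ring)
    (by intro a b c; simp [dotProduct_add]; ring) (by intro a b c; simp; ring)

/-- The exterior algebra of the extended lattice. -/
def Fock (d : ℕ) : Type := ExteriorAlgebra ℚ (Extended d)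

instance (d : ℕ) : Ring (Fock d) := inferInstanceAs (Ring (ExteriorAlgebra ℚ (Extended d)))

instance (d : ℕ) : Algebra ℚ (Fock d) :=
  inferInstanceAs (Algebra ℚ (ExteriorAlgebra ℚ (Extended d)))

instance (d : ℕ) : Nontrivial (Fock d) :=
  inferInstanceAs (Nontrivial (ExteriorAlgebra ℚ (Extended d)))

/-- The inclusion of the vectors. -/
def vec (d : ℕ) : Extended d →ₗ[ℚ] Fock d := ExteriorAlgebra.ι ℚ

section Fock

variable {d : ℕ}

theorem extendedForm_apply (x y : Extended d) : extendedForm d x y = x.1 ⬝ᵥ y.1 - x.2 * y.2 := rfl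

theorem extendedForm_comm (x y : Extended d) : extendedForm d x y = extendedForm d y x := by
  rw [extendedForm_apply, extendedForm_apply, dotProduct_comm, mul_comm]

/-- The operators of multiplication by vectors. -/
def wedge : Extended d →ₗ[ℚ] Module.End ℚ (Fock d) :=
  (LinearMap.mul ℚ (Fock d)) ∘ₗ vec d

/-- The operators of contraction with vectors. -/
def contract : Extended d →ₗ[ℚ] Module.End ℚ (Fock d) :=
  (CliffordAlgebra.contractLeft :
    _ →ₗ[ℚ] Module.End ℚ (ExteriorAlgebra ℚ (Extended d))) ∘ₗ extendedForm d

theorem wedge_apply (x : Extended d) (a : Fock d) : wedge x a = vec d x * a := rfl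

theorem wedge_wedge (x y : Extended d) (a : Fock d) : wedge x (wedge y a) = -wedge y (wedge x a) := by
  have h : vec d x * vec d y = -(vec d y * vec d x) :=
    eq_neg_of_add_eq_zero_left (ExteriorAlgebra.ι_add_mul_swap x y)
  rw [wedge_apply, wedge_apply, wedge_apply, wedge_apply, ← mul_assoc, h, neg_mul, mul_assoc]

theorem wedge_self (x : Extended d) (a : Fock d) : wedge x (wedge x a) = 0 := by
  rw [wedge_apply, wedge_apply, ← mul_assoc, show vec d x * vec d x = 0 from
    ExteriorAlgebra.ι_sq_zero x, zero_mul]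

theorem contract_contract (x y : Extended d) (a : Fock d) :
    contract x (contract y a) = -contract y (contract x a) :=
  CliffordAlgebra.contractLeft_comm _ _ _

theorem contract_self (x : Extended d) (a : Fock d) : contract x (contract x a) = 0 :=
  CliffordAlgebra.contractLeft_contractLeft _ _

theorem contract_wedge (x y : Extended d) (a : Fock d) :
    contract x (wedge y a) = extendedForm d x y • a - wedge y (contract x a) :=
  CliffordAlgebra.contractLeft_ι_mul _ _ _

theorem contract_one (x : Extended d) : contract x (1 : Fock d) = 0 :=
  CliffordAlgebra.contractLeft_one _ _

theorem contract_algebraMap (x : Extended d) (r : ℚ) :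
    contract x (algebraMap ℚ (Fock d) r) = 0 :=
  CliffordAlgebra.contractLeft_algebraMap _ _ r

theorem fock_induction {C : Fock d → Prop} (a : Fock d) (h1 : ∀ r, C (algebraMap ℚ (Fock d) r))
    (hadd : ∀ a b, C a → C b → C (a + b)) (hw : ∀ x a, C a → C (wedge x a)) : C a :=
  CliffordAlgebra.left_induction 0 (P := C) h1 hadd (fun a x h => hw x a h) a

/-- The standard basis vectors of the extended lattice. -/
def stdVec : Option (Fin d) → Extended d
  | none => (0, 1)
  | some i => (Pi.single i 1, 0)

/-- The square of a standard basis vector. -/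
def stdSq : Option (Fin d) → ℚ
  | none => -1
  | some _ => 1

theorem stdSq_mul_self (i : Option (Fin d)) : stdSq i * stdSq i = 1 := by
  cases i <;> simp [stdSq]

theorem extendedForm_stdVec (i j : Option (Fin d)) :
    extendedForm d (stdVec i) (stdVec j) = if i = j then stdSq i else 0 := by
  cases i <;> cases j <;>
    simp [extendedForm_apply, stdVec, stdSq, Pi.single_apply, eq_comm]

theorem sum_extendedForm_smul_stdVec (x : Extended d) :
    ∑ i, (stdSq i * extendedForm d (stdVec i) x) • stdVec i = x := by
  rw [Fintype.sum_option]
  ext j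
  · simp [stdVec, stdSq, extendedForm_apply, Finset.sum_apply, Prod.fst_sum, Pi.single_apply]
  · simp [stdVec, stdSq, extendedForm_apply, Prod.snd_sum]

/-- The operator whose eigenvalues are the degrees. -/
def euler (d : ℕ) : Module.End ℚ (Fock d) :=
  ∑ i, stdSq i • (wedge (stdVec i) * contract (stdVec i))

theorem euler_apply (a : Fock d) :
    euler d a = ∑ i, stdSq i • wedge (stdVec i) (contract (stdVec i) a) := by
  simp [euler, LinearMap.sum_apply]

/-- In the commutator of `euler` with multiplication by x, the Clifford relation leaves the
expansion of x in the standard orthogonal basis. -/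
theorem euler_wedge (x : Extended d) (a : Fock d) :
    euler d (wedge x a) = wedge x a + wedge x (euler d a) := by
  have h : ∀ i : Option (Fin d), stdSq i • wedge (stdVec i) (contract (stdVec i) (wedge x a)) =
      wedge ((stdSq i * extendedForm d (stdVec i) x) • stdVec i) a +
      wedge x (stdSq i • wedge (stdVec i) (contract (stdVec i) a)) := by
    intro i
    rw [contract_wedge, map_sub, wedge_wedge _ x]
    simp [mul_smul]
  rw [euler_apply, Finset.sum_congr rfl (fun i _ => h i), Finset.sum_add_distrib, ← map_sum,
    ← euler_apply]
  congr 1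
  rw [← LinearMap.sum_apply, ← map_sum, sum_extendedForm_smul_stdVec]

theorem euler_contract (x : Extended d) (a : Fock d) :
    euler d (contract x a) = contract x (euler d a) - contract x a := by
  have h : ∀ i : Option (Fin d), contract x (stdSq i • wedge (stdVec i) (contract (stdVec i) a)) =
      contract ((stdSq i * extendedForm d (stdVec i) x) • stdVec i) a +
      stdSq i • wedge (stdVec i) (contract (stdVec i) (contract x a)) := by
    intro i
    rw [map_smul, contract_wedge, contract_contract x, extendedForm_comm]
    simp [mul_smul]
  rw [euler_apply a, map_sum, Finset.sum_congr rfl (fun i _ => h i), Finset.sum_add_distrib,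
    ← euler_apply, ← LinearMap.sum_apply, ← map_sum, sum_extendedForm_smul_stdVec]
  abel

theorem euler_algebraMap (r : ℚ) : euler d (algebraMap ℚ (Fock d) r) = 0 := by
  simp [euler_apply, contract_algebraMap]

/-- The elements of degree `k`. -/
def degreePart (d : ℕ) (k : ℤ) : Submodule ℚ (Fock d) :=
  LinearMap.ker (euler d - (k : ℚ) • LinearMap.id)

theorem mem_degreePart {k : ℤ} {a : Fock d} : a ∈ degreePart d k ↔ euler d a = (k : ℚ) • a := by
  simp [degreePart, sub_eq_zero]

theorem wedge_mem_degreePart {k l : ℤ} (x : Extended d) {a : Fock d} (h : a ∈ degreePart d k)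
    (hl : l = k + 1) : wedge x a ∈ degreePart d l := by
  rw [mem_degreePart] at *
  rw [euler_wedge, h, hl, map_smul]
  push_cast
  module

theorem contract_mem_degreePart {k l : ℤ} (x : Extended d) {a : Fock d} (h : a ∈ degreePart d k)
    (hl : l = k - 1) : contract x a ∈ degreePart d l := by
  rw [mem_degreePart] at *
  rw [euler_contract, h, hl, map_smul]
  push_cast
  module

/-- The exterior power, as a subspace of the Fock space. -/
def powerPart (d p : ℕ) : Submodule ℚ (Fock d) := ⋀[ℚ]^p (Extended d)

theorem powerPart_le_degreePart (p : ℕ) : powerPart d p ≤ degreePart d p := by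
  induction p with
  | zero =>
    rw [powerPart, show (⋀[ℚ]^0 (Extended d)) = 1 from pow_zero _, Submodule.one_eq_range]
    rintro _ ⟨r, rfl⟩
    change algebraMap ℚ (Fock d) r ∈ degreePart d _
    rw [mem_degreePart]
    simpa using euler_algebraMap (d := d) r
  | succ p ih =>
    rw [powerPart, show (⋀[ℚ]^(p + 1) (Extended d)) =
      LinearMap.range (ExteriorAlgebra.ι ℚ) * ⋀[ℚ]^p (Extended d) from pow_succ' _ _]
    refine Submodule.mul_le.2 ?_
    rintro _ ⟨x, rfl⟩ b hb
    exact wedge_mem_degreePart x (ih hb) (by push_cast; rfl)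

theorem eq_zero_of_sum_exteriorPower_eq_zero {E : Type*} [AddCommGroup E] [Module ℚ E]
    {c : ℕ → ExteriorAlgebra ℚ E} (hc : ∀ i, c i ∈ ⋀[ℚ]^i E) {s : Finset ℕ}
    (h : ∑ i ∈ s, c i = 0) : ∀ i ∈ s, c i = 0 := by
  intro i hi
  have h1 : (DirectSum.decompose (fun i : ℕ => ⋀[ℚ]^i E) (∑ j ∈ s, c j) i :
      ExteriorAlgebra ℚ E) = 0 := by
    rw [h, DirectSum.decompose_zero]
    rfl
  rw [DirectSum.decompose_sum, DFinsupp.finsetSum_apply, AddSubmonoidClass.coe_finsetSum,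
    Finset.sum_eq_single i] at h1
  · rwa [DirectSum.decompose_of_mem_same (fun i : ℕ => ⋀[ℚ]^i E) (hc i)] at h1
  · intro j _ hj
    exact DirectSum.decompose_of_mem_ne (fun i : ℕ => ⋀[ℚ]^i E) (hc j) hj
  · intro h2
    exact absurd hi h2

theorem exists_sum_exteriorPower {E : Type*} [AddCommGroup E] [Module ℚ E]
    (a : ExteriorAlgebra ℚ E) : ∃ (c : ℕ → ExteriorAlgebra ℚ E) (s : Finset ℕ),
      (∀ i, c i ∈ ⋀[ℚ]^i E) ∧ ∑ i ∈ s, c i = a := by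
  classical
  have key : ∀ (𝒜 : ℕ → Submodule ℚ (ExteriorAlgebra ℚ E)) [DirectSum.Decomposition 𝒜],
      ∃ (c : ℕ → ExteriorAlgebra ℚ E) (s : Finset ℕ), (∀ i, c i ∈ 𝒜 i) ∧ ∑ i ∈ s, c i = a :=
    fun 𝒜 _ => ⟨fun i => DirectSum.decompose 𝒜 a i, _,
      fun i => (DirectSum.decompose 𝒜 a i).2, DirectSum.sum_support_decompose 𝒜 a⟩
  exact @key (fun i : ℕ => ⋀[ℚ]^i E) GradedRing.toDecomposition

/-- The component of degree i of an eigenvector of eigenvalue p is killed by i - p. With the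
opposite inclusion, degrees may be handled as eigenvalues, which makes sense for all integers and
needs only commutators. -/
theorem degreePart_le_powerPart (p : ℕ) : degreePart d p ≤ powerPart d p := by
  intro a h
  obtain ⟨c, s, hc, hs⟩ : ∃ (c : ℕ → Fock d) (s : Finset ℕ),
    (∀ i, c i ∈ powerPart d i) ∧ ∑ i ∈ s, c i = a := exists_sum_exteriorPower _
  have hE : euler d a = ∑ i ∈ s, (i : ℚ) • c i := by
    conv_lhs => rw [← hs, map_sum]
    refine Finset.sum_congr rfl fun i _ => ?_
    have := powerPart_le_degreePart i (hc i)
    rw [mem_degreePart] at this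
    exact_mod_cast this
  rw [mem_degreePart] at h
  have hz : ∑ i ∈ s, ((i : ℚ) - p) • c i = 0 := by
    simp only [sub_smul, Finset.sum_sub_distrib]
    rw [← Finset.smul_sum, hs, ← hE, h]
    simp
  have hzero : ∀ i ∈ s, ((i : ℚ) - p) • c i = 0 :=
    eq_zero_of_sum_exteriorPower_eq_zero (fun i => Submodule.smul_mem (powerPart d i) _ (hc i)) hz
  rw [← hs]
  refine Submodule.sum_mem _ fun i hi => ?_
  rcases smul_eq_zero.1 (hzero i hi) with h' | h'
  · have : i = p := by exact_mod_cast sub_eq_zero.1 h'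
    exact this ▸ hc i
  · rw [h']
    exact Submodule.zero_mem _

end Fock

/-! ### Products of multiplications and of contractions: images, kernels, dual systems. -/

section ProductsOfOperators

variable {V : Type*} [Encodable V] [DecidableEq V]

theorem mul_orderedProd {A : Type*} [Ring A] {o : V → A} (ho : ∀ u v, o u * o v = -(o v * o u))
    {y : A} {σ : Finset V} (hy : ∀ v ∈ σ, y * o v = -(o v * y)) :
    y * orderedProd o σ = (-1 : ℤ) ^ σ.card • (orderedProd o σ * y) := by
  induction σ using Finset.induction_on with
  | empty => simp
  | insert v s hv ih =>
    rw [orderedProd_insert ho hv, mul_smul_comm, ← mul_assoc, hy v (Finset.mem_insert_self _ _),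
      neg_mul, mul_assoc, ih fun u hu => hy u (Finset.mem_insert_of_mem hu),
      Finset.card_insert_of_notMem hv, pow_succ]
    simp only [mul_smul_comm, smul_mul_assoc, smul_neg, mul_neg_one, neg_smul, mul_assoc]
    rw [smul_comm]

variable {d : ℕ} (f : V → Extended d)

/-- The ordered product of the multiplication operators by the vectors `f v`, `v ∈ σ`. -/
def wedgeProd (σ : Finset V) : Module.End ℚ (Fock d) := orderedProd (fun v => wedge (f v)) σ

/-- The ordered product of the contraction operators with the vectors `f v`, `v ∈ σ`. -/
def contractProd (σ : Finset V) : Module.End ℚ (Fock d) := orderedProd (fun v => contract (f v)) σ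

theorem wedge_mul_wedge (x y : Extended d) : wedge x * wedge y = -(wedge y * wedge x) :=
  LinearMap.ext fun a => wedge_wedge x y a

theorem contract_mul_contract (x y : Extended d) :
    contract x * contract y = -(contract y * contract x) :=
  LinearMap.ext fun a => contract_contract x y a

theorem contract_mul_wedge {x y : Extended d} (h : extendedForm d x y = 0) :
    contract x * wedge y = -(wedge y * contract x) :=
  LinearMap.ext fun a => by simp [contract_wedge, h]

theorem wedge_mul_contract {x y : Extended d} (h : extendedForm d x y = 0) :
    wedge y * contract x = -(contract x * wedge y) := by
  rw [contract_mul_wedge h, neg_neg]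

@[simp]
theorem wedgeProd_empty : wedgeProd f ∅ = 1 := by
  rw [wedgeProd, orderedProd_empty]

@[simp]
theorem contractProd_empty : contractProd f ∅ = 1 := by
  rw [contractProd, orderedProd_empty]

variable {f} {σ : Finset V} {v : V}

theorem wedgeProd_insert (hv : v ∉ σ) (a : Fock d) : wedgeProd f (insert v σ) a =
    ((insertSign v σ : ℤˣ) : ℤ) • wedge (f v) (wedgeProd f σ a) := by
  rw [wedgeProd, orderedProd_insert (fun _ _ => wedge_mul_wedge _ _) hv]
  rfl

theorem contractProd_insert (hv : v ∉ σ) (a : Fock d) : contractProd f (insert v σ) a =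
    ((insertSign v σ : ℤˣ) : ℤ) • contract (f v) (contractProd f σ a) := by
  rw [contractProd, orderedProd_insert (fun _ _ => contract_mul_contract _ _) hv]
  rfl

theorem wedge_wedgeProd (x : Extended d) (a : Fock d) :
    wedge x (wedgeProd f σ a) = (-1 : ℤ) ^ σ.card • wedgeProd f σ (wedge x a) :=
  LinearMap.congr_fun (mul_orderedProd (fun _ _ => wedge_mul_wedge _ _)
    fun _ _ => wedge_mul_wedge _ _) a

theorem contract_contractProd (x : Extended d) (a : Fock d) :
    contract x (contractProd f σ a) = (-1 : ℤ) ^ σ.card • contractProd f σ (contract x a) :=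
  LinearMap.congr_fun (mul_orderedProd (fun _ _ => contract_mul_contract _ _)
    fun _ _ => contract_mul_contract _ _) a

theorem contract_wedgeProd {x : Extended d} (h : ∀ v ∈ σ, extendedForm d x (f v) = 0)
    (a : Fock d) :
    contract x (wedgeProd f σ a) = (-1 : ℤ) ^ σ.card • wedgeProd f σ (contract x a) :=
  LinearMap.congr_fun (mul_orderedProd (fun _ _ => wedge_mul_wedge _ _)
    fun v hv => contract_mul_wedge (h v hv)) a

theorem wedge_contractProd {x : Extended d} (h : ∀ v ∈ σ, extendedForm d (f v) x = 0)
    (a : Fock d) :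
    wedge x (contractProd f σ a) = (-1 : ℤ) ^ σ.card • contractProd f σ (wedge x a) :=
  LinearMap.congr_fun (mul_orderedProd (fun _ _ => contract_mul_contract _ _)
    fun v hv => wedge_mul_contract (h v hv)) a

theorem wedge_wedgeProd_of_mem (hv : v ∈ σ) (a : Fock d) : wedge (f v) (wedgeProd f σ a) = 0 := by
  obtain ⟨s, hs, rfl⟩ : ∃ s, v ∉ s ∧ insert v s = σ :=
    ⟨σ.erase v, Finset.notMem_erase _ _, Finset.insert_erase hv⟩
  rw [wedgeProd_insert hs, map_zsmul, wedge_self, smul_zero]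

theorem contract_contractProd_of_mem (hv : v ∈ σ) (a : Fock d) :
    contract (f v) (contractProd f σ a) = 0 := by
  obtain ⟨s, hs, rfl⟩ : ∃ s, v ∉ s ∧ insert v s = σ :=
    ⟨σ.erase v, Finset.notMem_erase _ _, Finset.insert_erase hv⟩
  rw [contractProd_insert hs, map_zsmul, contract_self, smul_zero]

/-- Contractions anticommute, so the factor at v can be applied first. -/
theorem contractProd_congr (hv : v ∈ σ) {a b : Fock d} (h : contract (f v) a = contract (f v) b) :
    contractProd f σ a = contractProd f σ b := by
  obtain ⟨s, hs, rfl⟩ : ∃ s, v ∉ s ∧ insert v s = σ :=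
    ⟨σ.erase v, Finset.notMem_erase _ _, Finset.insert_erase hv⟩
  rw [contractProd_insert hs, contractProd_insert hs, contract_contractProd, h,
    contract_contractProd]

theorem wedgeProd_mem_degreePart {k l : ℤ} {a : Fock d} (h : a ∈ degreePart d k)
    (hl : l = k + σ.card) : wedgeProd f σ a ∈ degreePart d l := by
  induction σ using Finset.induction_on generalizing l with
  | empty => simpa [hl] using h
  | insert v s hv ih =>
    rw [wedgeProd_insert hv]
    rw [Finset.card_insert_of_notMem hv] at hl
    exact zsmul_mem (wedge_mem_degreePart _ (ih rfl) (by push_cast at hl; linarith)) _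

theorem contractProd_mem_degreePart {k l : ℤ} {a : Fock d} (h : a ∈ degreePart d k)
    (hl : l = k - σ.card) : contractProd f σ a ∈ degreePart d l := by
  induction σ using Finset.induction_on generalizing l with
  | empty => simpa [hl] using h
  | insert v s hv ih =>
    rw [contractProd_insert hv]
    rw [Finset.card_insert_of_notMem hv] at hl
    exact zsmul_mem (contract_mem_degreePart _ (ih rfl) (by push_cast at hl; linarith)) _

variable {m : V → Extended d}

/-- The vectors `m u` form a system dual to the vectors `f v`, for `u`, `v` in `σ`. -/
def IsDualOn (m f : V → Extended d) (σ : Finset V) : Prop :=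
  ∀ u ∈ σ, ∀ v ∈ σ, extendedForm d (m u) (f v) = if u = v then 1 else 0

theorem IsDualOn.mono {s : Finset V} (h : IsDualOn m f σ) (hs : s ⊆ σ) : IsDualOn m f s :=
  fun u hu v hv => h u (hs hu) v (hs hv)

/-- The Clifford relation writes ⟨y, x⟩ a as a sum of two terms which vanish here. -/
theorem eq_zero_of_wedge_eq_zero {x y : Extended d} (h : extendedForm d y x ≠ 0) {a : Fock d}
    (hx : wedge x a = 0) (hy : contract y a = 0) : a = 0 := by
  have := contract_wedge y x a
  rw [hx, hy, map_zero, map_zero, sub_zero] at this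
  exact (smul_eq_zero.1 this.symm).resolve_left h

theorem eq_zero_of_wedgeProd_eq_zero (h : IsDualOn m f σ) {a : Fock d}
    (ha : ∀ u ∈ σ, contract (m u) a = 0) (h0 : wedgeProd f σ a = 0) : a = 0 := by
  induction σ using Finset.induction_on with
  | empty => simpa using h0
  | insert v s hv ih =>
    have hself := Finset.mem_insert_self v s
    refine ih (h.mono (Finset.subset_insert _ _))
      (fun u hu => ha u (Finset.mem_insert_of_mem hu)) ?_
    rw [wedgeProd_insert hv, ← Units.smul_def, smul_eq_zero_iff_eq] at h0
    refine eq_zero_of_wedge_eq_zero (y := m v) ?_ h0 ?_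
    · rw [h v hself v hself, if_pos rfl]
      exact one_ne_zero
    · rw [contract_wedgeProd, ha v hself, map_zero, smul_zero]
      intro u hu
      rw [h v hself u (Finset.mem_insert_of_mem hu), if_neg]
      rintro rfl
      exact hv hu

/-- Multiplying g by the dual vectors m v inverts the contractions. Since the preimage is a multiple
of g, it is killed by every multiplication that kills g; this is what keeps the condition coming
from α. -/
theorem exists_contractProd_eq (h : IsDualOn m f σ) {g : Fock d}
    (hg : ∀ v ∈ σ, contract (f v) g = 0) : ∃ a, contractProd f σ a = g ∧
      (∀ x, wedge x g = 0 → wedge x a = 0) ∧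
      ∀ k l : ℤ, g ∈ degreePart d k → l = k + σ.card → a ∈ degreePart d l := by
  induction σ using Finset.induction_on generalizing g with
  | empty => exact ⟨g, by simp, fun _ h => h, fun k l hk hl => by simpa [hl] using hk⟩
  | insert v s hv ih =>
    have hself := Finset.mem_insert_self v s
    obtain ⟨a, ha, hw, hdeg⟩ := ih (h.mono (Finset.subset_insert _ _))
      (g := ((insertSign v s : ℤˣ) : ℤ) • wedge (m v) g) (by
        intro u hu
        have huv : u ≠ v := fun h => hv (h ▸ hu)
        rw [map_zsmul, contract_wedge, extendedForm_comm,
          h v hself u (Finset.mem_insert_of_mem hu), if_neg huv.symm,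
          hg u (Finset.mem_insert_of_mem hu)]
        simp)
    refine ⟨a, ?_, ?_, ?_⟩
    · rw [contractProd_insert hv, ha, map_zsmul, smul_smul, ← Units.val_mul, Int.units_mul_self,
        contract_wedge, hg v hself, extendedForm_comm, h v hself v hself]
      simp
    · intro x hx
      refine hw x ?_
      rw [map_zsmul, wedge_wedge, hx]
      simp
    · intro k l hk hl
      refine hdeg (k + 1) l (zsmul_mem (wedge_mem_degreePart _ hk rfl) _) ?_
      rw [hl, Finset.card_insert_of_notMem hv]
      push_cast
      ring

theorem exists_wedgeProd_eq (h : IsDualOn m f σ) {g : Fock d}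
    (hg : ∀ v ∈ σ, wedge (f v) g = 0) : ∃ a, wedgeProd f σ a = g ∧
      ∀ k l : ℤ, g ∈ degreePart d k → l = k - σ.card → a ∈ degreePart d l := by
  induction σ using Finset.induction_on generalizing g with
  | empty => exact ⟨g, by simp, fun k l hk hl => by simpa [hl] using hk⟩
  | insert v s hv ih =>
    have hself := Finset.mem_insert_self v s
    obtain ⟨a, ha, hdeg⟩ := ih (h.mono (Finset.subset_insert _ _))
      (g := ((insertSign v s : ℤˣ) : ℤ) • contract (m v) g) (by
        intro u hu
        have huv : u ≠ v := fun h => hv (h ▸ hu)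
        have h1 := contract_wedge (m v) (f u) g
        rw [h v hself u (Finset.mem_insert_of_mem hu), if_neg huv.symm,
          hg u (Finset.mem_insert_of_mem hu), map_zero, zero_smul, zero_sub, eq_comm,
          neg_eq_zero] at h1
        rw [map_zsmul, h1, smul_zero])
    refine ⟨a, ?_, ?_⟩
    · have h1 := contract_wedge (m v) (f v) g
      rw [h v hself v hself, if_pos rfl, hg v hself, map_zero, one_smul, eq_comm,
        sub_eq_zero] at h1
      rw [wedgeProd_insert hv, ha, map_zsmul, smul_smul, ← Units.val_mul, Int.units_mul_self,
        ← h1, Units.val_one, one_smul]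
    · intro k l hk hl
      refine hdeg (k - 1) l (zsmul_mem (contract_mem_degreePart _ hk rfl) _) ?_
      rw [hl, Finset.card_insert_of_notMem hv]
      push_cast
      ring

/-- Every linear form is the pairing with a vector. -/
theorem exists_extendedForm_eq (φ : Extended d →ₗ[ℚ] ℚ) :
    ∃ m, ∀ x, extendedForm d m x = φ x := by
  refine ⟨∑ i, (stdSq i * φ (stdVec i)) • stdVec i, fun x => ?_⟩
  conv_rhs => rw [← sum_extendedForm_smul_stdVec x]
  rw [map_sum, map_sum, LinearMap.sum_apply]
  refine Finset.sum_congr rfl fun i _ => ?_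
  simp only [map_smul, LinearMap.smul_apply, smul_eq_mul]
  ring

/-- Extend the vectors to a basis and represent its coordinate forms by vectors; the form is
nondegenerate. -/
theorem exists_isDualOn (h : LinearIndepOn ℚ f (σ : Set V)) : ∃ m, IsDualOn m f σ := by
  have h' : LinearIndependent ℚ fun v : σ => f v := h
  let b := Module.Basis.extend h'.linearIndepOn_id
  have key : ∀ u : V, ∃ x : Extended d, u ∈ σ → ∀ v ∈ σ, extendedForm d x (f v) =
      if u = v then 1 else 0 := by
    intro u
    by_cases hu : u ∈ σ
    · obtain ⟨x, hx⟩ := exists_extendedForm_eq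
        (b.coord ⟨f u, Module.Basis.subset_extend _ ⟨⟨u, hu⟩, rfl⟩⟩)
      refine ⟨x, fun _ v hv => ?_⟩
      have hv' : f v = b ⟨f v, Module.Basis.subset_extend _ ⟨⟨v, hv⟩, rfl⟩⟩ := by
        rw [Module.Basis.extend_apply_self]
      rw [hx, hv', Module.Basis.coord_apply, Module.Basis.repr_self, Finsupp.single_apply]
      refine if_congr ?_ rfl rfl
      rw [Subtype.mk.injEq]
      constructor
      · intro h2
        exact (congrArg Subtype.val (h'.injective (a₁ := ⟨v, hv⟩) (a₂ := ⟨u, hu⟩) h2)).symm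
      · rintro rfl
        rfl
    · exact ⟨0, fun h => absurd h hu⟩
  choose m hm using key
  exact ⟨m, fun u hu => hm u hu⟩

/-- After contraction with f b, the terms f b in the differences contribute nothing. This passes
from the vertices of a simplex to its edge vectors at b. -/
theorem contract_contractProd_sub {b : V} (hb : b ∉ σ) (a : Fock d) :
    contract (f b) (contractProd (fun v => f v - f b) σ a) =
      contract (f b) (contractProd f σ a) := by
  induction σ using Finset.induction_on with
  | empty => simp
  | insert v s hv ih =>
    rw [contractProd_insert hv, contractProd_insert hv, map_zsmul, map_zsmul, map_sub,
      LinearMap.sub_apply, map_sub, contract_self, sub_zero, contract_contract,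
      ih fun h => hb (Finset.mem_insert_of_mem h), contract_contract (f b)]

/-- Induction for the elements of the kernel of a product of contractions: up to elements killed
by one of the factors, such an element is zero. -/
theorem mem_of_contractProd_eq_zero (h : IsDualOn m f σ) (X Y : Submodule ℚ (Fock d))
    (hX : ∀ v ∈ σ, ∀ a ∈ X, contract (f v) (wedge (m v) a) ∈ X)
    (hY : ∀ v ∈ σ, ∀ a ∈ X, contract (f v) a = 0 → a ∈ Y) {a : Fock d} (ha : a ∈ X)
    (h0 : contractProd f σ a = 0) : a ∈ Y := by
  induction σ using Finset.induction_on generalizing a with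
  | empty =>
    have : a = 0 := by simpa using h0
    rw [this]
    exact Y.zero_mem
  | insert v s hv ih =>
    have hself := Finset.mem_insert_self v s
    have h1 := contract_wedge (f v) (m v) a
    rw [extendedForm_comm, h v hself v hself, if_pos rfl, one_smul] at h1
    -- The Clifford relation for f v and its dual vector splits a into a part killed by f v and a
    -- part to which the induction hypothesis applies.
    have h2 : a = contract (f v) (wedge (m v) a) + wedge (m v) (contract (f v) a) := by
      rw [h1, sub_add_cancel]
    have h3 := hX v hself a ha
    have h4 : wedge (m v) (contract (f v) a) ∈ X := by
      have := X.sub_mem ha h3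
      rwa [h1, sub_sub_cancel] at this
    rw [h2]
    refine Y.add_mem (hY v hself _ h3 (contract_self _ _)) ?_
    refine ih (h.mono (Finset.subset_insert _ _))
      (fun u hu => hX u (Finset.mem_insert_of_mem hu))
      (fun u hu => hY u (Finset.mem_insert_of_mem hu)) h4 ?_
    rw [contractProd_insert hv, ← Units.smul_def, smul_eq_zero_iff_eq, contract_contractProd] at h0
    have h5 : contractProd f s (contract (f v) a) = 0 := by
      rcases neg_one_pow_eq_or ℤ s.card with h6 | h6 <;> rw [h6] at h0 <;> simpa using h0
    have h6 := wedge_contractProd (f := f) (σ := s) (x := m v) (by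
      intro u hu
      rw [extendedForm_comm, h v hself u (Finset.mem_insert_of_mem hu), if_neg]
      rintro rfl
      exact hv hu) (contract (f v) a)
    rw [h5, map_zero, eq_comm] at h6
    rcases neg_one_pow_eq_or ℤ s.card with h7 | h7 <;> rw [h7] at h6 <;> simpa using h6

end ProductsOfOperators

/-! ### The duality of the Fock space -/

section Star

variable {d : ℕ}

theorem isDualOn_stdVec : IsDualOn (fun i => stdSq i • stdVec i) (stdVec (d := d)) Finset.univ := by
  intro u _ v _
  rw [map_smul, LinearMap.smul_apply, extendedForm_stdVec]
  split_ifs with h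
  · rw [smul_eq_mul, stdSq_mul_self]
  · simp

/-- A volume form. -/
def volumeForm (d : ℕ) : Fock d := wedgeProd stdVec Finset.univ 1

theorem wedge_volumeForm (x : Extended d) : wedge x (volumeForm d) = 0 := by
  rw [← sum_extendedForm_smul_stdVec x, map_sum, LinearMap.sum_apply]
  refine Finset.sum_eq_zero fun i _ => ?_
  rw [map_smul, LinearMap.smul_apply, volumeForm, wedge_wedgeProd_of_mem (Finset.mem_univ _),
    smul_zero]

theorem volumeForm_ne_zero : volumeForm d ≠ 0 := fun h =>
  one_ne_zero (eq_zero_of_wedgeProd_eq_zero isDualOn_stdVec (fun _ _ => contract_one _) h)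

/-- The action of the Fock space on itself through contractions. -/
def contractHom (d : ℕ) : Fock d →ₐ[ℚ] Module.End ℚ (Fock d) :=
  ExteriorAlgebra.lift ℚ ⟨contract, fun x => LinearMap.ext fun a => contract_self x a⟩

theorem contractHom_wedge (x : Extended d) (a : Fock d) :
    contractHom d (wedge x a) = contract x * contractHom d a := by
  rw [wedge_apply, map_mul]
  congr 1
  exact ExteriorAlgebra.lift_ι_apply _ _ _ _

/-- The Hodge star operator, which exchanges multiplications and contractions. -/
def star (d : ℕ) : Module.End ℚ (Fock d) :=
  LinearMap.applyₗ (volumeForm d) ∘ₗ (contractHom d).toLinearMap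

theorem star_wedge (x : Extended d) (a : Fock d) : star d (wedge x a) = contract x (star d a) := by
  simp [star, contractHom_wedge]

theorem star_algebraMap (r : ℚ) : star d (algebraMap ℚ (Fock d) r) = r • volumeForm d := by
  simp [star]

/-- `star` turns multiplications into contractions by construction. Conversely, multiplication kills
the volume form as contraction kills scalars, and the Clifford relation is symmetric, so the claim
propagates from scalars to products. -/
theorem star_contract (x : Extended d) (a : Fock d) :
    star d (contract x a) = wedge x (star d a) := by
  induction a using fock_induction with
  | h1 r => rw [contract_algebraMap, star_algebraMap, map_zero, map_smul, wedge_volumeForm,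
      smul_zero]
  | hadd a b ha hb => rw [map_add, map_add, ha, hb, map_add, map_add]
  | hw y a ih =>
    rw [contract_wedge, star_wedge, map_sub, map_smul, star_wedge, ih, contract_wedge,
      extendedForm_comm]
    abel

theorem exists_algebraMap_of_contract_eq_zero {a : Fock d} (h : ∀ i, contract (stdVec i) a = 0) :
    ∃ r, algebraMap ℚ (Fock d) r = a := by
  have h0 : a ∈ degreePart d (0 : ℕ) := by
    rw [mem_degreePart, euler_apply]
    simp [h]
  have h1 := degreePart_le_powerPart 0 h0
  rw [powerPart, show (⋀[ℚ]^0 (Extended d)) = 1 from pow_zero _, Submodule.one_eq_range] at h1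
  exact h1

/-- The kernel is stable under contractions. Contracting a nonzero element with basis vectors as
long as the result is nonzero ends with a nonzero scalar in the kernel, whereas `star` maps scalars
to multiples of the nonzero volume form. -/
theorem star_injective : Function.Injective (star d) := by
  rw [injective_iff_map_eq_zero]
  intro a ha
  by_contra h0
  have key : ∀ s : Finset (Option (Fin d)), ∃ b, b ≠ 0 ∧ star d b = 0 ∧
      ∀ i ∈ s, contract (stdVec i) b = 0 := by
    intro s
    induction s using Finset.induction_on with
    | empty => exact ⟨a, h0, ha, by simp⟩
    | insert i s _ ih =>
      obtain ⟨b, hb, hb', hs⟩ := ih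
      by_cases h : contract (stdVec i) b = 0
      · exact ⟨b, hb, hb', fun j hj => (Finset.mem_insert.1 hj).elim (fun e => e ▸ h) (hs j)⟩
      · refine ⟨_, h, by rw [star_contract, hb', map_zero], fun j hj => ?_⟩
        rcases Finset.mem_insert.1 hj with rfl | hj
        · exact contract_self _ _
        · rw [contract_contract, hs j hj, map_zero, neg_zero]
  obtain ⟨b, hb, hb', h⟩ := key Finset.univ
  obtain ⟨r, rfl⟩ := exists_algebraMap_of_contract_eq_zero fun i => h i (Finset.mem_univ _)
  rw [star_algebraMap, smul_eq_zero] at hb'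
  rcases hb' with rfl | hb'
  · simp at hb
  · exact volumeForm_ne_zero hb'

/-- The square of `star` commutes with multiplications, so it is determined by its value at 1. That
value is killed by all contractions, hence a scalar, and it is nonzero by injectivity. -/
theorem star_surjective : Function.Surjective (star d) := by
  obtain ⟨r, hr⟩ := exists_algebraMap_of_contract_eq_zero (a := star d (star d 1)) (by
    intro i
    rw [← star_wedge, ← star_contract, contract_one, map_zero, map_zero])
  have hr0 : r ≠ 0 := by
    rintro rfl
    have h := star_injective (star_injective (a₂ := (0 : Fock d)) (a₁ := star d 1) (by
      rw [← hr, map_zero, map_zero]) |>.trans (map_zero (star d)).symm)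
    exact one_ne_zero h
  have h2 : ∀ a : Fock d, star d (star d a) = r • a := by
    intro a
    induction a using fock_induction with
    | h1 t =>
      rw [Algebra.algebraMap_eq_smul_one, map_smul, map_smul, ← hr, Algebra.algebraMap_eq_smul_one,
        smul_comm]
    | hadd a b ha hb => rw [map_add, map_add, ha, hb, smul_add]
    | hw y a ih => rw [star_wedge, star_contract, ih, map_smul]
  intro a
  exact ⟨star d (r⁻¹ • a), by rw [h2, smul_smul, mul_inv_cancel₀ hr0, one_smul]⟩

theorem euler_star (a : Fock d) : euler d (star d a) = (d + 1 : ℚ) • star d a - star d (euler d a) := by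
  have h : ∀ i : Option (Fin d), stdSq i • star d (wedge (stdVec i) (contract (stdVec i) a)) =
      star d a - stdSq i • wedge (stdVec i) (contract (stdVec i) (star d a)) := by
    intro i
    rw [star_wedge, star_contract, contract_wedge, extendedForm_stdVec, if_pos rfl, smul_sub,
      smul_smul, stdSq_mul_self, one_smul]
  rw [euler_apply a, map_sum]
  simp only [map_smul]
  rw [Finset.sum_congr rfl fun i _ => h i, Finset.sum_sub_distrib, ← euler_apply]
  simp [Finset.card_univ, ← Nat.cast_smul_eq_nsmul ℚ]

/-- By `euler_star`, conjugation by `star` turns `euler` into d + 1 - `euler`, the extended lattice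
having rank d + 1. -/
theorem star_mem_degreePart {k l : ℤ} {a : Fock d} (hl : l = d + 1 - k) :
    star d a ∈ degreePart d l ↔ a ∈ degreePart d k := by
  rw [mem_degreePart, mem_degreePart, euler_star, hl]
  constructor
  · intro h
    refine star_injective ?_
    rw [map_smul]
    have h' := congrArg (fun z => (d + 1 : ℚ) • star d a - z) h
    simp only [sub_sub_cancel] at h'
    rw [h']
    push_cast
    module
  · intro h
    rw [h, map_smul]
    push_cast
    module

end Star

/-! ### Complexes and quasi-isomorphisms -/

section Complexes

/-- Homology of `A₁ → A₀ → A` in the middle is computed by a larger complex if the quotient of the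
larger one by the smaller one is exact. -/
theorem rank_homology_eq_of_quotient_exact {A₁ A₀ A B₂ B₁ B₀ B : Type}
    [AddCommGroup A₁] [AddCommGroup A₀] [AddCommGroup A] [AddCommGroup B₂] [AddCommGroup B₁]
    [AddCommGroup B₀] [AddCommGroup B] [Module ℚ A₁] [Module ℚ A₀] [Module ℚ A] [Module ℚ B₂]
    [Module ℚ B₁] [Module ℚ B₀] [Module ℚ B]
    (a₁ : A₁ →ₗ[ℚ] A₀) (a₀ : A₀ →ₗ[ℚ] A) (b₂ : B₂ →ₗ[ℚ] B₁) (b₁ : B₁ →ₗ[ℚ] B₀) (b₀ : B₀ →ₗ[ℚ] B)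
    (φ₁ : A₁ →ₗ[ℚ] B₁) (φ₀ : A₀ →ₗ[ℚ] B₀) (φ : A →ₗ[ℚ] B)
    (hb₁ : ∀ x, b₁ (b₂ x) = 0) (hb₀ : ∀ x, b₀ (b₁ x) = 0)
    (h₁ : ∀ x, φ₀ (a₁ x) = b₁ (φ₁ x)) (h₀ : ∀ x, φ (a₀ x) = b₀ (φ₀ x))
    (hφ : Function.Injective φ) (hφ₀ : Function.Injective φ₀)
    (ex₀ : ∀ x z, b₀ x = φ z → ∃ s y, x = φ₀ s + b₁ y)
    (ex₁ : ∀ x z, b₁ x = φ₀ z → ∃ s y, x = φ₁ s + b₂ y) :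
    Module.rank ℚ (LinearMap.ker a₀ ⧸ (LinearMap.range a₁).comap (LinearMap.ker a₀).subtype) =
      Module.rank ℚ
        (LinearMap.ker b₀ ⧸ (LinearMap.range b₁).comap (LinearMap.ker b₀).subtype) := by
  have hker : ∀ x ∈ LinearMap.ker a₀, φ₀ x ∈ LinearMap.ker b₀ := by
    intro x hx
    rw [LinearMap.mem_ker] at *
    rw [← h₀, hx, map_zero]
  let ψ := ((LinearMap.range b₁).comap (LinearMap.ker b₀).subtype).mkQ ∘ₗ φ₀.restrict hker
  have hψ : Function.Surjective ψ := by
    intro y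
    obtain ⟨⟨y, hy⟩, rfl⟩ := Submodule.mkQ_surjective _ y
    obtain ⟨s, z, rfl⟩ := ex₀ y 0 (by rw [map_zero]; exact hy)
    have hs : s ∈ LinearMap.ker a₀ := by
      rw [LinearMap.mem_ker]
      apply hφ
      rw [LinearMap.mem_ker, map_add, hb₀, add_zero] at hy
      rw [h₀, hy, map_zero]
    refine ⟨⟨s, hs⟩, ?_⟩
    refine (Submodule.Quotient.eq _).2 ?_
    exact ⟨-z, by simp⟩
  have hk : LinearMap.ker ψ = (LinearMap.range a₁).comap (LinearMap.ker a₀).subtype := by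
    ext ⟨x, hx⟩
    rw [LinearMap.mem_ker, LinearMap.comp_apply, Submodule.mkQ_apply,
      Submodule.Quotient.mk_eq_zero]
    constructor
    · rintro ⟨y, hy⟩
      obtain ⟨s, z, rfl⟩ := ex₁ y x hy
      refine ⟨s, hφ₀ ?_⟩
      rw [map_add, hb₁, add_zero] at hy
      rw [h₁, hy]
      rfl
    · rintro ⟨y, hy⟩
      refine ⟨φ₁ y, ?_⟩
      rw [← h₁, hy]
      rfl
  rw [← hk]
  exact (ψ.quotKerEquivOfSurjective hψ).rank_eq

/-- A cochain complex given by graded subspaces of a fixed space with an endomorphism. -/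
structure SubComplex (W : Type) [AddCommGroup W] [Module ℚ W] where
  /-- the differential -/
  D : W →ₗ[ℚ] W
  /-- the graded pieces -/
  C : ℤ → Submodule ℚ W
  map_mem : ∀ k, ∀ x ∈ C k, D x ∈ C (k + 1)
  sq_zero : ∀ k, ∀ x ∈ C k, D (D x) = 0

namespace SubComplex

variable {W W' : Type} [AddCommGroup W] [Module ℚ W] [AddCommGroup W'] [Module ℚ W']

/-- The differential between graded pieces. -/
def d (X : SubComplex W) (k l : ℤ) (h : l = k + 1) : X.C k →ₗ[ℚ] X.C l :=
  X.D.restrict fun x hx => h ▸ X.map_mem k x hx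

/-- The dimension of the cohomology. -/
def rank (X : SubComplex W) (k : ℤ) : Cardinal :=
  Module.rank ℚ (LinearMap.ker (X.d k (k + 1) rfl) ⧸
    (LinearMap.range (X.d (k - 1) k (by ring))).comap
      (LinearMap.ker (X.d k (k + 1) rfl)).subtype)

/-- Here `hex` expresses that Y/φ(X) is exact; the long exact sequence then gives the same
cohomology. All comparisons of complexes below have this form. -/
theorem rank_eq (X : SubComplex W) (Y : SubComplex W') (φ : W →ₗ[ℚ] W')
    (hφ : ∀ k, ∀ x ∈ X.C k, φ x ∈ Y.C k) (hD : ∀ k, ∀ x ∈ X.C k, φ (X.D x) = Y.D (φ x))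
    (hinj : ∀ k, ∀ x ∈ X.C k, φ x = 0 → x = 0)
    (hex : ∀ k, ∀ x ∈ Y.C k, ∀ z ∈ X.C (k + 1), Y.D x = φ z →
      ∃ s ∈ X.C k, ∃ y ∈ Y.C (k - 1), x = φ s + Y.D y) (k : ℤ) : X.rank k = Y.rank k := by
  have hex' : ∀ k l m (hl : l = k + 1) (hm : k = m + 1) (x : Y.C k) (z : X.C l),
      Y.d k l hl x = φ.restrict (hφ l) z →
      ∃ (s : X.C k) (y : Y.C m), x = φ.restrict (hφ k) s + Y.d m k hm y := by
    intro k l m hl hm x z h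
    subst hl
    obtain rfl : m = k - 1 := by rw [hm]; ring
    obtain ⟨s, hs, y, hy, h'⟩ := hex k x x.2 z z.2 (congrArg Subtype.val h)
    exact ⟨⟨s, hs⟩, ⟨y, hy⟩, Subtype.ext h'⟩
  have hinj' : ∀ k, Function.Injective (φ.restrict (hφ k)) := by
    intro k
    rw [injective_iff_map_eq_zero]
    intro x hx
    exact Subtype.ext (hinj k x x.2 (congrArg Subtype.val hx))
  exact rank_homology_eq_of_quotient_exact _ _ (Y.d (k - 1 - 1) (k - 1) (by ring)) _ _
    (φ.restrict (hφ (k - 1))) (φ.restrict (hφ k)) (φ.restrict (hφ (k + 1)))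
    (fun x => Subtype.ext (Y.sq_zero _ _ x.2)) (fun x => Subtype.ext (Y.sq_zero _ _ x.2))
    (fun x => Subtype.ext (hD _ _ x.2)) (fun x => Subtype.ext (hD _ _ x.2))
    (hinj' _) (hinj' _) (hex' _ _ _ _ _) (hex' _ _ _ _ _)

end SubComplex

end Complexes

/-! ### Cochains on finite sets -/

section Cochains

variable {T F : Type} [DecidableEq T] [AddCommGroup F] [Module ℚ F]

open scoped Classical in
/-- The coboundary of a function on finite sets, cut off outside of `R`. -/
def coboundary (R : Set (Finset T)) (A : T → Finset T → Module.End ℚ F) :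
    (Finset T → F) →ₗ[ℚ] (Finset T → F) :=
  LinearMap.pi fun t =>
    if t ∈ R then ∑ e ∈ t, A e t ∘ₗ LinearMap.proj (t.erase e) else 0

theorem coboundary_apply {R : Set (Finset T)} (A : T → Finset T → Module.End ℚ F)
    (f : Finset T → F) {t : Finset T} (ht : t ∈ R) :
    coboundary R A f t = ∑ e ∈ t, A e t (f (t.erase e)) := by
  simp [coboundary, ht]

theorem coboundary_apply_of_notMem {R : Set (Finset T)} (A : T → Finset T → Module.End ℚ F)
    (f : Finset T → F) {t : Finset T} (ht : t ∉ R) : coboundary R A f t = 0 := by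
  simp [coboundary, ht]

theorem sum_erase_eq_zero {t : Finset T} (G : T → T → F)
    (h : ∀ e ∈ t, ∀ e' ∈ t, e ≠ e' → G e e' + G e' e = 0) :
    ∑ e ∈ t, ∑ e' ∈ t.erase e, G e e' = 0 := by
  have h1 : ∑ e ∈ t, ∑ e' ∈ t.erase e, G e e' = ∑ e ∈ t, ∑ e' ∈ t.erase e, G e' e := by
    refine Finset.sum_comm' fun x y => ?_
    simp only [Finset.mem_erase]
    constructor
    · rintro ⟨h1, h2, h3⟩
      exact ⟨⟨Ne.symm h2, h1⟩, h3⟩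
    · rintro ⟨⟨h1, h2⟩, h3⟩
      exact ⟨h2, Ne.symm h1, h3⟩
  -- The sum is equal to the one with the two indices exchanged, so its double vanishes term by
  -- term.
  have h2 : ∑ e ∈ t, ∑ e' ∈ t.erase e, G e e' + ∑ e ∈ t, ∑ e' ∈ t.erase e, G e e' = 0 := by
    conv_lhs => rw [h1]
    nth_rewrite 1 [← h1]
    rw [← Finset.sum_add_distrib]
    refine Finset.sum_eq_zero fun e he => ?_
    rw [← Finset.sum_add_distrib]
    refine Finset.sum_eq_zero fun e' he' => ?_
    exact h e he e' (Finset.mem_of_mem_erase he') (Finset.ne_of_mem_erase he').symm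
  rw [← two_smul ℚ] at h2
  exact (smul_eq_zero.1 h2).resolve_left two_ne_zero

/-- The two ways of removing e and e' cancel by `hA`. A face outside of R is cut off in the inner
coboundary, so one of the two ways could be lost; `hf` says that nothing was to be gained from such
a face. -/
theorem coboundary_coboundary {R : Set (Finset T)} {A : T → Finset T → Module.End ℚ F}
    {f : Finset T → F}
    (hA : ∀ t ∈ R, ∀ e ∈ t, ∀ e' ∈ t, e ≠ e' → ∀ x,
      A e t (A e' (t.erase e) x) + A e' t (A e (t.erase e') x) = 0)
    (hf : ∀ t ∈ R, ∀ e ∈ t, t.erase e ∉ R → ∀ e' ∈ t.erase e, f ((t.erase e).erase e') = 0) :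
    coboundary R A (coboundary R A f) = 0 := by
  funext t
  by_cases ht : t ∈ R
  · have h : ∀ e ∈ t, coboundary R A f (t.erase e) =
        ∑ e' ∈ t.erase e, A e' (t.erase e) (f ((t.erase e).erase e')) := by
      intro e he
      by_cases h : t.erase e ∈ R
      · rw [coboundary_apply A f h]
      · rw [coboundary_apply_of_notMem A f h]
        refine (Finset.sum_eq_zero fun e' he' => ?_).symm
        rw [hf t ht e he h e' he', map_zero]
    rw [coboundary_apply A _ ht, Finset.sum_congr rfl fun e he => by rw [h e he, map_sum]]
    refine sum_erase_eq_zero _ fun e he e' he' hne => ?_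
    rw [Finset.erase_right_comm (a := e') (b := e)]
    exact hA t ht e he e' he' hne _
  · exact coboundary_apply_of_notMem A _ ht

/-- The functions on finite sets, with values in given subspaces and with support in the sets in
`R` of given cardinality. -/
def sections (R : Set (Finset T)) (n : ℤ) (X : Finset T → Submodule ℚ F) :
    Submodule ℚ (Finset T → F) where
  carrier := {f | (∀ t, f t ∈ X t) ∧ ∀ t, ¬ (t ∈ R ∧ (t.card : ℤ) = n) → f t = 0}
  zero_mem' := ⟨fun _ => Submodule.zero_mem _, fun _ _ => rfl⟩
  add_mem' := fun hf hg => ⟨fun t => Submodule.add_mem _ (hf.1 t) (hg.1 t),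
    fun t ht => by rw [Pi.add_apply, hf.2 t ht, hg.2 t ht, add_zero]⟩
  smul_mem' := fun c f hf => ⟨fun t => Submodule.smul_mem _ c (hf.1 t),
    fun t ht => by rw [Pi.smul_apply, hf.2 t ht, smul_zero]⟩

variable {R : Set (Finset T)} {n m : ℤ} {X Y : Finset T → Submodule ℚ F} {f : Finset T → F}

theorem eq_zero_of_mem_sections (hf : f ∈ sections R n X) {t : Finset T} (ht : t ∉ R) :
    f t = 0 := hf.2 t fun h => ht h.1

theorem mem_sections_of (h : ∀ t ∈ R, (t.card : ℤ) = n → f t ∈ X t)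
    (h0 : ∀ t, ¬ (t ∈ R ∧ (t.card : ℤ) = n) → f t = 0) : f ∈ sections R n X := by
  refine ⟨fun t => ?_, h0⟩
  by_cases ht : t ∈ R ∧ (t.card : ℤ) = n
  · exact h t ht.1 ht.2
  · rw [h0 t ht]
    exact Submodule.zero_mem _

theorem coboundary_mem_sections {A : T → Finset T → Module.End ℚ F}
    (hf : f ∈ sections R n X)
    (hA : ∀ t ∈ R, ∀ e ∈ t, t.erase e ∈ R → ∀ x ∈ X (t.erase e), A e t x ∈ X t) :
    coboundary R A f ∈ sections R (n + 1) X := by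
  refine mem_sections_of (fun t ht _ => ?_) fun t ht => ?_
  · rw [coboundary_apply A f ht]
    refine Submodule.sum_mem _ fun e he => ?_
    by_cases h : t.erase e ∈ R
    · exact hA t ht e he h _ (hf.1 _)
    · rw [eq_zero_of_mem_sections hf h, map_zero]
      exact Submodule.zero_mem _
  · by_cases h : t ∈ R
    · rw [coboundary_apply A f h]
      refine Finset.sum_eq_zero fun e he => ?_
      rw [hf.2 (t.erase e), map_zero]
      rintro ⟨_, h2⟩
      refine ht ⟨h, ?_⟩
      rw [← h2, Finset.card_erase_of_mem he,
        Nat.cast_sub (Finset.card_pos.2 ⟨e, he⟩)]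
      push_cast
      ring
    · exact coboundary_apply_of_notMem A f h

end Cochains

/-! ### Lattice vectors at height one. -/

section LatticeVectors

/-- The lattice vectors. -/
abbrev Lat (d : ℕ) : Type := Fin d → ℤ

variable {d : ℕ}

/-- The lattice vector `v`, placed at height one in the extended lattice. -/
def lift (v : Lat d) : Extended d := (fun i => (v i : ℚ), 1)

/-- This is the purpose of the extra negative direction: u·v = 1 becomes orthogonality of the lifts,
while the lift of 0 pairs to -1 with every lift. -/
theorem extendedForm_lift (u v : Lat d) :
    extendedForm d (lift u) (lift v) = ((u ⬝ᵥ v : ℤ) : ℚ) - 1 := by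
  simp [extendedForm_apply, lift, dotProduct]

theorem extendedForm_lift_eq_zero {u v : Lat d} (h : u ⬝ᵥ v = 1) :
    extendedForm d (lift u) (lift v) = 0 := by
  rw [extendedForm_lift, h]
  simp

theorem extendedForm_lift_zero (v : Lat d) : extendedForm d (lift v) (lift 0) = -1 := by
  rw [extendedForm_lift, dotProduct_zero]
  simp

end LatticeVectors

/-! ### Combinatorial data of a mirror pair -/

section Combinatorial

variable {d : ℕ}

/-- The simplicial coboundary. -/
def simplicialCoboundary (f : Finset (Lat d) → Fock d) (σ : Finset (Lat d)) : Fock d :=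
  ∑ b ∈ σ, ((insertSign b (σ.erase b) : ℤˣ) : ℤ) • f (σ.erase b)

/-- A family of finite sets (containing the empty set) is acyclic if its augmented simplicial
cochain complex is exact. -/
def IsAcyclic (𝒦 : Set (Finset (Lat d))) : Prop :=
  ∀ (X : Submodule ℚ (Fock d)) (r : ℤ), ∀ f ∈ sections 𝒦 r fun _ => X,
    (∀ σ ∈ 𝒦, simplicialCoboundary f σ = 0) →
    ∃ k ∈ sections 𝒦 (r - 1) fun _ => X, ∀ σ ∈ 𝒦, f σ = simplicialCoboundary k σ

/-- The simplices `σ` that pair to one with the vertices of `α`. -/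
def dualComplex (K : Set (Finset (Lat d))) (α : Finset (Lat d)) : Set (Finset (Lat d)) :=
  {σ | σ.erase 0 ∈ K ∧ ∀ u ∈ α, ∀ b ∈ σ, u ⬝ᵥ b = 1}

/-- The combinatorial properties of the boundary complexes `K'`, `K` of central triangulations of
a reflexive polytope and its dual. -/
structure IsMirrorPair (K' K : Set (Finset (Lat d))) : Prop where
  empty_mem' : ∅ ∈ K'
  empty_mem : ∅ ∈ K
  zero_notMem' : ∀ α ∈ K', 0 ∉ α
  zero_notMem : ∀ β ∈ K, 0 ∉ β
  down_closed' : ∀ α ∈ K', ∀ α' ⊆ α, α' ∈ K'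
  down_closed : ∀ β ∈ K, ∀ β' ⊆ β, β' ∈ K
  dual' : ∀ α ∈ K', ∃ m, IsDualOn m lift (insert 0 α)
  dual : ∀ β ∈ K, ∃ m, IsDualOn m lift (insert 0 β)
  acyclic' : ∀ β ∈ K, IsAcyclic (dualComplex K' β)
  acyclic : ∀ α ∈ K', IsAcyclic (dualComplex K α)

variable {K' K : Set (Finset (Lat d))}

theorem IsMirrorPair.symm (h : IsMirrorPair K' K) : IsMirrorPair K K' where
  empty_mem' := h.empty_mem
  empty_mem := h.empty_mem'
  zero_notMem' := h.zero_notMem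
  zero_notMem := h.zero_notMem'
  down_closed' := h.down_closed
  down_closed := h.down_closed'
  dual' := h.dual
  dual := h.dual'
  acyclic' := h.acyclic
  acyclic := h.acyclic'

/-- A pair of finite sets of lattice vectors, encoded as a finite set. -/
abbrev Pairs (d : ℕ) : Type := Finset (Lat d ⊕ Lat d)

/-- The valid pairs: `α` in `K'`, `σ` in the cone over `K`, with all pairings equal to one. -/
def validPairs (K' K : Set (Finset (Lat d))) : Set (Pairs d) :=
  {t | t.toLeft ∈ K' ∧ t.toRight ∈ dualComplex K t.toLeft}

/-- The valid pairs with `σ` nonempty. -/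
def cellPairs (K' K : Set (Finset (Lat d))) : Set (Pairs d) :=
  {t | t ∈ validPairs K' K ∧ t.toRight ≠ ∅}

/-- The valid pairs with `0 ∉ σ`, not both empty. -/
def symmetricPairs (K' K : Set (Finset (Lat d))) : Set (Pairs d) :=
  {t | t ∈ validPairs K' K ∧ 0 ∉ t.toRight ∧ t ≠ ∅}

@[simp]
theorem toLeft_erase_inl (t : Pairs d) (u : Lat d) :
    (t.erase (Sum.inl u)).toLeft = t.toLeft.erase u := by ext; simp

@[simp]
theorem toRight_erase_inl (t : Pairs d) (u : Lat d) :
    (t.erase (Sum.inl u)).toRight = t.toRight := by ext; simp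

@[simp]
theorem toLeft_erase_inr (t : Pairs d) (u : Lat d) :
    (t.erase (Sum.inr u)).toLeft = t.toLeft := by ext; simp

@[simp]
theorem toRight_erase_inr (t : Pairs d) (u : Lat d) :
    (t.erase (Sum.inr u)).toRight = t.toRight.erase u := by ext; simp

theorem disjSum_erase_inl (α σ : Finset (Lat d)) (u : Lat d) :
    (α.disjSum σ).erase (Sum.inl u) = (α.erase u).disjSum σ := by ext (x | x) <;> simp

theorem disjSum_erase_inr (α σ : Finset (Lat d)) (u : Lat d) :
    (α.disjSum σ).erase (Sum.inr u) = α.disjSum (σ.erase u) := by ext (x | x) <;> simp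

theorem toLeft_mono {s t : Pairs d} (h : s ⊆ t) : s.toLeft ⊆ t.toLeft :=
  Finset.toLeft_subset_toLeft h

theorem toRight_mono {s t : Pairs d} (h : s ⊆ t) : s.toRight ⊆ t.toRight :=
  Finset.toRight_subset_toRight h

theorem validPairs_mono (h : IsMirrorPair K' K) {s t : Pairs d} (hst : s ⊆ t)
    (ht : t ∈ validPairs K' K) : s ∈ validPairs K' K :=
  ⟨h.down_closed' _ ht.1 _ (toLeft_mono hst),
    h.down_closed _ ht.2.1 _ (Finset.erase_subset_erase _ (toRight_mono hst)),
    fun u hu b hb => ht.2.2 u (toLeft_mono hst hu) b (toRight_mono hst hb)⟩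

theorem toLeft_eq_empty_of_zero_mem {t : Pairs d} (ht : t ∈ validPairs K' K)
    (h0 : 0 ∈ t.toRight) : t.toLeft = ∅ := by
  refine Finset.eq_empty_of_forall_notMem fun u hu => ?_
  have := ht.2.2 u hu 0 h0
  simp at this

/-- Because of this orthogonality, the multiplications by α and the contractions with σ anticommute,
which makes the mixed complexes complexes. -/
theorem form_eq_zero_of_valid {t : Pairs d} (ht : t ∈ validPairs K' K) {u b : Lat d}
    (hu : Sum.inl u ∈ t) (hb : Sum.inr b ∈ t) : extendedForm d (lift b) (lift u) = 0 := by
  rw [extendedForm_comm]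
  exact extendedForm_lift_eq_zero (ht.2.2 u (by simpa using hu) b (by simpa using hb))

/-! ### The coefficients -/

/-- The elements killed by the multiplication with the vectors in `α`. -/
def killedByWedge (α : Finset (Lat d)) : Submodule ℚ (Fock d) :=
  ⨅ u ∈ α, LinearMap.ker (wedge (lift u))

/-- The elements killed by the contraction with the vectors in `σ`. -/
def killedByContract (σ : Finset (Lat d)) : Submodule ℚ (Fock d) :=
  ⨅ b ∈ σ, LinearMap.ker (contract (lift b))

theorem mem_killedByWedge {α : Finset (Lat d)} {x : Fock d} :
    x ∈ killedByWedge α ↔ ∀ u ∈ α, wedge (lift u) x = 0 := by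
  simp [killedByWedge]

theorem mem_killedByContract {σ : Finset (Lat d)} {x : Fock d} :
    x ∈ killedByContract σ ↔ ∀ b ∈ σ, contract (lift b) x = 0 := by
  simp [killedByContract]

/-- Multiplication with vectors of `α`, contraction with vectors of `σ`. -/
def mixedOp : Lat d ⊕ Lat d → Pairs d → Module.End ℚ (Fock d)
  | Sum.inl u, _ => wedge (lift u)
  | Sum.inr b, _ => contract (lift b)

/-- The operators of the cellular complex of the ambient toric variety. -/
def cellOp : Lat d ⊕ Lat d → Pairs d → Module.End ℚ (Fock d)
  | Sum.inl u, t => ((-1 : ℤ) ^ t.toRight.card) • wedge (lift u)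
  | Sum.inr b, t => ((insertSign b (t.toRight.erase b) : ℤˣ) : ℤ) • 1

/-- The coefficients of the mixed complex. -/
def mixedCoeff (p : ℤ) (t : Pairs d) : Submodule ℚ (Fock d) :=
  degreePart d (p + 1 + t.toLeft.card - t.toRight.card) ⊓ killedByWedge t.toLeft ⊓
    killedByContract t.toRight

/-- The exterior powers of the tangent spaces. -/
def tangentCoeff (p : ℤ) (α : Finset (Lat d)) : Submodule ℚ (Fock d) :=
  degreePart d (p + 1 + α.card) ⊓ killedByWedge (insert 0 α)

theorem mixedOp_anticomm {t : Pairs d} (ht : t ∈ validPairs K' K) {e e' : Lat d ⊕ Lat d}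
    (he : e ∈ t) (he' : e' ∈ t) (s s' s'' s''' : Pairs d) (x : Fock d) :
    mixedOp e s (mixedOp e' s' x) + mixedOp e' s'' (mixedOp e s''' x) = 0 := by
  rcases e with u | b <;> rcases e' with u' | b' <;> simp only [mixedOp]
  · rw [wedge_wedge, neg_add_cancel]
  · rw [contract_wedge, form_eq_zero_of_valid ht he he']
    simp
  · rw [contract_wedge, form_eq_zero_of_valid ht he' he]
    simp
  · rw [contract_contract, neg_add_cancel]

theorem mixedOp_mem {p : ℤ} {t : Pairs d} (ht : t ∈ validPairs K' K) {e : Lat d ⊕ Lat d}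
    (he : e ∈ t) {x : Fock d} (hx : x ∈ mixedCoeff p (t.erase e)) (s : Pairs d) :
    mixedOp e s x ∈ mixedCoeff p t := by
  obtain ⟨⟨h1, h2⟩, h3⟩ := hx
  rw [SetLike.mem_coe, mem_killedByWedge] at h2
  rw [SetLike.mem_coe, mem_killedByContract] at h3
  rcases e with u | b
  · have hu : u ∈ t.toLeft := by simpa using he
    simp only [toLeft_erase_inl, toRight_erase_inl, Finset.card_erase_of_mem hu] at h1 h2 h3
    refine ⟨⟨wedge_mem_degreePart _ h1 ?_, ?_⟩, ?_⟩
    · rw [Nat.cast_sub (Finset.card_pos.2 ⟨u, hu⟩)]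
      push_cast
      ring
    · rw [SetLike.mem_coe, mem_killedByWedge]
      intro u' hu'
      change wedge (lift u') (wedge (lift u) x) = 0
      by_cases huu : u' = u
      · rw [huu, wedge_self]
      · rw [wedge_wedge, h2 u' (Finset.mem_erase.2 ⟨huu, hu'⟩), map_zero, neg_zero]
    · rw [SetLike.mem_coe, mem_killedByContract]
      intro b hb
      change contract (lift b) (wedge (lift u) x) = 0
      rw [contract_wedge, form_eq_zero_of_valid ht he (by simpa using hb), h3 b hb]
      simp
  · have hb : b ∈ t.toRight := by simpa using he
    simp only [toLeft_erase_inr, toRight_erase_inr, Finset.card_erase_of_mem hb] at h1 h2 h3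
    refine ⟨⟨contract_mem_degreePart _ h1 ?_, ?_⟩, ?_⟩
    · rw [Nat.cast_sub (Finset.card_pos.2 ⟨b, hb⟩)]
      push_cast
      ring
    · rw [SetLike.mem_coe, mem_killedByWedge]
      intro u hu
      change wedge (lift u) (contract (lift b) x) = 0
      have h4 := contract_wedge (lift b) (lift u) x
      rw [form_eq_zero_of_valid ht (by simpa using hu) he, h2 u hu] at h4
      simpa using h4
    · rw [SetLike.mem_coe, mem_killedByContract]
      intro b' hb'
      change contract (lift b') (contract (lift b) x) = 0
      by_cases hbb : b' = b
      · rw [hbb, contract_self]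
      · rw [contract_contract, h3 b' (Finset.mem_erase.2 ⟨hbb, hb'⟩), map_zero, neg_zero]

/-- These operators form a double complex. Multiplications anticommute by themselves, simplicial
signs by `insertSign_mul_insertSign`, and the factor (-1)^|σ| makes the two directions anticommute.
-/
theorem cellOp_anticomm (t : Pairs d) {e e' : Lat d ⊕ Lat d} (he : e ∈ t) (he' : e' ∈ t)
    (hne : e ≠ e') (x : Fock d) :
    cellOp e t (cellOp e' (t.erase e) x) + cellOp e' t (cellOp e (t.erase e') x) = 0 := by
  have hsign : ∀ b, b ∈ t.toRight →
      ((-1 : ℤ) ^ (t.toRight.erase b).card) = -(-1 : ℤ) ^ t.toRight.card := by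
    intro b hb
    rw [← Finset.card_erase_add_one hb, pow_succ]
    ring
  rcases e with u | b <;> rcases e' with u' | b' <;> simp only [cellOp, LinearMap.smul_apply,
    Module.End.one_apply, toRight_erase_inl, toRight_erase_inr, map_zsmul]
  · rw [wedge_wedge]
    simp
  · rw [hsign b' (by simpa using he'), smul_comm]
    simp
  · rw [hsign b (by simpa using he), smul_comm]
    simp
  · have hbb : b ≠ b' := fun h => hne (h ▸ rfl)
    have hb : b ∈ t.toRight := by simpa using he
    have hb' : b' ∈ t.toRight := by simpa using he'
    set s := (t.toRight.erase b).erase b' with hs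
    have h1 : t.toRight.erase b = insert b' s :=
      (Finset.insert_erase (Finset.mem_erase.2 ⟨hbb.symm, hb'⟩)).symm
    have h2 : t.toRight.erase b' = insert b s := by
      rw [hs, Finset.erase_right_comm, Finset.insert_erase (Finset.mem_erase.2 ⟨hbb, hb⟩)]
    have h3 : (t.toRight.erase b').erase b = s := by rw [hs, Finset.erase_right_comm]
    have h4 : b ∉ s := by simp [hs]
    have h5 : b' ∉ s := by simp [hs]
    rw [h3, h1, h2, smul_smul, smul_smul, ← add_smul, ← Units.val_mul, ← Units.val_mul,
      insertSign_mul_insertSign hbb.symm h5 h4]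
    simp

theorem cellOp_mem {p : ℤ} {t : Pairs d} {e : Lat d ⊕ Lat d}
    (he : e ∈ t) {x : Fock d} (hx : x ∈ tangentCoeff p (t.erase e).toLeft) :
    cellOp e t x ∈ tangentCoeff p t.toLeft := by
  obtain ⟨h1, h2⟩ := hx
  rw [SetLike.mem_coe, mem_killedByWedge] at h2
  rcases e with u | b
  · have hu : u ∈ t.toLeft := by simpa using he
    simp only [toLeft_erase_inl, Finset.card_erase_of_mem hu] at h1 h2
    refine zsmul_mem (K := tangentCoeff p t.toLeft) (Submodule.mem_inf.2
      ⟨wedge_mem_degreePart _ h1 ?_, ?_⟩) _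
    · rw [Nat.cast_sub (Finset.card_pos.2 ⟨u, hu⟩)]
      push_cast
      ring
    · rw [mem_killedByWedge]
      intro u' hu'
      by_cases huu : u' = u
      · rw [huu, wedge_self]
      · rw [wedge_wedge, h2 u', map_zero, neg_zero]
        rcases Finset.mem_insert.1 hu' with rfl | hu'
        · exact Finset.mem_insert_self _ _
        · exact Finset.mem_insert_of_mem (Finset.mem_erase.2 ⟨huu, hu'⟩)
  · simp only [toLeft_erase_inr] at h1 h2
    exact zsmul_mem (K := tangentCoeff p t.toLeft) (Submodule.mem_inf.2
      ⟨h1, mem_killedByWedge.2 h2⟩) _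

theorem sum_pairs {A : Type*} [AddCommMonoid A] (t : Pairs d) (F : Lat d ⊕ Lat d → A) :
    ∑ e ∈ t, F e = ∑ u ∈ t.toLeft, F (Sum.inl u) + ∑ b ∈ t.toRight, F (Sum.inr b) := by
  conv_lhs => rw [← Finset.toLeft_disjSum_toRight (u := t)]
  exact Finset.sum_disjSum _ _ _

/-! ### The mixed complexes -/

/-- The coefficients of the mixed complex on all valid pairs. -/
def augmentedCoeff (p : ℤ) (t : Pairs d) : Submodule ℚ (Fock d) where
  carrier := {x | x ∈ mixedCoeff p t ∧ (t.toRight = ∅ → wedge (lift 0) x = 0)}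
  zero_mem' := ⟨Submodule.zero_mem _, fun _ => map_zero _⟩
  add_mem' := fun h h' => ⟨Submodule.add_mem _ h.1 h'.1, fun e => by
    rw [map_add, h.2 e, h'.2 e, add_zero]⟩
  smul_mem' := fun c x h => ⟨Submodule.smul_mem _ c h.1, fun e => by
    rw [map_smul, h.2 e, smul_zero]⟩

/-- The coefficients of the symmetric complex. -/
def symmetricCoeff (p : ℤ) (t : Pairs d) : Submodule ℚ (Fock d) where
  carrier := {x | x ∈ mixedCoeff p t ∧ (t.toRight = ∅ → wedge (lift 0) x = 0) ∧
    (t.toLeft = ∅ → contract (lift 0) x = 0)}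
  zero_mem' := ⟨Submodule.zero_mem _, fun _ => map_zero _, fun _ => map_zero _⟩
  add_mem' := fun h h' => ⟨Submodule.add_mem _ h.1 h'.1, fun e => by
    rw [map_add, h.2.1 e, h'.2.1 e, add_zero], fun e => by
    rw [map_add, h.2.2 e, h'.2.2 e, add_zero]⟩
  smul_mem' := fun c x h => ⟨Submodule.smul_mem _ c h.1, fun e => by
    rw [map_smul, h.2.1 e, smul_zero], fun e => by
    rw [map_smul, h.2.2 e, smul_zero]⟩

theorem mixedOp_mem_augmentedCoeff {p : ℤ} {t : Pairs d} (ht : t ∈ validPairs K' K)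
    {e : Lat d ⊕ Lat d} (he : e ∈ t) {x : Fock d} (hx : x ∈ augmentedCoeff p (t.erase e))
    (s : Pairs d) : mixedOp e s x ∈ augmentedCoeff p t := by
  refine ⟨mixedOp_mem ht he hx.1 s, fun h => ?_⟩
  rcases e with u | b
  · change wedge (lift 0) (wedge (lift u) x) = 0
    rw [wedge_wedge, hx.2 (by simpa using h), map_zero, neg_zero]
  · have : b ∈ t.toRight := by simpa using he
    rw [h] at this
    exact absurd this (Finset.notMem_empty _)

theorem mixedOp_mem_symmetricCoeff {p : ℤ} {t : Pairs d} (ht : t ∈ validPairs K' K)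
    {e : Lat d ⊕ Lat d} (he : e ∈ t) {x : Fock d} (hx : x ∈ symmetricCoeff p (t.erase e))
    (s : Pairs d) : mixedOp e s x ∈ symmetricCoeff p t := by
  have h1 := mixedOp_mem_augmentedCoeff ht he (x := x) ⟨hx.1, hx.2.1⟩ s
  refine ⟨h1.1, h1.2, fun h => ?_⟩
  rcases e with u | b
  · have : u ∈ t.toLeft := by simpa using he
    rw [h] at this
    exact absurd this (Finset.notMem_empty _)
  · change contract (lift 0) (contract (lift b) x) = 0
    rw [contract_contract, hx.2.2 (by simpa using h), map_zero, neg_zero]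

theorem erase_empty_or (t : Pairs d) (ht : t ∈ validPairs K' K) (hK : IsMirrorPair K' K)
    {e : Lat d ⊕ Lat d} (h : t.erase e ∉ cellPairs K' K) : (t.erase e).toRight = ∅ := by
  by_contra h'
  exact h ⟨validPairs_mono hK (Finset.erase_subset _ _) ht, h'⟩

variable (hK : IsMirrorPair K' K)

/-- The mixed complex on all valid pairs. -/
def augmentedComplex (hK : IsMirrorPair K' K) (p : ℤ) : SubComplex (Pairs d → Fock d) where
  D := coboundary (validPairs K' K) mixedOp
  -- The shift by one is that of the target in the mapping cone `coneComplex`, so that the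
  -- comparison maps preserve k.
  C k := sections (validPairs K' K) (k - 1) (augmentedCoeff p)
  map_mem k f hf := by
    rw [add_sub_right_comm]
    exact coboundary_mem_sections hf fun t ht e he _ x hx => mixedOp_mem_augmentedCoeff ht he hx t
  sq_zero k f hf := coboundary_coboundary
    (fun t ht e he e' he' _ x => mixedOp_anticomm ht he he' _ _ _ _ x)
    fun t ht e _ h => absurd (validPairs_mono hK (Finset.erase_subset _ _) ht) h

/-- The mixed complex on the symmetric pairs. -/
def symmetricComplex (hK : IsMirrorPair K' K) (p : ℤ) : SubComplex (Pairs d → Fock d) where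
  D := coboundary (symmetricPairs K' K) mixedOp
  C k := sections (symmetricPairs K' K) (k - 1) (symmetricCoeff p)
  map_mem k f hf := by
    rw [add_sub_right_comm]
    exact coboundary_mem_sections hf fun t ht e he _ x hx =>
      mixedOp_mem_symmetricCoeff ht.1 he hx t
  sq_zero k f hf := by
    refine coboundary_coboundary
      (fun t ht e he e' he' _ x => mixedOp_anticomm ht.1 he he' _ _ _ _ x) ?_
    intro t ht e he h e' he'
    -- The only excluded face of a symmetric pair is the empty pair, which has no faces itself.
    have h1 : t.erase e = ∅ := by
      by_contra h2
      exact h ⟨validPairs_mono hK (Finset.erase_subset _ _) ht.1,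
        fun h3 => ht.2.1 (toRight_mono (Finset.erase_subset _ _) h3), h2⟩
    rw [h1] at he'
    exact absurd he' (Finset.notMem_empty _)

open scoped Classical in
/-- The map from the cellular complex of the ambient toric variety to the mixed complex. -/
def contractMap (K' K : Set (Finset (Lat d))) : (Pairs d → Fock d) →ₗ[ℚ] (Pairs d → Fock d) :=
  LinearMap.pi fun t =>
    if t ∈ cellPairs K' K then contractProd lift t.toRight ∘ₗ LinearMap.proj t else 0

theorem contractMap_apply {t : Pairs d} (ht : t ∈ cellPairs K' K) (f : Pairs d → Fock d) :
    contractMap K' K f t = contractProd lift t.toRight (f t) := by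
  simp [contractMap, ht]

theorem contractMap_apply_of_notMem {t : Pairs d} (ht : t ∉ cellPairs K' K)
    (f : Pairs d → Fock d) : contractMap K' K f t = 0 := by
  simp [contractMap, ht]

theorem contractProd_mem_mixedCoeff {p : ℤ} {t : Pairs d} (ht : t ∈ validPairs K' K)
    {x : Fock d} (hx : x ∈ tangentCoeff p t.toLeft) :
    contractProd lift t.toRight x ∈ mixedCoeff p t := by
  have h2 := mem_killedByWedge.1 hx.2
  refine ⟨⟨contractProd_mem_degreePart hx.1 rfl, ?_⟩, ?_⟩
  · rw [SetLike.mem_coe, mem_killedByWedge]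
    intro u hu
    rw [wedge_contractProd fun b hb => form_eq_zero_of_valid ht (by simpa using hu)
      (by simpa using hb), h2 u (Finset.mem_insert_of_mem hu), map_zero, smul_zero]
  · rw [SetLike.mem_coe, mem_killedByContract]
    exact fun b hb => contract_contractProd_of_mem hb _

/-- Moving a multiplication past the |σ| contractions costs the sign (-1)^|σ| built into `cellOp`;
adding b to σ multiplies the product of contractions by the contraction with b and the sign
`insertSign`. -/
theorem contractMap_coboundary {f : Pairs d → Fock d} (h0 : ∀ t ∉ cellPairs K' K, f t = 0) :
    contractMap K' K (coboundary (cellPairs K' K) cellOp f) =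
      coboundary (cellPairs K' K) mixedOp (contractMap K' K f) := by
  funext t
  by_cases ht : t ∈ cellPairs K' K
  swap
  · rw [contractMap_apply_of_notMem ht, coboundary_apply_of_notMem _ _ ht]
  have hc : ∀ s, contractMap K' K f s = contractProd lift s.toRight (f s) := by
    intro s
    by_cases hs : s ∈ cellPairs K' K
    · exact contractMap_apply hs f
    · rw [contractMap_apply_of_notMem hs, h0 s hs, map_zero]
  rw [contractMap_apply ht, coboundary_apply _ _ ht, coboundary_apply _ _ ht, map_sum]
  refine Finset.sum_congr rfl fun e he => ?_
  rw [hc]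
  rcases e with u | b
  · simp only [cellOp, mixedOp, LinearMap.smul_apply, toRight_erase_inl, map_zsmul]
    rw [wedge_contractProd fun b hb => form_eq_zero_of_valid ht.1 he (by simpa using hb)]
  · have hb : b ∈ t.toRight := by simpa using he
    simp only [cellOp, mixedOp, LinearMap.smul_apply, toRight_erase_inr, map_zsmul,
      Module.End.one_apply]
    conv_lhs => rw [← Finset.insert_erase hb]
    rw [contractProd_insert (Finset.notMem_erase _ _), Finset.erase_insert (Finset.notMem_erase _ _),
      smul_smul, ← Units.val_mul, Int.units_mul_self, Units.val_one, one_smul]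

/-- The mapping cone of the map from the cellular complex to the mixed complex. -/
def coneComplex (hK : IsMirrorPair K' K) (p : ℤ) :
    SubComplex ((Pairs d → Fock d) × (Pairs d → Fock d)) where
  D := LinearMap.prod (-(coboundary (cellPairs K' K) cellOp ∘ₗ LinearMap.fst ℚ _ _))
    (contractMap K' K ∘ₗ LinearMap.fst ℚ _ _ +
      coboundary (cellPairs K' K) mixedOp ∘ₗ LinearMap.snd ℚ _ _)
  C k := (sections (cellPairs K' K) k fun t => tangentCoeff p t.toLeft).prod
    (sections (cellPairs K' K) (k - 1) (mixedCoeff p))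
  map_mem k x hx := by
    refine ⟨neg_mem (coboundary_mem_sections hx.1 fun t _ e he _ y hy => cellOp_mem he hy),
      add_mem ?_ ?_⟩
    · refine mem_sections_of (fun t ht _ => ?_) fun t ht => ?_
      · rw [LinearMap.comp_apply, contractMap_apply ht]
        exact contractProd_mem_mixedCoeff ht.1 (hx.1.1 t)
      · rw [LinearMap.comp_apply]
        by_cases h : t ∈ cellPairs K' K
        · rw [contractMap_apply h]
          change contractProd lift t.toRight (x.1 t) = 0
          rw [hx.1.2 t fun h' => ht ⟨h, by rw [h'.2]; ring⟩, map_zero]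
        · exact contractMap_apply_of_notMem h _
    · rw [add_sub_right_comm]
      exact coboundary_mem_sections hx.2 fun t ht e he _ y hy => mixedOp_mem ht.1 he hy t
  sq_zero k x hx := by
    have h1 : ∀ y : Pairs d → Fock d, (∀ t ∉ cellPairs K' K, y t = 0) →
        ∀ t ∈ cellPairs K' K, ∀ e ∈ t, t.erase e ∉ cellPairs K' K →
          ∀ e' ∈ t.erase e, y ((t.erase e).erase e') = 0 := by
      intro y hy t ht e he h e' he'
      refine hy _ fun h2 => h2.2 ?_
      exact Finset.subset_empty.1
        ((toRight_mono (Finset.erase_subset _ _)).trans_eq (erase_empty_or t ht.1 hK h))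
    have h2 : coboundary (cellPairs K' K) cellOp (coboundary (cellPairs K' K) cellOp x.1) = 0 :=
      coboundary_coboundary (fun t _ e he e' he' hne y => cellOp_anticomm t he he' hne y)
        (h1 _ fun t ht => eq_zero_of_mem_sections hx.1 ht)
    have h3 : coboundary (cellPairs K' K) mixedOp (coboundary (cellPairs K' K) mixedOp x.2) = 0 :=
      coboundary_coboundary (fun t ht e he e' he' _ y => mixedOp_anticomm ht.1 he he' _ _ _ _ y)
        (h1 _ fun t ht => eq_zero_of_mem_sections hx.2 ht)
    have h4 := contractMap_coboundary (f := x.1) fun t ht => eq_zero_of_mem_sections hx.1 ht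
    ext1 <;> simp [h2, h3, h4]

end Combinatorial

/-! ### Surjectivity of the contraction map, removal of the pairs containing 0, and the mirror
exchange. -/

section Comparison

variable {d : ℕ} {K' K : Set (Finset (Lat d))} (hK : IsMirrorPair K' K) {p : ℤ}

include hK

theorem exists_isDualOn_toRight {t : Pairs d} (ht : t ∈ validPairs K' K) :
    ∃ m, IsDualOn m lift (insert 0 (t.toRight)) := by
  obtain ⟨m, hm⟩ := hK.dual _ ht.2.1
  refine ⟨m, hm.mono fun b hb => ?_⟩
  by_cases h : b = 0
  · exact h ▸ Finset.mem_insert_self _ _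
  · exact Finset.mem_insert_of_mem
      (Finset.mem_erase.2 ⟨h, (Finset.mem_insert.1 hb).resolve_left h⟩)

/-- Inverting the contractions gives some a, which need not be killed by `lift 0`. For b ∈ σ, the
element -`lift 0` ∧ (b ⌟ a) is killed by it and has the same contraction with b, as ⟨`lift b`, `lift
0`⟩ = -1; so it has the same image. The argument needs σ nonempty. -/
theorem exists_tangentCoeff_contractProd_eq {t : Pairs d} (ht : t ∈ cellPairs K' K) {g : Fock d}
    (hg : g ∈ mixedCoeff p t) :
    ∃ f ∈ tangentCoeff p t.toLeft, contractProd lift t.toRight f = g := by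
  obtain ⟨m, hm⟩ := exists_isDualOn_toRight hK ht.1
  obtain ⟨a, ha, hw, hdeg⟩ := exists_contractProd_eq (hm.mono (Finset.subset_insert _ _))
    (mem_killedByContract.1 hg.2)
  obtain ⟨b, hb⟩ := Finset.nonempty_iff_ne_empty.2 ht.2
  have hdega := hdeg _ (p + 1 + t.toLeft.card) hg.1.1 (by ring)
  refine ⟨-wedge (lift 0) (contract (lift b) a), Submodule.neg_mem _ (Submodule.mem_inf.2
    ⟨wedge_mem_degreePart _ (contract_mem_degreePart _ hdega rfl) (by ring), ?_⟩), ?_⟩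
  · rw [mem_killedByWedge]
    intro u hu
    rcases Finset.mem_insert.1 hu with rfl | hu
    · exact wedge_self _ _
    · have h1 := contract_wedge (lift b) (lift u) a
      rw [hw _ (mem_killedByWedge.1 hg.1.2 u hu), map_zero,
        form_eq_zero_of_valid ht.1 (by simpa using hu) (by simpa using hb), zero_smul, zero_sub,
        eq_comm, neg_eq_zero] at h1
      rw [wedge_wedge, h1, map_zero, neg_zero]
  · rw [← ha]
    refine contractProd_congr hb ?_
    rw [map_neg, contract_wedge, extendedForm_lift_zero, contract_self]
    simp

/-- Since the contraction map is onto, the second component of an element of the cone can be removed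
by a boundary. So the cone computes the cohomology of the kernel. -/
theorem exists_coneComplex_reduction {k : ℤ} {x : (Pairs d → Fock d) × (Pairs d → Fock d)}
    (hx : x ∈ (coneComplex hK p).C k) : ∃ y ∈ (coneComplex hK p).C (k - 1),
      (x - (coneComplex hK p).D y).2 = 0 := by
  classical
  have key : ∀ t, ∃ f : Fock d, (t ∈ cellPairs K' K → f ∈ tangentCoeff p t.toLeft ∧
      contractProd lift t.toRight f = x.2 t) ∧
      (¬ (t ∈ cellPairs K' K ∧ (t.card : ℤ) = k - 1) → f = 0) := by
    intro t
    by_cases ht : t ∈ cellPairs K' K ∧ (t.card : ℤ) = k - 1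
    · obtain ⟨f, hf⟩ := exists_tangentCoeff_contractProd_eq hK ht.1 (hx.2.1 t)
      exact ⟨f, fun _ => hf, fun h => absurd ht h⟩
    · exact ⟨0, fun _ => ⟨Submodule.zero_mem _, by rw [hx.2.2 t ht, map_zero]⟩, fun _ => rfl⟩
  choose f hf hf0 using key
  refine ⟨(f, 0), ⟨mem_sections_of (fun t ht _ => (hf t ht).1) hf0, Submodule.zero_mem _⟩, ?_⟩
  funext t
  change x.2 t - (contractMap K' K f + coboundary (cellPairs K' K) mixedOp 0) t = 0
  rw [map_zero, add_zero]
  by_cases ht : t ∈ cellPairs K' K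
  · rw [contractMap_apply ht, (hf t ht).2, sub_self]
  · rw [contractMap_apply_of_notMem ht, eq_zero_of_mem_sections hx.2 ht, sub_zero]

omit hK in
theorem coneComplex_snd_D (hK : IsMirrorPair K' K) (x : (Pairs d → Fock d) × (Pairs d → Fock d))
    (hx : x.2 = 0) : ((coneComplex hK p).D x).2 = contractMap K' K x.1 := by
  change contractMap K' K x.1 + coboundary (cellPairs K' K) mixedOp x.2 = _
  rw [hx, map_zero, add_zero]

/-! ### The symmetric complex and the augmented complex -/

/-- Multiply g by a vector n dual to `lift 0` and orthogonal to σ. For σ = ∅ the result must also be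
killed by `lift 0`, which is achieved by n = -`lift 0`, because ⟨`lift 0`, `lift 0`⟩ = -1. -/
theorem exists_augmented_lift {t : Pairs d} (ht : t ∈ validPairs K' K) (hl : t.toLeft = ∅)
    (h0 : 0 ∉ t.toRight) {g : Fock d}
    (hg : g ∈ mixedCoeff p (insert (Sum.inr 0) t)) :
    ∃ a ∈ augmentedCoeff p t, contract (lift 0) a = g := by
  obtain ⟨m, hm⟩ := exists_isDualOn_toRight hK ht
  obtain ⟨n, hn0, hn, hn'⟩ : ∃ n, extendedForm d (lift 0) n = 1 ∧
      (∀ b ∈ t.toRight, extendedForm d (lift b) n = 0) ∧ (t.toRight = ∅ → n = -lift 0) := by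
    by_cases h : t.toRight = ∅
    · refine ⟨-lift 0, ?_, ?_, fun _ => rfl⟩
      · rw [map_neg, extendedForm_lift_zero, neg_neg]
      · simp [h]
    · refine ⟨m 0, ?_, ?_, fun h' => absurd h' h⟩
      · rw [extendedForm_comm, hm 0 (Finset.mem_insert_self _ _) 0 (Finset.mem_insert_self _ _),
          if_pos rfl]
      · intro b hb
        rw [extendedForm_comm, hm 0 (Finset.mem_insert_self _ _) b (Finset.mem_insert_of_mem hb),
          if_neg]
        rintro rfl
        exact h0 hb
  obtain ⟨⟨h1, -⟩, h3⟩ := hg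
  rw [SetLike.mem_coe, mem_killedByContract] at h3
  simp only [Finset.toLeft_insert_inr, Finset.toRight_insert_inr] at h1 h3
  rw [Finset.card_insert_of_notMem h0] at h1
  refine ⟨wedge n g, ⟨⟨⟨wedge_mem_degreePart _ h1 (by push_cast; ring), ?_⟩, ?_⟩, ?_⟩, ?_⟩
  · rw [SetLike.mem_coe, mem_killedByWedge, hl]
    simp
  · rw [SetLike.mem_coe, mem_killedByContract]
    intro b hb
    rw [contract_wedge, hn b hb, h3 b (Finset.mem_insert_of_mem hb)]
    simp
  · intro h
    rw [hn' h, map_neg, LinearMap.neg_apply, map_neg, wedge_self, neg_zero]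
  · rw [contract_wedge, hn0, h3 0 (Finset.mem_insert_self _ _)]
    simp

-- At a pair with 0 ∈ σ the set α is empty, and every face other than the one opposite to 0 still
-- contains 0, where f vanishes by assumption.
omit hK in
theorem coboundary_mixedOp_insert_zero {f : Pairs d → Fock d} {t : Pairs d}
    (ht : insert (Sum.inr 0) t ∈ validPairs K' K) (h0 : 0 ∉ t.toRight)
    (hf : ∀ b ∈ t.toRight, f (insert (Sum.inr 0) (t.erase (Sum.inr b))) = 0) :
    coboundary (validPairs K' K) mixedOp f (insert (Sum.inr 0) t) = contract (lift 0) (f t) := by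
  have h0' : Sum.inr 0 ∉ t := by simpa using h0
  rw [coboundary_apply _ _ ht, Finset.sum_insert h0', Finset.erase_insert h0',
    Finset.sum_eq_zero, add_zero]
  · rfl
  · intro e he
    rcases e with u | b
    · have h1 := toLeft_eq_empty_of_zero_mem ht (by simp)
      have h2 : u ∈ (insert (Sum.inr 0) t : Pairs d).toLeft := by simpa using he
      rw [h1] at h2
      exact absurd h2 (Finset.notMem_empty _)
    · have hb : (Sum.inr 0 : Lat d ⊕ Lat d) ≠ Sum.inr b := by
        rintro h
        exact h0' (h ▸ he)
      rw [Finset.erase_insert_of_ne hb, hf b (by simpa using he), map_zero]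

theorem insert_zero_mem_validPairs {t : Pairs d} (ht : t ∈ validPairs K' K) (hl : t.toLeft = ∅) :
    insert (Sum.inr 0) t ∈ validPairs K' K := by
  refine ⟨by simpa using ht.1, ?_, ?_⟩
  · have : (insert (Sum.inr 0) t : Pairs d).toRight.erase 0 = t.toRight.erase 0 := by
      rw [Finset.toRight_insert_inr, Finset.erase_insert_eq_erase]
    rw [this]
    exact ht.2.1
  · simp [hl]

omit hK in
theorem symmetricCoeff_le_augmentedCoeff (t : Pairs d) :
    symmetricCoeff p t ≤ augmentedCoeff p t := fun _ h => ⟨h.1, h.2.1⟩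

/-- The two differentials could differ only at pairs with 0 ∈ σ and at the empty pair. At the former
the value is a contraction with `lift 0` of an element with α = ∅, zero by definition of
`symmetricCoeff`; at the latter the sum is empty. -/
theorem symmetricComplex_D_eq {k : ℤ} {f : Pairs d → Fock d}
    (hf : f ∈ (symmetricComplex hK p).C k) :
    (symmetricComplex hK p).D f = (augmentedComplex hK p).D f := by
  funext t
  change coboundary (symmetricPairs K' K) mixedOp f t = coboundary (validPairs K' K) mixedOp f t
  by_cases hv : t ∈ validPairs K' K
  swap
  · rw [coboundary_apply_of_notMem _ _ hv, coboundary_apply_of_notMem _ _ fun h => hv h.1]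
  by_cases ht : t ∈ symmetricPairs K' K
  · rw [coboundary_apply _ _ ht, coboundary_apply _ _ ht.1]
  · rw [coboundary_apply_of_notMem _ _ ht]
    by_cases h0 : 0 ∈ t.toRight
    · have hins : insert (Sum.inr 0) (t.erase (Sum.inr 0)) = t :=
        Finset.insert_erase (by simpa using h0)
      have h1 : 0 ∉ (t.erase (Sum.inr 0)).toRight := by simp
      have hl := toLeft_eq_empty_of_zero_mem hv h0
      rw [← hins] at hv ⊢
      rw [coboundary_mixedOp_insert_zero hv h1, (hf.1 _).2.2 (by simpa using hl)]
      intro b _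
      exact eq_zero_of_mem_sections hf fun h => h.2.1 (by simp)
    · have : t = ∅ := by
        by_contra h
        exact ht ⟨hv, h0, h⟩
      subst this
      rw [coboundary_apply _ _ hv, Finset.sum_empty]

/-- Choose y so that subtracting its coboundary removes the values of f at the pairs with 0 ∈ σ;
this uses surjectivity of contraction with `lift 0`. As the coboundary of the rest s vanishes at
those pairs, s is killed by this contraction where α = ∅. At the empty pair s is also killed by
multiplication with `lift 0`, hence zero. -/
theorem exists_augmented_reduction {k : ℤ} {f z : Pairs d → Fock d}
    (hf : f ∈ (augmentedComplex hK p).C k) (hz : z ∈ (symmetricComplex hK p).C (k + 1))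
    (hfz : (augmentedComplex hK p).D f = z) : ∃ s ∈ (symmetricComplex hK p).C k,
      ∃ y ∈ (augmentedComplex hK p).C (k - 1), f = s + (augmentedComplex hK p).D y := by
  classical
  have key : ∀ t, ∃ a ∈ augmentedCoeff p t,
      (¬ (t ∈ validPairs K' K ∧ (t.card : ℤ) = k - 1 - 1) → a = 0) ∧ (0 ∈ t.toRight → a = 0) ∧
      (t ∈ validPairs K' K → t.toLeft = ∅ → 0 ∉ t.toRight →
        contract (lift 0) a = f (insert (Sum.inr 0) t)) := by
    intro t
    by_cases ht : t ∈ validPairs K' K ∧ (t.card : ℤ) = k - 1 - 1 ∧ t.toLeft = ∅ ∧ 0 ∉ t.toRight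
    · obtain ⟨a, ha, ha'⟩ := exists_augmented_lift hK ht.1 ht.2.2.1 ht.2.2.2
        (hf.1 (insert (Sum.inr 0) t)).1
      exact ⟨a, ha, fun h => absurd ⟨ht.1, ht.2.1⟩ h, fun h => absurd h ht.2.2.2,
        fun _ _ _ => ha'⟩
    · refine ⟨0, Submodule.zero_mem _, fun _ => rfl, fun _ => rfl, fun h1 h2 h3 => ?_⟩
      rw [map_zero, hf.2]
      rintro ⟨-, h4⟩
      rw [Finset.card_insert_of_notMem (by simpa using h3)] at h4
      exact ht ⟨h1, by rw [← h4]; push_cast; ring, h2, h3⟩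
  choose y hy hy0 hy1 hy2 using key
  have hyC : y ∈ (augmentedComplex hK p).C (k - 1) :=
    mem_sections_of (fun t _ _ => hy t) hy0
  set s := f - (augmentedComplex hK p).D y with hs
  have hsC : s ∈ (augmentedComplex hK p).C k := by
    refine Submodule.sub_mem _ hf ?_
    have := (augmentedComplex hK p).map_mem _ y hyC
    rwa [sub_add_cancel] at this
  have hDs : (augmentedComplex hK p).D s = z := by
    rw [hs, map_sub, (augmentedComplex hK p).sq_zero _ y hyC, sub_zero, hfz]
  have hs0 : ∀ t, 0 ∈ t.toRight → s t = 0 := by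
    intro t h0
    by_cases hv : t ∈ validPairs K' K
    · have hins : insert (Sum.inr 0) (t.erase (Sum.inr 0)) = t :=
        Finset.insert_erase (by simpa using h0)
      have h1 : 0 ∉ (t.erase (Sum.inr 0)).toRight := by simp
      have hl := toLeft_eq_empty_of_zero_mem hv h0
      have hv' := validPairs_mono hK (Finset.erase_subset (Sum.inr 0) t) hv
      rw [← hins] at hv ⊢
      change f _ - coboundary (validPairs K' K) mixedOp y _ = 0
      rw [coboundary_mixedOp_insert_zero hv h1, hy2 _ hv' (by simpa using hl) h1, sub_self]
      intro b _
      exact hy1 _ (by simp)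
    · exact eq_zero_of_mem_sections hsC hv
  have hs1 : ∀ t ∈ validPairs K' K, t.toLeft = ∅ → 0 ∉ t.toRight →
      contract (lift 0) (s t) = 0 := by
    intro t ht hl h0
    have hins := insert_zero_mem_validPairs hK ht hl
    rw [← coboundary_mixedOp_insert_zero hins h0 fun b _ => hs0 _ (by simp)]
    change (augmentedComplex hK p).D s _ = 0
    rw [hDs]
    exact eq_zero_of_mem_sections hz fun h => h.2.1 (by simp)
  refine ⟨s, ⟨fun t => ⟨(hsC.1 t).1, (hsC.1 t).2, fun hl => ?_⟩, fun t ht => ?_⟩, y, hyC,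
    (sub_add_cancel _ _).symm⟩
  · by_cases hv : t ∈ validPairs K' K
    · by_cases h0 : 0 ∈ t.toRight
      · rw [hs0 t h0, map_zero]
      · exact hs1 t hv hl h0
    · rw [eq_zero_of_mem_sections hsC hv, map_zero]
  · by_cases hv : t ∈ validPairs K' K ∧ (t.card : ℤ) = k - 1
    · by_cases h0 : 0 ∈ t.toRight
      · exact hs0 t h0
      · have : t = ∅ := by
          by_contra h
          exact ht ⟨⟨hv.1, h0, h⟩, hv.2⟩
        subst this
        refine eq_zero_of_wedge_eq_zero (x := lift 0) (y := lift 0) ?_ ((hsC.1 ∅).2 rfl)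
          (hs1 ∅ hv.1 rfl h0)
        rw [extendedForm_lift_zero]
        norm_num
    · exact hsC.2 t hv

theorem rank_symmetricComplex (k : ℤ) :
    (symmetricComplex hK p).rank k = (augmentedComplex hK p).rank k := by
  refine SubComplex.rank_eq _ _ LinearMap.id ?_ (fun k f hf => symmetricComplex_D_eq hK hf)
    (fun _ _ _ h => h) (fun k f hf z hz h => exists_augmented_reduction hK hf hz h) k
  intro k f hf
  refine mem_sections_of (fun t _ _ => symmetricCoeff_le_augmentedCoeff t (hf.1 t))
    fun t ht => ?_
  by_cases h : t ∈ symmetricPairs K' K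
  · exact hf.2 t fun h' => ht ⟨h.1, h'.2⟩
  · exact eq_zero_of_mem_sections hf h

/-! ### Mirror symmetry of the symmetric complex -/

omit hK

/-- The exchange of the two components of a pair. -/
def swapPair (t : Pairs d) : Pairs d := t.map (Equiv.sumComm _ _).toEmbedding

@[simp]
theorem toLeft_swapPair (t : Pairs d) : (swapPair t).toLeft = t.toRight := by
  simp [swapPair]

@[simp]
theorem toRight_swapPair (t : Pairs d) : (swapPair t).toRight = t.toLeft := by
  simp [swapPair]

@[simp]
theorem card_swapPair (t : Pairs d) : (swapPair t).card = t.card := Finset.card_map _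

@[simp]
theorem swapPair_swapPair (t : Pairs d) : swapPair (swapPair t) = t := by
  ext (x | x) <;> simp [swapPair]

theorem swapPair_erase (t : Pairs d) (e : Lat d ⊕ Lat d) :
    swapPair (t.erase e) = (swapPair t).erase e.swap :=
  Finset.map_erase _ _ _

theorem sum_swapPair {A : Type*} [AddCommMonoid A] (t : Pairs d) (F : Lat d ⊕ Lat d → A) :
    ∑ e ∈ swapPair t, F e = ∑ e ∈ t, F e.swap :=
  Finset.sum_map _ _ _

theorem swapPair_mem (hK : IsMirrorPair K' K) {t : Pairs d} (ht : t ∈ symmetricPairs K' K) :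
    swapPair t ∈ symmetricPairs K K' := by
  refine ⟨⟨?_, ?_, ?_⟩, ?_, ?_⟩
  · rw [toLeft_swapPair, ← Finset.erase_eq_of_notMem ht.2.1]
    exact ht.1.2.1
  · rw [toRight_swapPair, Finset.erase_eq_of_notMem (hK.zero_notMem' _ ht.1.1)]
    exact ht.1.1
  · rw [toRight_swapPair, toLeft_swapPair]
    intro u hu b hb
    rw [dotProduct_comm]
    exact ht.1.2.2 b hb u hu
  · rw [toRight_swapPair]
    exact hK.zero_notMem' _ ht.1.1
  · intro h
    exact ht.2.2 (by rw [← swapPair_swapPair t, h]; rfl)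

theorem swapPair_mem_iff (hK : IsMirrorPair K' K) {t : Pairs d} :
    swapPair t ∈ symmetricPairs K K' ↔ t ∈ symmetricPairs K' K :=
  ⟨fun h => swapPair_swapPair t ▸ swapPair_mem hK.symm h, swapPair_mem hK⟩

/-- The Hodge star operator on functions on pairs. -/
def starMap (d : ℕ) : (Pairs d → Fock d) →ₗ[ℚ] (Pairs d → Fock d) :=
  LinearMap.pi fun t => star d ∘ₗ LinearMap.proj (swapPair t)

theorem starMap_apply (f : Pairs d → Fock d) (t : Pairs d) :
    starMap d f t = star d (f (swapPair t)) := rfl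

/-- The conditions of multiplication and contraction are exchanged, and d + 1 - (p + 1 + |α| - |σ|)
= p' + 1 + |σ| - |α|. This is where p turns into its mirror degree. -/
theorem star_mem_symmetricCoeff {p p' : ℤ} (hp : p' = d - 1 - p) {t : Pairs d} {x : Fock d} :
    star d x ∈ symmetricCoeff p' (swapPair t) ↔ x ∈ symmetricCoeff p t := by
  have h0 : ∀ y : Fock d, star d y = 0 ↔ y = 0 := fun y =>
    ⟨fun h => star_injective (h.trans (map_zero _).symm), fun h => by rw [h, map_zero]⟩
  change ((star d x ∈ degreePart d _ ∧ star d x ∈ killedByWedge _) ∧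
      star d x ∈ killedByContract _) ∧ _ ↔
    ((x ∈ degreePart d _ ∧ x ∈ killedByWedge _) ∧ x ∈ killedByContract _) ∧ _
  simp only [mem_killedByWedge, mem_killedByContract, toLeft_swapPair, toRight_swapPair,
    ← star_contract, ← star_wedge, h0]
  rw [star_mem_degreePart (k := p + 1 + t.toLeft.card - t.toRight.card) (by rw [hp]; ring)]
  tauto

theorem starMap_mem {p p' : ℤ} (hp : p' = d - 1 - p) (hK : IsMirrorPair K' K) {k : ℤ}
    {f : Pairs d → Fock d} (hf : f ∈ (symmetricComplex hK p).C k) :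
    starMap d f ∈ (symmetricComplex hK.symm p').C k := by
  refine ⟨fun t => ?_, fun t ht => ?_⟩
  · have h := (star_mem_symmetricCoeff hp).2 (hf.1 (swapPair t))
    rwa [swapPair_swapPair] at h
  · rw [starMap_apply, hf.2 _ _, map_zero]
    rintro ⟨h1, h2⟩
    exact ht ⟨(swapPair_mem_iff hK.symm).1 h1, by rwa [card_swapPair] at h2⟩

theorem starMap_D {p p' : ℤ} (hK : IsMirrorPair K' K) (f : Pairs d → Fock d) :
    starMap d ((symmetricComplex hK p).D f) = (symmetricComplex hK.symm p').D (starMap d f) := by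
  funext t
  change star d (coboundary (symmetricPairs K' K) mixedOp f (swapPair t)) =
    coboundary (symmetricPairs K K') mixedOp (starMap d f) t
  by_cases ht : t ∈ symmetricPairs K K'
  · rw [coboundary_apply _ _ ht, coboundary_apply _ _ (swapPair_mem hK.symm ht), sum_swapPair,
      map_sum]
    refine Finset.sum_congr rfl fun e _ => ?_
    rw [starMap_apply, swapPair_erase]
    rcases e with u | b
    · exact star_contract _ _
    · exact star_wedge _ _
  · rw [coboundary_apply_of_notMem _ _ ht, coboundary_apply_of_notMem, map_zero]
    exact fun h => ht ((swapPair_mem_iff hK.symm).1 h)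

/-- The star with the exchange of components is an isomorphism of complexes; it preserves k because
the exchange preserves |α| + |σ|. -/
theorem rank_symmetricComplex_symm {p p' : ℤ} (hp : p' = d - 1 - p) (hK : IsMirrorPair K' K)
    (k : ℤ) : (symmetricComplex hK p).rank k = (symmetricComplex hK.symm p').rank k := by
  refine SubComplex.rank_eq _ _ (starMap d) (fun k f hf => starMap_mem hp hK hf)
    (fun k f _ => starMap_D hK f) ?_ ?_ k
  · intro k f _ h
    funext t
    have h1 := congrFun h (swapPair t)
    rw [starMap_apply, swapPair_swapPair] at h1
    exact star_injective (h1.trans (map_zero _).symm)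
  · intro k x hx _ _ _
    choose g hg using fun t => star_surjective (d := d) (x (swapPair t))
    have hgx : starMap d g = x := by
      funext t
      rw [starMap_apply, hg, swapPair_swapPair]
    refine ⟨g, ⟨fun t => ?_, fun t ht => ?_⟩, 0, Submodule.zero_mem _, by rw [hgx, map_zero,
      add_zero]⟩
    · rw [← star_mem_symmetricCoeff hp, hg]
      exact hx.1 _
    · refine star_injective ?_
      rw [hg, map_zero, hx.2]
      rintro ⟨h1, h2⟩
      exact ht ⟨(swapPair_mem_iff hK).1 h1, by rwa [card_swapPair] at h2⟩

end Comparison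

/-! ### Replacing the ambient cellular complex by its constants at σ = ∅. -/

section Augmentation

variable {d : ℕ} {K' K : Set (Finset (Lat d))} (hK : IsMirrorPair K' K) {p : ℤ}

theorem disjSum_mem_validPairs {α σ : Finset (Lat d)} :
    α.disjSum σ ∈ validPairs K' K ↔ α ∈ K' ∧ σ ∈ dualComplex K α := by
  change _ ∧ _ ↔ _
  rw [Finset.toLeft_disjSum, Finset.toRight_disjSum]

theorem disjSum_mem_cellPairs {α σ : Finset (Lat d)} :
    α.disjSum σ ∈ cellPairs K' K ↔ α ∈ K' ∧ σ ∈ dualComplex K α ∧ σ ≠ ∅ := by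
  change _ ∧ _ ↔ _
  rw [disjSum_mem_validPairs, Finset.toRight_disjSum, and_assoc]

theorem sum_disjSum_pairs {A : Type*} [AddCommMonoid A] (α σ : Finset (Lat d))
    (F : Lat d ⊕ Lat d → A) :
    ∑ e ∈ α.disjSum σ, F e = ∑ u ∈ α, F (Sum.inl u) + ∑ b ∈ σ, F (Sum.inr b) :=
  Finset.sum_disjSum _ _ _

theorem cellCoboundary_apply {α σ : Finset (Lat d)} (h : α.disjSum σ ∈ cellPairs K' K)
    (f : Pairs d → Fock d) : coboundary (cellPairs K' K) cellOp f (α.disjSum σ) =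
      ∑ u ∈ α, (-1 : ℤ) ^ σ.card • wedge (lift u) (f ((α.erase u).disjSum σ)) +
        simplicialCoboundary (fun s => f (α.disjSum s)) σ := by
  rw [coboundary_apply _ _ h, sum_disjSum_pairs]
  simp only [disjSum_erase_inl, disjSum_erase_inr, cellOp, Finset.toRight_disjSum,
    LinearMap.smul_apply, Module.End.one_apply]
  rfl

theorem dualComplex_mono (hK : IsMirrorPair K' K) {α α' σ σ' : Finset (Lat d)} (hα : α' ⊆ α)
    (hσ : σ' ⊆ σ) (h : σ ∈ dualComplex K α) : σ' ∈ dualComplex K α' :=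
  ⟨hK.down_closed _ h.1 _ (Finset.erase_subset_erase _ hσ),
    fun u hu b hb => h.2 u (hα hu) b (hσ hb)⟩

theorem empty_mem_dualComplex (hK : IsMirrorPair K' K) (α : Finset (Lat d)) :
    ∅ ∈ dualComplex K α := ⟨hK.empty_mem, by simp⟩

theorem simplicialCoboundary_singleton (f : Finset (Lat d) → Fock d) (b : Lat d) :
    simplicialCoboundary f {b} = f ∅ := by
  simp [simplicialCoboundary]

open scoped Classical in
/-- The inclusion of the augmented complex into the mapping cone: on `(α, ∅)` it is the inclusion
of the constant cochains. -/
def constantMap (K' K : Set (Finset (Lat d))) :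
    (Pairs d → Fock d) →ₗ[ℚ] (Pairs d → Fock d) × (Pairs d → Fock d) :=
  LinearMap.prod
    (LinearMap.pi fun t => if t ∈ cellPairs K' K ∧ t.toRight.card = 1 then
      LinearMap.proj (t.toLeft.disjSum ∅) else 0)
    (LinearMap.pi fun t => if t ∈ cellPairs K' K then LinearMap.proj t else 0)

theorem constantMap_fst {f : Pairs d → Fock d} {t : Pairs d} (ht : t ∈ cellPairs K' K)
    (h1 : t.toRight.card = 1) : (constantMap K' K f).1 t = f (t.toLeft.disjSum ∅) := by
  simp [constantMap, ht, h1]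

open scoped Classical in
theorem constantMap_fst_eq_zero {f : Pairs d → Fock d} {t : Pairs d}
    (h : ¬ (t ∈ cellPairs K' K ∧ t.toRight.card = 1)) : (constantMap K' K f).1 t = 0 := by
  change (if t ∈ cellPairs K' K ∧ t.toRight.card = 1 then
    LinearMap.proj (R := ℚ) (φ := fun _ : Pairs d => Fock d) (t.toLeft.disjSum ∅) else 0) f = 0
  rw [if_neg h, LinearMap.zero_apply]

theorem constantMap_snd {f : Pairs d → Fock d} {t : Pairs d} (ht : t ∈ cellPairs K' K) :
    (constantMap K' K f).2 t = f t := by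
  simp [constantMap, ht]

theorem constantMap_snd_eq_zero {f : Pairs d → Fock d} {t : Pairs d}
    (h : t ∉ cellPairs K' K) : (constantMap K' K f).2 t = 0 := by
  simp [constantMap, h]

theorem tangentCoeff_of_augmentedCoeff {α : Finset (Lat d)} {x : Fock d}
    (hx : x ∈ augmentedCoeff p (α.disjSum ∅)) : x ∈ tangentCoeff p α := by
  obtain ⟨⟨⟨h1, h2⟩, -⟩, h3⟩ := hx
  simp only [Finset.toLeft_disjSum, Finset.toRight_disjSum, Finset.card_empty, Nat.cast_zero,
    sub_zero] at h1 h2 h3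
  refine ⟨h1, mem_killedByWedge.2 fun u hu => ?_⟩
  rcases Finset.mem_insert.1 hu with rfl | hu
  · exact h3 trivial
  · exact mem_killedByWedge.1 h2 u hu

theorem augmentedCoeff_of_tangentCoeff {α : Finset (Lat d)} {x : Fock d}
    (hx : x ∈ tangentCoeff p α) : x ∈ augmentedCoeff p (α.disjSum ∅) := by
  have h2 := mem_killedByWedge.1 hx.2
  refine ⟨⟨⟨?_, mem_killedByWedge.2 fun u hu => h2 u ?_⟩, mem_killedByContract.2 (by simp)⟩,
    fun _ => h2 0 (Finset.mem_insert_self _ _)⟩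
  · have := hx.1
    simp only [Finset.toLeft_disjSum, Finset.toRight_disjSum, Finset.card_empty, Nat.cast_zero,
      sub_zero]
    exact this
  · rw [Finset.toLeft_disjSum] at hu
    exact Finset.mem_insert_of_mem hu

include hK

/-- A complex whose only simplex is the empty one has nonzero reduced cohomology, so acyclicity
provides a vertex. -/
theorem exists_singleton_mem_dualComplex {α : Finset (Lat d)} (hα : α ∈ K') :
    ∃ b, {b} ∈ dualComplex K α := by
  classical
  by_contra! h
  have hcon : ∀ σ ∈ dualComplex K α, σ = ∅ := by
    intro σ hσ
    by_contra hne
    obtain ⟨b, hb⟩ := Finset.nonempty_iff_ne_empty.2 hne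
    exact h b (dualComplex_mono hK subset_rfl (Finset.singleton_subset_iff.2 hb) hσ)
  obtain ⟨k, -, hk⟩ := hK.acyclic α hα ⊤ 0 (fun σ => if σ = ∅ then 1 else 0)
    (mem_sections_of (fun _ _ _ => Submodule.mem_top) (by
      intro σ hσ
      rw [if_neg]
      rintro rfl
      exact hσ ⟨empty_mem_dualComplex hK α, by simp⟩))
    (by
      intro σ hσ
      rw [hcon σ hσ]
      simp [simplicialCoboundary])
  have := hk ∅ (empty_mem_dualComplex hK α)
  simp [simplicialCoboundary] at this

theorem constantMap_mem {k : ℤ} {f : Pairs d → Fock d} (hf : f ∈ (augmentedComplex hK p).C k) :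
    constantMap K' K f ∈ (coneComplex hK p).C k := by
  refine ⟨mem_sections_of (fun t ht _ => ?_) fun t ht => ?_,
    mem_sections_of (fun t ht _ => ?_) fun t ht => ?_⟩
  · by_cases h1 : t.toRight.card = 1
    · rw [constantMap_fst ht h1]
      exact tangentCoeff_of_augmentedCoeff (hf.1 _)
    · rw [constantMap_fst_eq_zero fun h => h1 h.2]
      exact Submodule.zero_mem _
  · by_cases h : t ∈ cellPairs K' K ∧ t.toRight.card = 1
    · rw [constantMap_fst h.1 h.2, hf.2]
      rintro ⟨-, h3⟩
      refine ht ⟨h.1, ?_⟩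
      rw [Finset.card_disjSum, Finset.card_empty, add_zero] at h3
      rw [← Finset.card_toLeft_add_card_toRight, h.2]
      push_cast
      rw [h3]
      ring
    · exact constantMap_fst_eq_zero h
  · rw [constantMap_snd ht]
    exact (hf.1 t).1
  · by_cases h : t ∈ cellPairs K' K
    · rw [constantMap_snd h, hf.2 t fun h' => ht ⟨h, h'.2⟩]
    · exact constantMap_snd_eq_zero h

/-- On vertices, the sign -1 of the cone cancels (-1)^|σ|; on edges, the simplicial coboundary of a
constant vanishes. In the second component, the face (α, ∅) of (α, {b}), which is not a cell, is
supplied by the contraction map. -/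
theorem constantMap_D {k : ℤ} {f : Pairs d → Fock d} (hf : f ∈ (augmentedComplex hK p).C k) :
    constantMap K' K ((augmentedComplex hK p).D f) =
      (coneComplex hK p).D (constantMap K' K f) := by
  classical
  change constantMap K' K (coboundary (validPairs K' K) mixedOp f) =
    (-(coboundary (cellPairs K' K) cellOp (constantMap K' K f).1),
      contractMap K' K (constantMap K' K f).1 +
        coboundary (cellPairs K' K) mixedOp (constantMap K' K f).2)
  refine Prod.ext (funext fun t => ?_) (funext fun t => ?_)
  · change _ = (-(coboundary (cellPairs K' K) cellOp (constantMap K' K f).1)) t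
    by_cases ht : t ∈ cellPairs K' K
    swap
    · rw [constantMap_fst_eq_zero fun h => ht h.1, Pi.neg_apply,
        coboundary_apply_of_notMem _ _ ht, neg_zero]
    obtain ⟨α, σ, rfl⟩ : ∃ α σ : Finset (Lat d), t = α.disjSum σ :=
      ⟨_, _, (Finset.toLeft_disjSum_toRight).symm⟩
    have hc : ∀ s, (constantMap K' K f).1 (α.disjSum s) =
        if α.disjSum s ∈ cellPairs K' K ∧ s.card = 1 then f (α.disjSum ∅) else 0 := by
      intro s
      split_ifs with h
      · rw [constantMap_fst h.1 (by rw [Finset.toRight_disjSum]; exact h.2),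
          Finset.toLeft_disjSum]
      · rw [constantMap_fst_eq_zero]
        rw [Finset.toRight_disjSum]
        exact h
    have hv := (disjSum_mem_cellPairs.1 ht)
    rw [Pi.neg_apply, cellCoboundary_apply ht]
    by_cases h1 : σ.card = 1
    · obtain ⟨b, rfl⟩ := Finset.card_eq_one.1 h1
      rw [constantMap_fst ht (by simp), Finset.toLeft_disjSum,
        coboundary_apply _ _ (disjSum_mem_validPairs.2 ⟨hv.1, empty_mem_dualComplex hK α⟩),
        sum_disjSum_pairs, Finset.sum_empty, add_zero, simplicialCoboundary_singleton, hc,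
        if_neg (by simp), add_zero, ← Finset.sum_neg_distrib]
      refine Finset.sum_congr rfl fun u hu => ?_
      have hcell : (α.erase u).disjSum {b} ∈ cellPairs K' K :=
        disjSum_mem_cellPairs.2 ⟨hK.down_closed' _ hv.1 _ (Finset.erase_subset _ _),
          dualComplex_mono hK (Finset.erase_subset _ _) subset_rfl hv.2.1, hv.2.2⟩
      rw [constantMap_fst hcell (by simp), disjSum_erase_inl, Finset.toLeft_disjSum]
      simp [mixedOp]
    · rw [constantMap_fst_eq_zero fun h => h1 (by simpa using h.2), Finset.sum_eq_zero, zero_add]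
      · rw [eq_comm, neg_eq_zero]
        by_cases h2 : σ.card = 2
        · obtain ⟨b, b', hbb, rfl⟩ := Finset.card_eq_two.1 h2
          have hcb : ∀ c ∈ ({b, b'} : Finset (Lat d)), α.disjSum {c} ∈ cellPairs K' K :=
            fun c hc => disjSum_mem_cellPairs.2 ⟨hv.1, dualComplex_mono hK subset_rfl
              (Finset.singleton_subset_iff.2 hc) hv.2.1, Finset.singleton_ne_empty _⟩
          have e1 : ({b, b'} : Finset (Lat d)).erase b = {b'} := by
            rw [Finset.erase_insert (by simpa using hbb)]
          have e2 : ({b, b'} : Finset (Lat d)).erase b' = {b} := by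
            rw [Finset.pair_comm, Finset.erase_insert (by simpa using hbb.symm)]
          rw [simplicialCoboundary, Finset.sum_pair hbb, e1, e2, hc, hc,
            if_pos ⟨hcb b' (by simp), by simp⟩, if_pos ⟨hcb b (by simp), by simp⟩, ← add_smul]
          have h3 := insertSign_mul_insertSign hbb.symm (Finset.notMem_empty b')
            (Finset.notMem_empty b)
          simp only [insertSign_empty, one_mul, insert_empty_eq] at h3
          rw [h3]
          simp
        · refine Finset.sum_eq_zero fun b hb => ?_
          beta_reduce
          rw [hc, if_neg, smul_zero]
          rintro ⟨-, h3⟩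
          rw [Finset.card_erase_of_mem hb] at h3
          omega
      · intro u _
        rw [constantMap_fst_eq_zero, map_zero, smul_zero]
        rw [Finset.toRight_disjSum]
        exact fun h => h1 h.2
  · change _ = (contractMap K' K (constantMap K' K f).1 +
      coboundary (cellPairs K' K) mixedOp (constantMap K' K f).2) t
    by_cases ht : t ∈ cellPairs K' K
    swap
    · rw [constantMap_snd_eq_zero ht, Pi.add_apply, contractMap_apply_of_notMem ht,
        coboundary_apply_of_notMem _ _ ht, add_zero]
    rw [constantMap_snd ht, coboundary_apply _ _ ht.1, Pi.add_apply, contractMap_apply ht,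
      coboundary_apply _ _ ht]
    by_cases h1 : t.toRight.card = 1
    · obtain ⟨b, hb⟩ := Finset.card_eq_one.1 h1
      rw [sum_pairs, sum_pairs, hb, Finset.sum_singleton, Finset.sum_singleton,
        constantMap_fst ht h1, constantMap_snd_eq_zero (t := t.erase (Sum.inr b)), map_zero,
        add_zero, add_comm]
      · congr 1
        · have h2 : t.erase (Sum.inr b) = t.toLeft.disjSum ∅ := by
            rw [← Finset.toLeft_disjSum_toRight (u := t), hb, disjSum_erase_inr]
            simp
          rw [h2, show ({b} : Finset (Lat d)) = insert b ∅ from rfl,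
            contractProd_insert (Finset.notMem_empty b)]
          simp [mixedOp]
        · refine Finset.sum_congr rfl fun u _ => ?_
          rw [constantMap_snd]
          exact ⟨validPairs_mono hK (Finset.erase_subset _ _) ht.1, by
            rw [toRight_erase_inl]; exact ht.2⟩
      · intro h
        refine h.2 ?_
        rw [toRight_erase_inr, hb]
        simp
    · rw [constantMap_fst_eq_zero fun h => h1 h.2, map_zero, zero_add]
      refine Finset.sum_congr rfl fun e he => ?_
      rw [constantMap_snd]
      refine ⟨validPairs_mono hK (Finset.erase_subset _ _) ht.1, fun h => ?_⟩
      rcases e with u | b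
      · exact ht.2 (by simpa using h)
      · rw [toRight_erase_inr] at h
        have hb : b ∈ t.toRight := by simpa using he
        rw [← Finset.card_erase_add_one hb, h] at h1
        simp at h1

theorem constantMap_injective {k : ℤ} {f : Pairs d → Fock d}
    (hf : f ∈ (augmentedComplex hK p).C k) (h0 : constantMap K' K f = 0) : f = 0 := by
  funext t
  by_cases hv : t ∈ validPairs K' K
  swap
  · exact eq_zero_of_mem_sections hf hv
  by_cases h : t.toRight = ∅
  · obtain ⟨b, hb⟩ := exists_singleton_mem_dualComplex hK hv.1
    have h1 := constantMap_fst (f := f) (K' := K') (K := K) (t := t.toLeft.disjSum {b})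
      (disjSum_mem_cellPairs.2 ⟨hv.1, hb, Finset.singleton_ne_empty b⟩) (by simp)
    rw [h0, Finset.toLeft_disjSum, ← h, Finset.toLeft_disjSum_toRight] at h1
    exact h1.symm
  · have h1 := constantMap_snd (f := f) (K' := K') (K := K) (t := t) ⟨hv, h⟩
    rw [h0] at h1
    exact h1.symm

/-- The cochain `f(α, ·)` is a constant function on the vertices. -/
def IsConstantAt (K' K : Set (Finset (Lat d))) (f : Pairs d → Fock d) (α : Finset (Lat d)) : Prop :=
  (∀ σ, σ.card ≠ 1 → f (α.disjSum σ) = 0) ∧ ∀ b b', α.disjSum {b} ∈ cellPairs K' K →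
    α.disjSum {b'} ∈ cellPairs K' K → f (α.disjSum {b}) = f (α.disjSum {b'})

/-- Where |σ| ≠ 1, the terms coming from smaller α vanish by assumption, so for |α| = m the function
x(α, ·) is a cocycle for the augmented simplicial complex. Acyclicity gives a primitive κ(α, ·),
possibly with a value at ∅. -/
theorem isConstantAt_step {k : ℤ} {m : ℕ} {x : (Pairs d → Fock d) × (Pairs d → Fock d)}
    {z : Pairs d → Fock d}
    (hx : x ∈ (coneComplex hK p).C k) (hxz : (coneComplex hK p).D x = constantMap K' K z)
    (hm : ∀ α, α.card < m → IsConstantAt K' K x.1 α) :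
    ∃ y ∈ (coneComplex hK p).C (k - 1),
      ∀ α, α.card < m + 1 → IsConstantAt K' K (x - (coneComplex hK p).D y).1 α := by
  classical
  have key : ∀ α, ∃ κ : Finset (Lat d) → Fock d, (α ∈ K' → α.card = m →
      κ ∈ sections (dualComplex K α) (k - m - 1) (fun _ => tangentCoeff p α) ∧
      ∀ σ ∈ dualComplex K α, x.1 (α.disjSum σ) = simplicialCoboundary κ σ) := by
    intro α
    by_cases hα : α ∈ K' ∧ α.card = m
    swap
    · exact ⟨0, fun h1 h2 => absurd ⟨h1, h2⟩ hα⟩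
    obtain ⟨hα, hαm⟩ := hα
    have hsec : (fun σ => x.1 (α.disjSum σ)) ∈
        sections (dualComplex K α) (k - m) (fun _ => tangentCoeff p α) := by
      refine mem_sections_of (fun σ _ _ => ?_) fun σ hσ => ?_
      · have := hx.1.1 (α.disjSum σ)
        beta_reduce at this
        rwa [Finset.toLeft_disjSum] at this
      · refine hx.1.2 _ ?_
        rintro ⟨h1, h2⟩
        refine hσ ⟨(disjSum_mem_cellPairs.1 h1).2.1, ?_⟩
        rw [← h2, Finset.card_disjSum, hαm]
        push_cast
        ring
    obtain ⟨κ, h1, h2⟩ := hK.acyclic α hα _ _ _ hsec (by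
      intro σ hσ
      by_cases hσ0 : σ = ∅
      · simp [hσ0, simplicialCoboundary]
      by_cases hσ1 : σ.card = 1
      · obtain ⟨b, rfl⟩ := Finset.card_eq_one.1 hσ1
        rw [simplicialCoboundary_singleton]
        exact eq_zero_of_mem_sections hx.1 fun h => (disjSum_mem_cellPairs.1 h).2.2 rfl
      · have hcell : α.disjSum σ ∈ cellPairs K' K := disjSum_mem_cellPairs.2 ⟨hα, hσ, hσ0⟩
        have h1 := congrFun (congrArg Prod.fst hxz) (α.disjSum σ)
        rw [constantMap_fst_eq_zero fun h => hσ1 (by simpa using h.2)] at h1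
        change -(coboundary (cellPairs K' K) cellOp x.1 (α.disjSum σ)) = 0 at h1
        rw [neg_eq_zero, cellCoboundary_apply hcell, Finset.sum_eq_zero, zero_add] at h1
        · exact h1
        · intro u hu
          rw [(hm (α.erase u) (by rw [← hαm]; exact Finset.card_erase_lt_of_mem hu)).1 σ hσ1,
            map_zero, smul_zero])
    exact ⟨κ, fun _ _ => ⟨h1, h2⟩⟩
  choose κ hκ using key
  -- The primitive is used at nonempty σ only; dropping its value at ∅ leaves exactly that value as
  -- a constant on the vertices. The sign offsets that of the differential of the cone.
  let f : Pairs d → Fock d := fun t =>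
    if t ∈ cellPairs K' K ∧ t.toLeft.card = m then -κ t.toLeft t.toRight else 0
  have hf0 : ∀ α σ : Finset (Lat d), α.card ≠ m → f (α.disjSum σ) = 0 := by
    intro α σ h
    simp only [f, Finset.toLeft_disjSum]
    rw [if_neg fun h' => h h'.2]
  have hf1 : ∀ α σ : Finset (Lat d), α ∈ K' → σ ∈ dualComplex K α → σ ≠ ∅ → α.card = m →
      f (α.disjSum σ) = -κ α σ := by
    intro α σ h1 h2 h3 h4
    simp only [f, Finset.toLeft_disjSum, Finset.toRight_disjSum]
    rw [if_pos ⟨disjSum_mem_cellPairs.2 ⟨h1, h2, h3⟩, h4⟩]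
  have hfC : (f, (0 : Pairs d → Fock d)) ∈ (coneComplex hK p).C (k - 1) := by
    refine ⟨mem_sections_of (fun t ht _ => ?_) fun t ht => ?_, Submodule.zero_mem _⟩
    · simp only [f]
      split_ifs with h
      · exact Submodule.neg_mem _ ((hκ _ ht.1.1 h.2).1.1 _)
      · exact Submodule.zero_mem _
    · simp only [f]
      split_ifs with h
      · rw [(hκ _ h.1.1.1 h.2).1.2, neg_zero]
        rintro ⟨-, h2⟩
        refine ht ⟨h.1, ?_⟩
        rw [← Finset.card_toLeft_add_card_toRight, h.2]
        push_cast
        rw [h2]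
        ring
      · rfl
  refine ⟨(f, 0), hfC, fun α hα => ?_⟩
  have hD : ∀ t, (x - (coneComplex hK p).D (f, 0)).1 t =
      x.1 t + coboundary (cellPairs K' K) cellOp f t := fun t => sub_neg_eq_add _ _
  have hlow : ∀ u ∈ α, ∀ σ, f ((α.erase u).disjSum σ) = 0 := by
    intro u hu σ
    refine hf0 _ _ (ne_of_lt ?_)
    have := Finset.card_erase_lt_of_mem hu
    omega
  have hcob : ∀ σ, α.disjSum σ ∈ cellPairs K' K →
      coboundary (cellPairs K' K) cellOp f (α.disjSum σ) =
        simplicialCoboundary (fun s => f (α.disjSum s)) σ := by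
    intro σ hσ
    rw [cellCoboundary_apply hσ, Finset.sum_eq_zero, zero_add]
    intro u hu
    rw [hlow u hu, map_zero, smul_zero]
  rcases Nat.lt_succ_iff_lt_or_eq.1 hα with hlt | heq
  · have hz : ∀ σ, (x - (coneComplex hK p).D (f, 0)).1 (α.disjSum σ) = x.1 (α.disjSum σ) := by
      intro σ
      rw [hD]
      by_cases hσ : α.disjSum σ ∈ cellPairs K' K
      · rw [hcob σ hσ, simplicialCoboundary, Finset.sum_eq_zero, add_zero]
        intro b _
        rw [hf0 _ _ hlt.ne, smul_zero]
      · rw [coboundary_apply_of_notMem _ _ hσ, add_zero]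
    refine ⟨fun σ h => ?_, fun b b' h1 h2 => ?_⟩
    · rw [hz]
      exact (hm α hlt).1 σ h
    · rw [hz, hz]
      exact (hm α hlt).2 b b' h1 h2
  · have hz0 : ∀ σ, α.disjSum σ ∉ cellPairs K' K →
        (x - (coneComplex hK p).D (f, 0)).1 (α.disjSum σ) = 0 := by
      intro σ hσ
      rw [hD, coboundary_apply_of_notMem _ _ hσ, eq_zero_of_mem_sections hx.1 hσ, add_zero]
    refine ⟨fun σ h => ?_, fun b b' h1 h2 => ?_⟩
    · by_cases hσ : α.disjSum σ ∈ cellPairs K' K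
      swap
      · exact hz0 σ hσ
      obtain ⟨h1, h2, h3⟩ := disjSum_mem_cellPairs.1 hσ
      rw [hD, hcob σ hσ, (hκ α h1 heq).2 σ h2, simplicialCoboundary, simplicialCoboundary,
        ← Finset.sum_add_distrib]
      refine Finset.sum_eq_zero fun b hb => ?_
      rw [hf1 α _ h1 (dualComplex_mono hK subset_rfl (Finset.erase_subset _ _) h2) _ heq, smul_neg,
        add_neg_cancel]
      intro h4
      rw [← Finset.card_erase_add_one hb, h4] at h
      simp at h
    · have hv : ∀ c, α.disjSum {c} ∈ cellPairs K' K →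
          (x - (coneComplex hK p).D (f, 0)).1 (α.disjSum {c}) = κ α ∅ := by
        intro c hc
        obtain ⟨h1, h2, h3⟩ := disjSum_mem_cellPairs.1 hc
        have h4 : f (α.disjSum ∅) = 0 :=
          eq_zero_of_mem_sections hfC.1 fun h => (disjSum_mem_cellPairs.1 h).2.2 rfl
        rw [hD, hcob _ hc, (hκ α h1 heq).2 _ h2, simplicialCoboundary_singleton,
          simplicialCoboundary_singleton, h4, add_zero]
      rw [hv b h1, hv b' h2]

theorem exists_isConstantAt {k : ℤ} {x : (Pairs d → Fock d) × (Pairs d → Fock d)}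
    {z : Pairs d → Fock d}
    (hx : x ∈ (coneComplex hK p).C k) (hxz : (coneComplex hK p).D x = constantMap K' K z) (m : ℕ) :
    ∃ y ∈ (coneComplex hK p).C (k - 1),
      ∀ α, α.card < m → IsConstantAt K' K (x - (coneComplex hK p).D y).1 α := by
  induction m with
  | zero => exact ⟨0, Submodule.zero_mem _, fun α h => absurd h (Nat.not_lt_zero _)⟩
  | succ m ih =>
    obtain ⟨y, hy, h⟩ := ih
    have hDy : (coneComplex hK p).D y ∈ (coneComplex hK p).C k := by
      have := (coneComplex hK p).map_mem _ y hy
      rwa [sub_add_cancel] at this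
    obtain ⟨y', hy', h'⟩ := isConstantAt_step hK (x := x - (coneComplex hK p).D y)
      (Submodule.sub_mem _ hx hDy)
      (by rw [map_sub, (coneComplex hK p).sq_zero _ y hy, sub_zero, hxz]) h
    refine ⟨y + y', Submodule.add_mem _ hy hy', ?_⟩
    rwa [map_add, ← sub_sub]

/-- The value at (α, ∅) is read off at any vertex of the dual complex of α. -/
theorem exists_constantMap_eq {k : ℤ} {x : (Pairs d → Fock d) × (Pairs d → Fock d)}
    (hx : x ∈ (coneComplex hK p).C k) (h : ∀ α, IsConstantAt K' K x.1 α) :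
    ∃ s ∈ (augmentedComplex hK p).C k, constantMap K' K s = x := by
  classical
  have hb : ∀ α, ∃ b, α ∈ K' → {b} ∈ dualComplex K α := by
    intro α
    by_cases hα : α ∈ K'
    · obtain ⟨b, hb⟩ := exists_singleton_mem_dualComplex hK hα
      exact ⟨b, fun _ => hb⟩
    · exact ⟨0, fun h => absurd h hα⟩
  choose b hb using hb
  let s : Pairs d → Fock d := fun t =>
    if t.toRight = ∅ then x.1 (t.toLeft.disjSum {b t.toLeft}) else x.2 t
  have hs0 : ∀ α : Finset (Lat d), s (α.disjSum ∅) = x.1 (α.disjSum {b α}) := by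
    intro α
    change (if (α.disjSum ∅).toRight = ∅ then _ else _) = _
    rw [Finset.toRight_disjSum, if_pos rfl, Finset.toLeft_disjSum]
  have hs1 : ∀ t, t.toRight ≠ ∅ → s t = x.2 t := by
    intro t ht
    simp only [s]
    rw [if_neg ht]
  refine ⟨s, ⟨fun t => ?_, fun t ht => ?_⟩, Prod.ext (funext fun t => ?_) (funext fun t => ?_)⟩
  · by_cases h0 : t.toRight = ∅
    · obtain ⟨α, rfl⟩ : ∃ α, t = α.disjSum ∅ :=
        ⟨t.toLeft, by rw [← h0, Finset.toLeft_disjSum_toRight]⟩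
      rw [hs0]
      have := hx.1.1 (α.disjSum {b α})
      beta_reduce at this
      rw [Finset.toLeft_disjSum] at this
      exact augmentedCoeff_of_tangentCoeff this
    · rw [hs1 t h0]
      exact ⟨hx.2.1 t, fun h => absurd h h0⟩
  · by_cases h0 : t.toRight = ∅
    · obtain ⟨α, rfl⟩ : ∃ α, t = α.disjSum ∅ :=
        ⟨t.toLeft, by rw [← h0, Finset.toLeft_disjSum_toRight]⟩
      rw [hs0]
      refine hx.1.2 _ ?_
      rintro ⟨h1, h2⟩
      refine ht ⟨disjSum_mem_validPairs.2 ⟨(disjSum_mem_cellPairs.1 h1).1,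
        empty_mem_dualComplex hK α⟩, ?_⟩
      rw [Finset.card_disjSum] at h2 ⊢
      simp at h2 ⊢
      linarith
    · rw [hs1 t h0]
      exact hx.2.2 t fun h' => ht ⟨h'.1.1, h'.2⟩
  · by_cases ht : t ∈ cellPairs K' K ∧ t.toRight.card = 1
    · rw [constantMap_fst ht.1 ht.2, hs0]
      obtain ⟨c, hc⟩ := Finset.card_eq_one.1 ht.2
      have h1 : t = t.toLeft.disjSum {c} := by rw [← hc, Finset.toLeft_disjSum_toRight]
      conv_rhs => rw [h1]
      refine (h t.toLeft).2 _ _ ?_ (h1 ▸ ht.1)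
      exact disjSum_mem_cellPairs.2 ⟨ht.1.1.1, hb _ ht.1.1.1, Finset.singleton_ne_empty _⟩
    · rw [constantMap_fst_eq_zero ht]
      by_cases hc : t ∈ cellPairs K' K
      · have h1 := (h t.toLeft).1 t.toRight fun h' => ht ⟨hc, h'⟩
        rw [Finset.toLeft_disjSum_toRight] at h1
        exact h1.symm
      · exact (eq_zero_of_mem_sections hx.1 hc).symm
  · by_cases ht : t ∈ cellPairs K' K
    · rw [constantMap_snd ht, hs1 t ht.2]
    · rw [constantMap_snd_eq_zero ht, eq_zero_of_mem_sections hx.2 ht]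

/-- Exactness of the quotient is proved by induction on |α|, which is bounded: elements of degree k
vanish when |α| > k. -/
theorem rank_augmentedComplex (k : ℤ) :
    (augmentedComplex hK p).rank k = (coneComplex hK p).rank k := by
  refine SubComplex.rank_eq _ _ (constantMap K' K) (fun k f hf => constantMap_mem hK hf)
    (fun k f hf => constantMap_D hK hf) (fun k f hf h => constantMap_injective hK hf h) ?_ k
  intro k x hx z _ hxz
  obtain ⟨y, hy, h⟩ := exists_isConstantAt hK hx hxz (k.toNat + 1)
  have hDy : (coneComplex hK p).D y ∈ (coneComplex hK p).C k := by
    have := (coneComplex hK p).map_mem _ y hy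
    rwa [sub_add_cancel] at this
  have hx' := Submodule.sub_mem _ hx hDy
  obtain ⟨s, hs, hs'⟩ := exists_constantMap_eq hK hx' (by
    intro α
    by_cases hα : α.card < k.toNat + 1
    · exact h α hα
    · have h0 : ∀ σ, (x - (coneComplex hK p).D y).1 (α.disjSum σ) = 0 := by
        intro σ
        refine hx'.1.2 _ ?_
        rintro ⟨-, h2⟩
        rw [Finset.card_disjSum] at h2
        omega
      exact ⟨fun σ _ => h0 σ, fun b b' _ _ => by rw [h0, h0]⟩)
  exact ⟨s, hs, y, hy, by rw [hs', sub_add_cancel]⟩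

end Augmentation

/-! ### An acyclicity criterion -/

section Acyclicity

variable {d : ℕ}

/-- The operators of the simplicial coboundary. -/
def simplicialOp (b : Lat d) (σ : Finset (Lat d)) : Module.End ℚ (Fock d) :=
  ((insertSign b (σ.erase b) : ℤˣ) : ℤ) • 1

theorem coboundary_simplicialOp {𝒦 : Set (Finset (Lat d))} (f : Finset (Lat d) → Fock d)
    {σ : Finset (Lat d)} (hσ : σ ∈ 𝒦) :
    coboundary 𝒦 simplicialOp f σ = simplicialCoboundary f σ := by
  rw [coboundary_apply _ _ hσ]
  rfl

theorem coboundary_coboundary_simplicialOp {𝒦 : Set (Finset (Lat d))}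
    (hdown : ∀ σ ∈ 𝒦, ∀ σ' ⊆ σ, σ' ∈ 𝒦) (f : Finset (Lat d) → Fock d) :
    coboundary 𝒦 simplicialOp (coboundary 𝒦 simplicialOp f) = 0 := by
  refine coboundary_coboundary (fun t _ b hb b' hb' hne x => ?_)
    fun t ht e _ h => absurd (hdown t ht _ (Finset.erase_subset _ _)) h
  obtain ⟨s, h4, h5, hs⟩ : ∃ s, b ∉ s ∧ b' ∉ s ∧ t = insert b (insert b' s) := by
    refine ⟨(t.erase b).erase b', by simp, by simp, ?_⟩
    rw [Finset.insert_erase (Finset.mem_erase.2 ⟨hne.symm, hb'⟩), Finset.insert_erase hb]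
  have h1 : t.erase b = insert b' s := by
    rw [hs, Finset.erase_insert (by simp [hne, h4])]
  have h2 : t.erase b' = insert b s := by
    rw [hs, Finset.insert_comm, Finset.erase_insert (by simp [hne.symm, h5])]
  simp only [simplicialOp, h1, h2, Finset.erase_insert h4, Finset.erase_insert h5,
    LinearMap.smul_apply, Module.End.one_apply]
  rw [smul_smul, smul_smul, ← add_smul, ← Units.val_mul, ← Units.val_mul, mul_comm,
    insertSign_mul_insertSign hne.symm h5 h4, mul_comm]
  simp

variable {𝒦 : Set (Finset (Lat d))} {ι : Type*} [LinearOrder ι]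
  {ord : Finset (Lat d) → ι} {t : Finset (Lat d) → Lat d}

theorem neg_units_mul_eq {a b c e : ℤˣ} (h : a * b = -(c * e)) : -(e * b) = c * a := by
  revert a b c e
  decide

-- Adding or removing t σ is a matching within each level of `ord`. If f vanishes below the level m,
-- the cone operator of this matching, restricted to level m, gives a primitive of f up to level m.
open scoped Classical in
theorem exists_simplicialCoboundary_step
    (hdown : ∀ σ ∈ 𝒦, ∀ σ' ⊆ σ, σ' ∈ 𝒦)
    (hmono : ∀ σ ∈ 𝒦, ∀ σ' ⊆ σ, ord σ' ≤ ord σ)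
    (ht : ∀ σ ∈ 𝒦, ∀ σ' ⊆ σ, ord σ' = ord σ → t σ' = t σ)
    (hins : ∀ σ ∈ 𝒦, insert (t σ) σ ∈ 𝒦 ∧ ord (insert (t σ) σ) = ord σ)
    (her : ∀ σ ∈ 𝒦, ord (σ.erase (t σ)) = ord σ)
    (X : Submodule ℚ (Fock d)) (r : ℤ) {f : Finset (Lat d) → Fock d}
    (hf : f ∈ sections 𝒦 r fun _ => X) (hf0 : ∀ σ ∈ 𝒦, simplicialCoboundary f σ = 0) {m : ι}
    (hm : ∀ σ ∈ 𝒦, ord σ < m → f σ = 0) :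
    ∃ k ∈ sections 𝒦 (r - 1) fun _ => X,
      ∀ σ ∈ 𝒦, ord σ ≤ m → f σ = simplicialCoboundary k σ := by
  let k : Finset (Lat d) → Fock d := fun σ => if σ ∈ 𝒦 ∧ ord σ = m ∧ t σ ∉ σ then
    ((insertSign (t σ) σ : ℤˣ) : ℤ) • f (insert (t σ) σ) else 0
  have hk0 : ∀ σ, ord σ ≠ m → k σ = 0 := fun σ h => if_neg fun h' => h h'.2.1
  have hk1 : ∀ σ, t σ ∈ σ → k σ = 0 := fun σ h => if_neg fun h' => h'.2.2 h
  have hk2 : ∀ σ ∈ 𝒦, ord σ = m → t σ ∉ σ →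
      k σ = ((insertSign (t σ) σ : ℤˣ) : ℤ) • f (insert (t σ) σ) :=
    fun σ h1 h2 h3 => if_pos ⟨h1, h2, h3⟩
  refine ⟨k, mem_sections_of (fun σ _ _ => ?_) fun σ hσ => ?_, fun σ hσ hσm => ?_⟩
  · simp only [k]
    split_ifs
    · exact zsmul_mem (hf.1 _) _
    · exact Submodule.zero_mem _
  · simp only [k]
    split_ifs with h
    · rw [hf.2, smul_zero]
      rintro ⟨h1, h2⟩
      refine hσ ⟨h.1, ?_⟩
      rw [← h2, Finset.card_insert_of_notMem h.2.2]
      push_cast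
      ring
    · rfl
  rcases hσm.lt_or_eq with hlt | heq
  · rw [hm σ hσ hlt, simplicialCoboundary, Finset.sum_eq_zero]
    intro b _
    rw [hk0 _ ((hmono σ hσ _ (Finset.erase_subset b σ)).trans_lt hlt).ne, smul_zero]
  by_cases htσ : t σ ∈ σ
  · rw [simplicialCoboundary, Finset.sum_eq_single_of_mem _ htσ]
    · have h1 := hdown σ hσ _ (Finset.erase_subset (t σ) σ)
      have h2 : t (σ.erase (t σ)) = t σ := ht _ hσ _ (Finset.erase_subset _ _) (her σ hσ)
      rw [hk2 _ h1 ((her σ hσ).trans heq) (by rw [h2]; exact Finset.notMem_erase _ _), h2,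
        Finset.insert_erase htσ, smul_smul, ← Units.val_mul, Int.units_mul_self, Units.val_one,
        one_smul]
    · intro b hb hbt
      have h1 := hdown σ hσ _ (Finset.erase_subset b σ)
      by_cases h2 : ord (σ.erase b) = m
      · rw [hk1, smul_zero]
        rw [ht _ hσ _ (Finset.erase_subset _ _) (h2.trans heq.symm)]
        exact Finset.mem_erase.2 ⟨hbt.symm, htσ⟩
      · rw [hk0 _ h2, smul_zero]
  · have h1 := hf0 _ (hins σ hσ).1
    rw [simplicialCoboundary, Finset.sum_insert htσ, Finset.erase_insert htσ] at h1
    have h2 : f σ = -∑ b ∈ σ, ((insertSign (t σ) σ : ℤˣ) : ℤ) •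
        ((insertSign b ((insert (t σ) σ).erase b) : ℤˣ) : ℤ) • f ((insert (t σ) σ).erase b) := by
      have h3 := congrArg (((insertSign (t σ) σ : ℤˣ) : ℤ) • ·) h1
      simp only [smul_add, smul_zero] at h3
      rw [smul_smul, ← Units.val_mul, Int.units_mul_self, Units.val_one, one_smul,
        Finset.smul_sum] at h3
      exact eq_neg_of_add_eq_zero_left h3
    rw [h2, simplicialCoboundary, ← Finset.sum_neg_distrib]
    refine Finset.sum_congr rfl fun b hb => ?_
    have hbt : t σ ≠ b := fun h => htσ (h ▸ hb)
    have h3 := hdown σ hσ _ (Finset.erase_subset b σ)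
    have h4 : (insert (t σ) σ).erase b = insert (t σ) (σ.erase b) :=
      Finset.erase_insert_of_ne hbt
    have h4' : insert (t σ) (σ.erase b) ∈ 𝒦 :=
      h4 ▸ hdown _ (hins σ hσ).1 _ (Finset.erase_subset _ _)
    have h5 : t σ ∉ σ.erase b := fun h => htσ (Finset.mem_of_mem_erase h)
    rw [h4]
    by_cases h6 : ord (σ.erase b) = m
    · have h7 : t (σ.erase b) = t σ := ht _ hσ _ (Finset.erase_subset _ _) (h6.trans heq.symm)
      rw [hk2 _ h3 h6 (by rwa [h7]), h7, smul_smul, smul_smul, ← neg_smul]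
      congr 1
      rw [← Units.val_mul, ← Units.val_mul, ← Units.val_neg]
      congr 1
      have h8 := insertSign_mul_insertSign hbt h5 (Finset.notMem_erase b σ)
      rw [Finset.insert_erase hb] at h8
      exact neg_units_mul_eq h8
    · have h7 : ord (insert (t σ) (σ.erase b)) < m := by
        refine lt_of_le_of_ne ?_ fun h => h6 ?_
        · rw [← heq, ← (hins σ hσ).2, ← h4]
          exact hmono _ (hins σ hσ).1 _ (Finset.erase_subset _ _)
        · have h8 : t (insert (t σ) (σ.erase b)) = t σ := by
            rw [← h4, ht _ (hins σ hσ).1 _ (Finset.erase_subset _ _)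
              (by rw [h4, h, (hins σ hσ).2, heq]),
              ← ht _ (hins σ hσ).1 _ (Finset.subset_insert _ _) (hins σ hσ).2.symm]
          have h9 := her _ h4'
          rw [h8, Finset.erase_insert h5] at h9
          exact h9.trans h
      rw [hk0 _ h6, hm _ h4' h7]
      simp

/-- Each application of the previous step raises the lowest level at which the cocycle is nonzero;
the number of levels from there on bounds the induction. -/
theorem isAcyclic_of_toggle (hfin : 𝒦.Finite)
    (hdown : ∀ σ ∈ 𝒦, ∀ σ' ⊆ σ, σ' ∈ 𝒦)
    (hmono : ∀ σ ∈ 𝒦, ∀ σ' ⊆ σ, ord σ' ≤ ord σ)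
    (ht : ∀ σ ∈ 𝒦, ∀ σ' ⊆ σ, ord σ' = ord σ → t σ' = t σ)
    (hins : ∀ σ ∈ 𝒦, insert (t σ) σ ∈ 𝒦 ∧ ord (insert (t σ) σ) = ord σ)
    (her : ∀ σ ∈ 𝒦, ord (σ.erase (t σ)) = ord σ) : IsAcyclic 𝒦 := by
  classical
  intro X r
  suffices h : ∀ (n : ℕ) (f : Finset (Lat d) → Fock d), f ∈ sections 𝒦 r (fun _ => X) →
      (∀ σ ∈ 𝒦, simplicialCoboundary f σ = 0) →
      ((hfin.toFinset.image ord).filter fun o => ∃ σ ∈ 𝒦, f σ ≠ 0 ∧ ord σ ≤ o).card ≤ n →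
      ∃ k ∈ sections 𝒦 (r - 1) fun _ => X, ∀ σ ∈ 𝒦, f σ = simplicialCoboundary k σ from
    fun f hf hf0 => h _ f hf hf0 le_rfl
  intro n
  induction n with
  | zero =>
    intro f _ _ hn
    refine ⟨0, Submodule.zero_mem _, fun σ hσ => ?_⟩
    have h1 : simplicialCoboundary (0 : Finset (Lat d) → Fock d) σ = 0 := by
      simp [simplicialCoboundary]
    rw [h1]
    by_contra h2
    have h3 := Finset.card_eq_zero.1 (Nat.le_zero.1 hn)
    refine Finset.notMem_empty (ord σ) (h3 ▸ Finset.mem_filter.2 ⟨?_, σ, hσ, h2, le_rfl⟩)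
    exact Finset.mem_image_of_mem _ (hfin.mem_toFinset.2 hσ)
  | succ n ih =>
    intro f hf hf0 hn
    by_cases hne : ∃ σ ∈ 𝒦, f σ ≠ 0
    swap
    · push Not at hne
      refine ih f hf hf0 ?_
      rw [Finset.filter_false_of_mem]
      · simp
      · rintro o _ ⟨σ, h1, h2, _⟩
        exact h2 (hne σ h1)
    obtain ⟨σ₀, hσ₀, hmin⟩ := (hfin.toFinset.filter fun σ => f σ ≠ 0).exists_min_image ord
      (by
        obtain ⟨σ, h1, h2⟩ := hne
        exact ⟨σ, Finset.mem_filter.2 ⟨hfin.mem_toFinset.2 h1, h2⟩⟩)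
    rw [Finset.mem_filter, hfin.mem_toFinset] at hσ₀
    have hm : ∀ σ ∈ 𝒦, ord σ < ord σ₀ → f σ = 0 := by
      intro σ hσ hlt
      by_contra h
      exact absurd (hmin σ (Finset.mem_filter.2 ⟨hfin.mem_toFinset.2 hσ, h⟩)) hlt.not_ge
    obtain ⟨k, hk, hfk⟩ := exists_simplicialCoboundary_step hdown hmono ht hins her X r hf hf0 hm
    have hkX : coboundary 𝒦 simplicialOp k ∈ sections 𝒦 r fun _ => X := by
      have h1 := coboundary_mem_sections (A := simplicialOp) hk
        fun _ _ _ _ _ x hx => zsmul_mem (K := X) hx _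
      rwa [sub_add_cancel] at h1
    obtain ⟨k', hk', hfk'⟩ := ih (f - coboundary 𝒦 simplicialOp k)
      (Submodule.sub_mem _ hf hkX) (by
        intro σ hσ
        rw [← coboundary_simplicialOp _ hσ, map_sub, coboundary_coboundary_simplicialOp hdown,
          sub_zero, coboundary_simplicialOp _ hσ, hf0 σ hσ]) (by
        refine Nat.le_of_lt_succ (lt_of_lt_of_le (Finset.card_lt_card ?_) hn)
        refine Finset.ssubset_iff_of_subset (fun o ho => ?_) |>.2 ⟨ord σ₀, ?_, ?_⟩
        · rw [Finset.mem_filter] at ho ⊢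
          obtain ⟨ho, σ, hσ, h1, h2⟩ := ho
          refine ⟨ho, σ₀, hσ₀.1, hσ₀.2, ?_⟩
          refine le_trans (le_of_not_ge fun h3 => h1 ?_) h2
          rw [Pi.sub_apply, coboundary_simplicialOp _ hσ, hfk σ hσ h3, sub_self]
        · exact Finset.mem_filter.2 ⟨Finset.mem_image_of_mem _ (hfin.mem_toFinset.2 hσ₀.1), σ₀,
            hσ₀.1, hσ₀.2, le_rfl⟩
        · rw [Finset.mem_filter]
          rintro ⟨_, σ, hσ, h1, h2⟩
          refine h1 ?_
          rw [Pi.sub_apply, coboundary_simplicialOp _ hσ, hfk σ hσ h2, sub_self])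
    refine ⟨k + k', Submodule.add_mem _ hk hk', fun σ hσ => ?_⟩
    have h1 := hfk' σ hσ
    rw [Pi.sub_apply, sub_eq_iff_eq_add] at h1
    rw [h1, ← coboundary_simplicialOp _ hσ, ← coboundary_simplicialOp _ hσ, map_add, add_comm]
    rfl

end Acyclicity

/-! ### Polar pairs of polytopes and their triangulations -/

section PolarPairs

variable {d : ℕ}

@[simp]
theorem toReal_zero : toReal (0 : Lat d) = 0 := by
  funext i
  simp [toReal]

theorem toReal_injective : Function.Injective (toReal (d := d)) := by
  intro u v h
  funext i
  have := congrFun h i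
  simpa [toReal] using this

theorem toReal_dotProduct (u v : Lat d) : toReal u ⬝ᵥ toReal v = ((u ⬝ᵥ v : ℤ) : ℝ) := by
  simp [toReal, dotProduct]

theorem toReal_sub (u v : Lat d) : toReal (u - v) = toReal u - toReal v := by
  funext i
  simp [toReal]

theorem toReal_add (u v : Lat d) : toReal (u + v) = toReal u + toReal v := by
  funext i
  simp [toReal]

/-- Two polytopes that are polar to each other, each of them defined by inequalities given by
lattice points of the other. -/
structure IsPolarPair (Q Δ : Set (Fin d → ℝ)) : Prop where
  ineq' : ∃ S : Finset (Lat d), (∀ v ∈ S, toReal v ∈ Δ) ∧ Q = {u | ∀ v ∈ S, toReal v ⬝ᵥ u ≤ 1}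
  ineq : ∃ S : Finset (Lat d), (∀ v ∈ S, toReal v ∈ Q) ∧ Δ = {u | ∀ v ∈ S, toReal v ⬝ᵥ u ≤ 1}
  le_one : ∀ u ∈ Q, ∀ v ∈ Δ, u ⬝ᵥ v ≤ 1

theorem IsPolarPair.symm {Q Δ : Set (Fin d → ℝ)} (h : IsPolarPair Q Δ) : IsPolarPair Δ Q where
  ineq' := h.ineq
  ineq := h.ineq'
  le_one u hu v hv := by
    rw [dotProduct_comm]
    exact h.le_one v hv u hu

/-- The lattice points spanning Δ give the inequalities of the dual, and the integral normals of Δ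
are themselves points of the dual. In this form the situation is symmetric. -/
theorem isPolarPair_of_isReflexive {Δ : Set (Fin d → ℝ)} (h : IsReflexive Δ) :
    IsPolarPair (polarDual Δ) Δ := by
  obtain ⟨S, hS⟩ := h.lattice
  obtain ⟨V, hV⟩ := h.ineq
  refine ⟨⟨S, fun v hv => ?_, ?_⟩, ⟨V, fun v hv u hu => ?_, hV⟩, fun u hu v hv => hu v hv⟩
  · rw [hS]
    exact subset_convexHull _ _ ⟨v, hv, rfl⟩
  · ext u
    refine ⟨fun hu v hv => ?_, fun hu v hv => ?_⟩
    · rw [dotProduct_comm]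
      exact hu _ (hS ▸ subset_convexHull _ _ ⟨v, hv, rfl⟩)
    · have hconv : Convex ℝ {v : Fin d → ℝ | u ⬝ᵥ v ≤ 1} :=
        convex_halfSpace_le ⟨fun x y => dotProduct_add _ _ _, fun c x => dotProduct_smul _ _ _⟩ _
      rw [hS] at hv
      refine convexHull_min ?_ hconv hv
      rintro _ ⟨w, hw, rfl⟩
      change u ⬝ᵥ toReal w ≤ 1
      rw [dotProduct_comm]
      exact hu w hw
  · rw [hV] at hu
    exact hu v hv

theorem mem_hull {s : Finset (Lat d)} {x : Fin d → ℝ} : x ∈ hull s ↔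
    ∃ w : Lat d → ℝ, (∀ v ∈ s, 0 ≤ w v) ∧ ∑ v ∈ s, w v = 1 ∧ ∑ v ∈ s, w v • toReal v = x := by
  classical
  rw [hull, ← Finset.coe_image, Finset.mem_convexHull']
  constructor
  · rintro ⟨w, h1, h2, h3⟩
    rw [Finset.sum_image fun a _ b _ h => toReal_injective h] at h2 h3
    exact ⟨fun v => w (toReal v), fun v hv => h1 _ (Finset.mem_image_of_mem _ hv), h2, h3⟩
  · rintro ⟨w, h1, h2, h3⟩
    have hinv : ∀ v, Function.invFun (toReal (d := d)) (toReal v) = v :=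
      Function.leftInverse_invFun toReal_injective
    refine ⟨fun x => w (Function.invFun toReal x), fun y hy => ?_, ?_, ?_⟩
    · obtain ⟨v, hv, rfl⟩ := Finset.mem_image.1 hy
      simpa only [hinv] using h1 v hv
    · rw [Finset.sum_image fun a _ b _ h => toReal_injective h]
      simpa only [hinv] using h2
    · rw [Finset.sum_image fun a _ b _ h => toReal_injective h]
      simpa only [hinv] using h3

theorem toReal_mem_hull {s : Finset (Lat d)} {v : Lat d} (hv : v ∈ s) : toReal v ∈ hull s :=
  subset_convexHull _ _ ⟨v, hv, rfl⟩

variable {Q Δ : Set (Fin d → ℝ)}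

theorem Triangulation.hull_subset (T : Triangulation Δ) {s : Finset (Lat d)} (hs : s ∈ T.faces) :
    hull s ⊆ Δ := by
  rw [← T.space]
  exact Set.subset_iUnion₂ (s := fun s _ => hull s) s hs

theorem Triangulation.toReal_mem (T : Triangulation Δ) {s : Finset (Lat d)} (hs : s ∈ T.faces)
    {v : Lat d} (hv : v ∈ s) : toReal v ∈ Δ := T.hull_subset hs (toReal_mem_hull hv)

theorem Triangulation.eq_zero_of_sum (T : Triangulation Δ) {s : Finset (Lat d)} (hs : s ∈ T.faces)
    {w : Lat d → ℝ} (h1 : ∑ v ∈ s, w v = 0) (h2 : ∑ v ∈ s, w v • toReal v = 0) :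
    ∀ v ∈ s, w v = 0 := by
  intro v hv
  refine affineIndependent_iff.1 (T.indep s hs) Finset.univ (fun v => w v) ?_ ?_ ⟨v, hv⟩
    (Finset.mem_univ _)
  · rw [← h1]
    exact Finset.sum_coe_sort s w
  · rw [← h2]
    exact Finset.sum_coe_sort s fun v => w v • toReal v

theorem Triangulation.isBounded (T : Triangulation Δ) : IsCompact Δ := by
  rw [← T.space]
  refine T.faces.finite_toSet.isCompact_biUnion fun s _ => ?_
  exact (s.finite_toSet.image _).isCompact_convexHull (𝕜 := ℝ)

/-- The lattice points of a triangulated polytope. -/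
theorem Triangulation.finite_latticePoints (T : Triangulation Δ) :
    {v : Lat d | toReal v ∈ Δ}.Finite := by
  obtain ⟨R, hR⟩ := T.isBounded.isBounded.exists_norm_le
  refine Set.Finite.subset (Set.finite_Icc (fun _ : Fin d => (-⌈R⌉ : ℤ)) fun _ => ⌈R⌉) ?_
  intro v hv
  have h1 : ∀ i, |(v i : ℝ)| ≤ R := fun i => (norm_le_pi_norm (toReal v) i).trans (hR _ hv)
  have h2 : ∀ i, |v i| ≤ ⌈R⌉ := fun i => by
    have := (h1 i).trans (Int.le_ceil R)
    exact_mod_cast this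
  exact ⟨fun i => (abs_le.1 (h2 i)).1, fun i => (abs_le.1 (h2 i)).2⟩

/-- If all of the finitely many defining inequalities were strict at u, they would be strict near u,
and u would be an interior point. -/
theorem IsPolarPair.exists_eq_one_of_mem_frontier (h : IsPolarPair Q Δ) {u : Fin d → ℝ}
    (hu : u ∈ frontier Q) : ∃ z : Lat d, toReal z ∈ Δ ∧ toReal z ⬝ᵥ u = 1 := by
  obtain ⟨S, hS, hQ⟩ := h.ineq'
  by_contra! hcon
  have hcont : ∀ v : Lat d, Continuous fun u : Fin d → ℝ => toReal v ⬝ᵥ u := fun v => by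
    unfold dotProduct
    fun_prop
  have hclosed : IsClosed Q := by
    rw [hQ, Set.ofPred_forall]
    refine isClosed_iInter fun v => ?_
    rw [Set.ofPred_forall]
    exact isClosed_iInter fun _ => isClosed_le (hcont v) continuous_const
  have huQ : u ∈ Q := hclosed.frontier_subset hu
  have hint : u ∈ interior Q := by
    refine mem_interior.2 ⟨{u | ∀ v ∈ S, toReal v ⬝ᵥ u < 1}, ?_, ?_, ?_⟩
    · intro x hx
      rw [hQ]
      exact fun v hv => (hx v hv).le
    · have h1 : {u : Fin d → ℝ | ∀ v ∈ S, toReal v ⬝ᵥ u < 1} =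
          ⋂ v ∈ S, {u | toReal v ⬝ᵥ u < 1} := by ext; simp
      rw [h1]
      exact isOpen_biInter_finset fun v _ => isOpen_lt (hcont v) continuous_const
    · intro v hv
      rw [hQ] at huQ
      exact lt_of_le_of_ne (huQ v hv) (hcon v (hS v hv))
  exact hu.2 hint

theorem IsPolarPair.lattice_le_one (h : IsPolarPair Q Δ) {u v : Lat d} (hu : toReal u ∈ Q)
    (hv : toReal v ∈ Δ) : u ⬝ᵥ v ≤ 1 := by
  have := h.le_one _ hu _ hv
  rw [toReal_dotProduct] at this
  exact_mod_cast this

theorem eq_one_of_sum_eq_one {s : Finset (Lat d)} {w f : Lat d → ℝ} (hw : ∑ v ∈ s, w v = 1)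
    (hf : ∀ v ∈ s, f v ≤ 1) (hw0 : ∀ v ∈ s, 0 < w v) (h : ∑ v ∈ s, w v * f v = 1) :
    ∀ v ∈ s, f v = 1 := by
  have h1 : ∑ v ∈ s, w v * (1 - f v) = 0 := by
    simp only [mul_sub, mul_one, Finset.sum_sub_distrib, hw, h, sub_self]
  intro v hv
  have h2 := (Finset.sum_eq_zero_iff_of_nonneg fun v hv =>
    mul_nonneg (hw0 v hv).le (sub_nonneg.2 (hf v hv))).1 h1 v hv
  have h3 := (mul_eq_zero.1 h2).resolve_left (hw0 v hv).ne'
  linarith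

/-- The vertices of a face of a polytope pair to one with a lattice point of the dual polytope. -/
theorem IsPolarPair.exists_dual_vertex (h : IsPolarPair Q Δ) (T' : Triangulation Q)
    {α : Finset (Lat d)} (hα : α ∈ T'.faces) (h0 : 0 ∉ α) :
    ∃ z : Lat d, toReal z ∈ Δ ∧ ∀ u ∈ α, u ⬝ᵥ z = 1 := by
  have hne := T'.nonempty α hα
  have hpos : (0 : ℝ) < α.card := by exact_mod_cast hne.card_pos
  have hsum : ∑ v ∈ α, (α.card : ℝ)⁻¹ = 1 := by
    rw [Finset.sum_const, nsmul_eq_mul, mul_inv_cancel₀ hpos.ne']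
  have hmem : ∑ v ∈ α, (α.card : ℝ)⁻¹ • toReal v ∈ hull α :=
    mem_hull.2 ⟨fun _ => (α.card : ℝ)⁻¹, fun _ _ => (inv_pos.2 hpos).le, hsum, rfl⟩
  obtain ⟨z, hz, hz1⟩ := h.exists_eq_one_of_mem_frontier (T'.boundary α hα h0 hmem)
  refine ⟨z, hz, fun u hu => ?_⟩
  simp only [dotProduct_sum, dotProduct_smul, smul_eq_mul] at hz1
  have := eq_one_of_sum_eq_one hsum (f := fun u => toReal z ⬝ᵥ toReal u) (fun u hu => by
    rw [dotProduct_comm]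
    exact h.le_one _ (T'.toReal_mem hα hu) _ hz) (fun _ _ => inv_pos.2 hpos) hz1 u hu
  rw [dotProduct_comm, toReal_dotProduct] at this
  exact_mod_cast this

/-- The boundary complex of a central triangulation (with the empty simplex). -/
def boundaryComplex (T : Triangulation Δ) : Set (Finset (Lat d)) :=
  {α | 0 ∉ α ∧ insert 0 α ∈ T.faces}

/-- Affine independence of the vertices is linear independence of their lifts to height one. -/
theorem exists_isDualOn_of_mem_faces (T : Triangulation Δ) {s : Finset (Lat d)}
    (hs : s ∈ T.faces) : ∃ m, IsDualOn m lift s := by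
  refine exists_isDualOn (linearIndepOn_finset_iff.2 fun c hc v hv => ?_)
  have h1 : ∑ v ∈ s, (c v : ℝ) = 0 := by
    have := congrArg Prod.snd hc
    simp only [Prod.snd_sum, Prod.smul_snd, lift, smul_eq_mul, mul_one, Prod.snd_zero] at this
    exact_mod_cast this
  have h2 : ∑ v ∈ s, (c v : ℝ) • toReal v = 0 := by
    funext i
    have := congrFun (congrArg Prod.fst hc) i
    simp only [Prod.fst_sum, Prod.smul_fst, lift, Finset.sum_apply, Pi.smul_apply, smul_eq_mul,
      Prod.fst_zero, Pi.zero_apply] at this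
    simp only [Finset.sum_apply, Pi.smul_apply, smul_eq_mul, toReal, Pi.zero_apply]
    exact_mod_cast this
  have := T.eq_zero_of_sum hs h1 h2 v hv
  exact_mod_cast this

end PolarPairs

/-! ### Acyclicity of the dual complexes -/

section Carriers

variable {d : ℕ} {Q Δ : Set (Fin d → ℝ)} {T : Triangulation Δ} {z : Lat d}

theorem Triangulation.exists_carrier (T : Triangulation Δ) {x : Fin d → ℝ} (hx : x ∈ Δ) :
    ∃ ψ ∈ T.faces, ∃ w : Lat d → ℝ, (∀ v ∈ ψ, 0 < w v) ∧ ∑ v ∈ ψ, w v = 1 ∧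
      ∑ v ∈ ψ, w v • toReal v = x := by
  classical
  rw [← T.space] at hx
  obtain ⟨s, hs, hx⟩ := Set.mem_iUnion₂.1 hx
  obtain ⟨w, h1, h2, h3⟩ := mem_hull.1 hx
  have hz : ∀ v ∈ s, v ∉ s.filter (fun v => 0 < w v) → w v = 0 := by
    intro v hv hv'
    by_contra hne
    exact hv' (Finset.mem_filter.2 ⟨hv, lt_of_le_of_ne (h1 v hv) (Ne.symm hne)⟩)
  have h2' : ∑ v ∈ s.filter (fun v => 0 < w v), w v = 1 := by
    rw [← h2]
    exact Finset.sum_subset (Finset.filter_subset _ _) hz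
  refine ⟨s.filter fun v => 0 < w v, T.down_closed s hs _ (Finset.filter_subset _ _) ?_, w,
    fun v hv => (Finset.mem_filter.1 hv).2, h2', ?_⟩
  · rw [Finset.nonempty_iff_ne_empty]
    intro h
    rw [h] at h2'
    simp at h2'
  · rw [← h3]
    refine Finset.sum_subset (Finset.filter_subset _ _) fun v hv hv' => ?_
    rw [hz v hv hv', zero_smul]

/-- The face `ψ ⊇ σ` contains the end of a short segment from a point in the interior of `σ` in the
direction of `z`; the `c v` are the affine coordinates of `z`. -/
structure IsCarrier (T : Triangulation Δ) (z : Lat d) (σ ψ : Finset (Lat d)) (c : Lat d → ℝ) :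
    Prop where
  mem_faces : ψ ∈ T.faces
  subset : σ ⊆ ψ
  sum_eq : ∑ v ∈ ψ, c v = 1
  sum_smul_eq : ∑ v ∈ ψ, c v • toReal v = toReal z
  pos : ∀ v ∈ ψ, v ∉ σ → 0 < c v

/-- Affine coordinates with respect to a simplex are unique, so the coordinates of z depend on ψ
alone. This is why the vertex to be toggled can be chosen as a function of ψ. -/
theorem IsCarrier.unique {σ σ' ψ : Finset (Lat d)} {c c' : Lat d → ℝ} (h : IsCarrier T z σ ψ c)
    (h' : IsCarrier T z σ' ψ c') : ∀ v ∈ ψ, c v = c' v := by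
  intro v hv
  have := T.eq_zero_of_sum h.mem_faces (w := fun v => c v - c' v)
    (by rw [Finset.sum_sub_distrib, h.sum_eq, h'.sum_eq, sub_self])
    (by simp only [sub_smul]; rw [Finset.sum_sub_distrib, h.sum_smul_eq, h'.sum_smul_eq, sub_self])
    v hv
  exact sub_eq_zero.1 this

theorem IsCarrier.exists_pos {σ ψ : Finset (Lat d)} {c : Lat d → ℝ} (h : IsCarrier T z σ ψ c) :
    ∃ v ∈ ψ, 0 < c v := by
  by_contra! hcon
  have := Finset.sum_nonpos hcon
  rw [h.sum_eq] at this
  linarith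

/-- The value at `z` of the affine function that agrees with `μ` on the carrier decreases when the
simplex grows. -/
theorem IsCarrier.sum_le {μ : Lat d → ℤ} (hμ : T.IsInducedBy μ) {σ σ' ψ ψ' : Finset (Lat d)}
    {c c' : Lat d → ℝ} (h : IsCarrier T z σ ψ c) (h' : IsCarrier T z σ' ψ' c') (hσ : σ ⊆ σ') :
    ∑ v ∈ ψ', c' v * μ v ≤ ∑ v ∈ ψ, c v * μ v ∧
      (∑ v ∈ ψ, c v * μ v = ∑ v ∈ ψ', c' v * μ v → ψ ⊆ ψ') := by
  obtain ⟨x, hx⟩ := (hμ ψ').1 h'.mem_faces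
  obtain ⟨y, hy⟩ := T.nonempty _ h'.mem_faces
  set M : ℝ := x ⬝ᵥ toReal y - μ y with hM
  have hmax := (hx y).1 hy
  have h1 : ∀ v ∈ ψ', (μ v : ℝ) = x ⬝ᵥ toReal v - M := by
    intro v hv
    have h2 := ((hx v).1 hv).2 y hmax.1
    have h3 := hmax.2 v ((hx v).1 hv).1
    linarith
  have hval : ∀ {σ ψ : Finset (Lat d)} {c : Lat d → ℝ}, IsCarrier T z σ ψ c →
      ∑ v ∈ ψ, c v * (x ⬝ᵥ toReal v - M) = x ⬝ᵥ toReal z - M := by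
    intro σ ψ c h
    simp only [mul_sub, Finset.sum_sub_distrib, ← Finset.sum_mul, h.sum_eq, one_mul]
    rw [← h.sum_smul_eq]
    simp only [dotProduct_sum, dotProduct_smul, smul_eq_mul]
  have h2 : ∑ v ∈ ψ', c' v * μ v = x ⬝ᵥ toReal z - M := by
    rw [← hval h']
    exact Finset.sum_congr rfl fun v hv => by rw [h1 v hv]
  -- The affine function agreeing with μ on ψ' lies below μ, with equality only on ψ'. Negative
  -- coordinates occur only in σ ⊆ ψ', where the difference vanishes.
  have h3 : ∀ v ∈ ψ, 0 ≤ c v * (μ v - (x ⬝ᵥ toReal v - M)) := by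
    intro v hv
    by_cases hvσ : v ∈ σ
    · rw [h1 v (h'.subset (hσ hvσ)), sub_self, mul_zero]
    · refine mul_nonneg (h.pos v hv hvσ).le ?_
      have := hmax.2 v (T.toReal_mem h.mem_faces hv)
      linarith
  have h4 : ∑ v ∈ ψ, c v * (μ v - (x ⬝ᵥ toReal v - M)) =
      ∑ v ∈ ψ, c v * μ v - (x ⬝ᵥ toReal z - M) := by
    rw [← hval h, ← Finset.sum_sub_distrib]
    exact Finset.sum_congr rfl fun v _ => by ring
  rw [h2]
  refine ⟨?_, fun heq v hv => ?_⟩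
  · have := Finset.sum_nonneg h3
    rw [h4] at this
    linarith
  · by_cases hvσ : v ∈ σ
    · exact h'.subset (hσ hvσ)
    · rw [heq, sub_self] at h4
      have h5 := (Finset.sum_eq_zero_iff_of_nonneg h3).1 h4 v hv
      have h6 := (mul_eq_zero.1 h5).resolve_left (h.pos v hv hvσ).ne'
      refine (hx v).2 ⟨T.toReal_mem h.mem_faces hv, fun w hw => ?_⟩
      have := hmax.2 w hw
      linarith

/-- Move from the barycentre of σ towards z by 1/(k + 1). Infinitely many of these points lie in the
relative interior of one simplex ψ, whose closedness puts the barycentre in it, so σ ⊆ ψ. The extra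
weights exhibit a relative interior point of ψ as an affine combination of σ and z, used to keep ψ
in the face of the polytope containing both. -/
theorem exists_isCarrier (T : Triangulation Δ) (hconv : Convex ℝ Δ) (hz : toReal z ∈ Δ)
    {σ : Finset (Lat d)} (hσ : σ = ∅ ∨ σ ∈ T.faces) :
    ∃ ψ c, IsCarrier T z σ ψ c ∧ ∃ w : Lat d → ℝ, ∃ a b : ℝ, (∀ v ∈ ψ, 0 < w v) ∧
      ∑ v ∈ ψ, w v = 1 ∧ ∑ v ∈ ψ, w v • toReal v =
        a • ∑ v ∈ σ, toReal v + b • toReal z ∧ a * σ.card + b = 1 := by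
  classical
  rcases hσ with rfl | hσ
  · obtain ⟨ψ, hψ, w, h1, h2, h3⟩ := T.exists_carrier hz
    exact ⟨ψ, w, ⟨hψ, Finset.empty_subset _, h2, h3, fun v hv _ => h1 v hv⟩, w, 0, 1, h1, h2,
      by simp [h3], by simp⟩
  have hne := T.nonempty σ hσ
  have hpos : (0 : ℝ) < σ.card := by exact_mod_cast hne.card_pos
  set g : Fin d → ℝ := (σ.card : ℝ)⁻¹ • ∑ v ∈ σ, toReal v with hg
  have hgσ : g ∈ hull σ := by
    refine mem_hull.2 ⟨fun _ => (σ.card : ℝ)⁻¹, fun _ _ => (inv_pos.2 hpos).le, ?_, ?_⟩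
    · rw [Finset.sum_const, nsmul_eq_mul, mul_inv_cancel₀ hpos.ne']
    · rw [hg, Finset.smul_sum]
  let ε : ℕ → ℝ := fun k => 1 / (k + 1)
  have hε0 : ∀ k, 0 < ε k := fun k => Nat.one_div_pos_of_nat
  have hε1 : ∀ k, ε k ≤ 1 := fun k => by
    have : (0 : ℝ) ≤ k := Nat.cast_nonneg k
    exact (div_le_one (by linarith)).2 (by linarith)
  have hy : ∀ k, (1 - ε k) • g + ε k • toReal z ∈ Δ := fun k =>
    hconv (T.hull_subset hσ hgσ) hz (sub_nonneg.2 (hε1 k)) (hε0 k).le (by ring)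
  choose ψ hψ w h1 h2 h3 using fun k => T.exists_carrier (hy k)
  obtain ⟨⟨ψ₀, hψ₀⟩, hinf⟩ := Finite.exists_infinite_fiber fun k => (⟨ψ k, hψ k⟩ : T.faces)
  have hψk : ∀ k, k ∈ (fun k => (⟨ψ k, hψ k⟩ : T.faces)) ⁻¹' {⟨ψ₀, hψ₀⟩} → ψ k = ψ₀ := by
    intro k hk
    exact congrArg Subtype.val hk
  have hgψ : g ∈ hull ψ₀ := by
    have hcl : IsClosed (hull ψ₀) := (ψ₀.finite_toSet.image _).isClosed_convexHull (𝕜 := ℝ)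
    have hlim : Filter.Tendsto (fun k => (1 - ε k) • g + ε k • toReal z) Filter.atTop (nhds g) := by
      have h0 : Filter.Tendsto ε Filter.atTop (nhds 0) := tendsto_one_div_add_atTop_nhds_zero_nat
      have := ((tendsto_const_nhds (x := (1 : ℝ))).sub h0).smul_const g |>.add
        (h0.smul_const (toReal z))
      simpa using this
    refine hcl.mem_of_frequently_of_tendsto ?_ hlim
    refine (Nat.frequently_atTop_iff_infinite.2 (Set.infinite_coe_iff.1 hinf)).mono fun k hk => ?_
    rw [← hψk k hk]
    exact mem_hull.2 ⟨w k, fun v hv => (h1 k v hv).le, h2 k, h3 k⟩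
  have hsub : σ ⊆ ψ₀ := by
    obtain ⟨w', h4, h5, h6⟩ := mem_hull.1 (T.inter σ hσ ψ₀ hψ₀ ⟨hgσ, hgψ⟩)
    intro v hv
    by_contra hv'
    have h7 : ∀ f : Lat d → ℝ, ∑ v ∈ σ, (if v ∈ ψ₀ then f v else 0) = ∑ v ∈ σ ∩ ψ₀, f v := by
      intro f
      rw [← Finset.sum_filter, Finset.filter_mem_eq_inter]
    have h8 := T.eq_zero_of_sum hσ (w := fun v => (σ.card : ℝ)⁻¹ - if v ∈ ψ₀ then w' v else 0)
      (by rw [Finset.sum_sub_distrib, h7, h5, Finset.sum_const, nsmul_eq_mul,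
            mul_inv_cancel₀ hpos.ne', sub_self])
      (by
        simp only [sub_smul, ite_smul, zero_smul]
        rw [Finset.sum_sub_distrib, ← Finset.sum_filter, Finset.filter_mem_eq_inter, h6,
          ← Finset.smul_sum, sub_self]) v hv
    simp only [hv', if_false, sub_zero] at h8
    exact (inv_pos.2 hpos).ne' h8
  obtain ⟨⟨k, hk⟩⟩ := hinf.nonempty
  have hk := hψk k hk
  subst hk
  have h4 : ∀ f : Lat d → ℝ, ∑ v ∈ ψ k, (if v ∈ σ then f v else 0) = ∑ v ∈ σ, f v := by
    intro f
    rw [← Finset.sum_filter, Finset.filter_mem_eq_inter, Finset.inter_eq_right.2 hsub]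
  -- Solving y = (1 - ε) g + ε z for z gives its affine coordinates; off σ they are positive
  -- multiples of those of y.
  refine ⟨ψ k, fun v => (ε k)⁻¹ * (w k v - if v ∈ σ then (1 - ε k) * (σ.card : ℝ)⁻¹ else 0),
    ⟨hψ₀, hsub, ?_, ?_, fun v hv hvσ => ?_⟩, w k, (1 - ε k) * (σ.card : ℝ)⁻¹, ε k, h1 k, h2 k,
    ?_, ?_⟩
  · rw [← Finset.mul_sum, Finset.sum_sub_distrib, h2, h4, Finset.sum_const, nsmul_eq_mul,
      mul_comm (1 - ε k), ← mul_assoc, mul_inv_cancel₀ hpos.ne', one_mul, sub_sub_cancel,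
      inv_mul_cancel₀ (hε0 k).ne']
  · have h5 : ∀ a : ℝ, ∑ v ∈ ψ k, (if v ∈ σ then a * (σ.card : ℝ)⁻¹ else 0) • toReal v = a • g := by
      intro a
      simp only [ite_smul, zero_smul]
      rw [← Finset.sum_filter, Finset.filter_mem_eq_inter, Finset.inter_eq_right.2 hsub,
        ← Finset.smul_sum, mul_smul]
    simp only [mul_smul, sub_smul _ (ite _ _ _)]
    rw [← Finset.smul_sum, Finset.sum_sub_distrib, h3, h5, add_sub_cancel_left, smul_smul,
      inv_mul_cancel₀ (hε0 k).ne', one_smul]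
  · simp only [hvσ, if_false, sub_zero]
    exact mul_pos (inv_pos.2 (hε0 k)) (h1 k v hv)
  · rw [h3, mul_smul, ← hg]
  · rw [mul_assoc, inv_mul_cancel₀ hpos.ne']
    ring

end Carriers

/-! ### Acyclicity of the triangulated faces and the mirror pair of boundary complexes. -/

section DualComplex

variable {d : ℕ} {Q Δ : Set (Fin d → ℝ)} {T : Triangulation Δ} {z : Lat d}

theorem mem_dualComplex_boundaryComplex {α σ : Finset (Lat d)} :
    σ ∈ dualComplex (boundaryComplex T) α ↔
      insert 0 σ ∈ T.faces ∧ ∀ u ∈ α, ∀ b ∈ σ, u ⬝ᵥ b = 1 := by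
  have h : insert 0 (σ.erase 0) = insert 0 σ := by
    ext x
    by_cases hx : x = 0 <;> simp [hx]
  change (0 ∉ σ.erase 0 ∧ insert 0 (σ.erase 0) ∈ T.faces) ∧ _ ↔ _
  rw [h]
  simp

theorem Triangulation.insert_zero_mem_mono (T : Triangulation Δ) {σ σ' : Finset (Lat d)}
    (h : insert 0 σ ∈ T.faces) (hσ : σ' ⊆ σ) : insert 0 σ' ∈ T.faces :=
  T.down_closed _ h _ (Finset.insert_subset_insert _ hσ) (Finset.insert_nonempty _ _)

theorem Triangulation.eq_empty_or_mem_faces (T : Triangulation Δ) {σ : Finset (Lat d)}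
    (h : insert 0 σ ∈ T.faces) : σ = ∅ ∨ σ ∈ T.faces := by
  rcases σ.eq_empty_or_nonempty with h0 | h0
  · exact Or.inl h0
  · exact Or.inr (T.down_closed _ h _ (Finset.subset_insert _ _) h0)

theorem IsPolarPair.convex (h : IsPolarPair Q Δ) : Convex ℝ Δ := by
  obtain ⟨S, -, hS⟩ := h.ineq
  rw [hS]
  intro x hx y hy a b ha hb hab v hv
  rw [dotProduct_add, dotProduct_smul, dotProduct_smul, smul_eq_mul, smul_eq_mul]
  have h1 := mul_le_mul_of_nonneg_left (hx v hv) ha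
  have h2 := mul_le_mul_of_nonneg_left (hy v hv) hb
  linarith

/-- For α = ∅ the whole central triangulation occurs, a cone with apex 0: toggling 0 is a matching
with a single level. -/
theorem isAcyclic_dualComplex_empty (T : Triangulation Δ) :
    IsAcyclic (dualComplex (boundaryComplex T) ∅) := by
  have hmem : ∀ σ, σ ∈ dualComplex (boundaryComplex T) ∅ ↔ insert 0 σ ∈ T.faces := fun σ => by
    rw [mem_dualComplex_boundaryComplex]
    simp
  have hdown : ∀ σ ∈ dualComplex (boundaryComplex T) ∅, ∀ σ' ⊆ σ,
      σ' ∈ dualComplex (boundaryComplex T) ∅ := fun σ hσ σ' h =>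
    (hmem _).2 (T.insert_zero_mem_mono ((hmem _).1 hσ) h)
  have hfin : (dualComplex (boundaryComplex T) ∅).Finite := by
    refine Set.Finite.subset (T.faces.finite_toSet.union (Set.finite_singleton ∅)) fun σ hσ => ?_
    rcases T.eq_empty_or_mem_faces ((hmem σ).1 hσ) with h | h
    · exact Or.inr h
    · exact Or.inl h
  refine isAcyclic_of_toggle (ord := fun _ => (0 : ℕ)) (t := fun _ => 0) hfin hdown
    (fun _ _ _ _ => le_rfl) (fun _ _ _ _ _ => rfl) (fun σ hσ => ⟨(hmem _).2 ?_, rfl⟩)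
    fun _ _ => rfl
  rw [Finset.insert_idem]
  exact (hmem σ).1 hσ

/-- For α nonempty the complex triangulates the face of Δ on which all u ∈ α take the value 1. Fix a
lattice point z there and let ψ be the carrier of σ towards z; it stays in the face, because numbers
at most 1 whose average with positive weights is 1 are all 1. Toggling a vertex of ψ at which z has
a positive coordinate changes neither ψ nor the coordinates, and the carriers order the simplices.
-/
theorem isAcyclic_dualComplex (hQ : IsPolarPair Q Δ) (T' : Triangulation Q) {μ : Lat d → ℤ}
    (hμ : T.IsInducedBy μ) {α : Finset (Lat d)} (hα : α ∈ boundaryComplex T') :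
    IsAcyclic (dualComplex (boundaryComplex T) α) := by
  classical
  rcases T'.eq_empty_or_mem_faces hα.2 with rfl | hαT
  · exact isAcyclic_dualComplex_empty T
  obtain ⟨z, hz, hαz⟩ := hQ.exists_dual_vertex T' hαT hα.1
  have hmem : ∀ σ, σ ∈ dualComplex (boundaryComplex T) α ↔
      insert 0 σ ∈ T.faces ∧ ∀ u ∈ α, ∀ b ∈ σ, u ⬝ᵥ b = 1 :=
    fun σ => mem_dualComplex_boundaryComplex
  have hdown : ∀ σ ∈ dualComplex (boundaryComplex T) α, ∀ σ' ⊆ σ,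
      σ' ∈ dualComplex (boundaryComplex T) α := fun σ hσ σ' h =>
    (hmem _).2 ⟨T.insert_zero_mem_mono ((hmem _).1 hσ).1 h,
      fun u hu b hb => ((hmem _).1 hσ).2 u hu b (h hb)⟩
  have hfin : (dualComplex (boundaryComplex T) α).Finite := by
    refine Set.Finite.subset (T.faces.finite_toSet.union (Set.finite_singleton ∅)) fun σ hσ => ?_
    rcases T.eq_empty_or_mem_faces ((hmem σ).1 hσ).1 with h | h
    · exact Or.inr h
    · exact Or.inl h
  have hcar : ∀ σ, ∃ ψ c, σ ∈ dualComplex (boundaryComplex T) α →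
      IsCarrier T z σ ψ c ∧ ψ ∈ dualComplex (boundaryComplex T) α := by
    intro σ
    by_cases hσ : σ ∈ dualComplex (boundaryComplex T) α
    swap
    · exact ⟨∅, 0, fun h => absurd h hσ⟩
    obtain ⟨ψ, c, h1, w, a, b, hw0, hw1, hw2, hab⟩ := exists_isCarrier T hQ.convex hz
      (T.eq_empty_or_mem_faces ((hmem σ).1 hσ).1)
    refine ⟨ψ, c, fun _ => ⟨h1, (hmem ψ).2 ⟨T.insert_zero _ h1.mem_faces, fun u hu v hv => ?_⟩⟩⟩
    have hsum : ∑ v ∈ ψ, w v * (toReal u ⬝ᵥ toReal v) = 1 := by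
      have h2 := congrArg (fun x => toReal u ⬝ᵥ x) hw2
      simp only [dotProduct_sum, dotProduct_smul, smul_eq_mul, dotProduct_add] at h2
      have h3 : ∑ v ∈ σ, toReal u ⬝ᵥ toReal v = σ.card := by
        rw [Finset.sum_congr rfl fun v hv => by
          rw [toReal_dotProduct, ((hmem σ).1 hσ).2 u hu v hv, Int.cast_one]]
        simp
      rw [h2, h3, toReal_dotProduct, hαz u hu, Int.cast_one, mul_one, hab]
    have h4 := eq_one_of_sum_eq_one hw1 (fun v hv => hQ.le_one _ (T'.toReal_mem hαT hu) _
      (T.toReal_mem h1.mem_faces hv)) hw0 hsum v hv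
    rw [toReal_dotProduct] at h4
    exact_mod_cast h4
  choose ψ c hψ using hcar
  have htog : ∀ ψ : Finset (Lat d), ∃ t, ∀ σ c, IsCarrier T z σ ψ c → t ∈ ψ ∧ 0 < c t := by
    intro ψ
    by_cases h : ∃ σ c, IsCarrier T z σ ψ c
    · obtain ⟨σ, c, h⟩ := h
      obtain ⟨t, ht, hpos⟩ := h.exists_pos
      exact ⟨t, fun σ' c' h' => ⟨ht, (h.unique h' t ht) ▸ hpos⟩⟩
    · exact ⟨0, fun σ c h' => absurd ⟨σ, c, h'⟩ h⟩
  choose t ht using htog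
  -- The value at z of the affine extension of μ from ψ decreases as σ grows, hence the minus sign.
  -- When the values agree the carriers are nested, and their cardinality then detects whether they
  -- are equal.
  let ord : Finset (Lat d) → ℝ ×ₗ ℕ := fun σ =>
    toLex (-∑ v ∈ ψ σ, c σ v * μ v, (ψ σ).card)
  have hsame : ∀ σ ∈ dualComplex (boundaryComplex T) α, ∀ ψ' c', IsCarrier T z σ ψ' c' →
      ψ' = ψ σ ∧ toLex (-∑ v ∈ ψ', c' v * μ v, ψ'.card) = ord σ := by
    intro σ hσ ψ' c' h
    have h1 := h.sum_le hμ (hψ σ hσ).1 subset_rfl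
    have h2 := (hψ σ hσ).1.sum_le hμ h subset_rfl
    have h3 := le_antisymm h1.1 h2.1
    have h4 : ψ' = ψ σ := (h1.2 h3.symm).antisymm (h2.2 h3)
    refine ⟨h4, ?_⟩
    change _ = toLex (-∑ v ∈ ψ σ, c σ v * μ v, (ψ σ).card)
    rw [h3, h4]
  refine isAcyclic_of_toggle (ord := ord) (t := fun σ => t (ψ σ)) hfin hdown ?_ ?_ ?_ ?_
  · intro σ hσ σ' hσ'
    have h1 := (hψ σ' (hdown σ hσ σ' hσ')).1.sum_le hμ (hψ σ hσ).1 hσ'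
    rw [Prod.Lex.toLex_le_toLex]
    rcases h1.1.lt_or_eq with hlt | heq
    · exact Or.inl (neg_lt_neg hlt)
    · exact Or.inr ⟨congrArg Neg.neg heq.symm, Finset.card_le_card (h1.2 heq.symm)⟩
  · intro σ hσ σ' hσ' heq
    have h1 := (hψ σ' (hdown σ hσ σ' hσ')).1.sum_le hμ (hψ σ hσ).1 hσ'
    have h2 := Prod.ext_iff.1 (toLex.injective heq)
    change t (ψ σ') = t (ψ σ)
    rw [Finset.eq_of_subset_of_card_le (h1.2 (neg_injective h2.1)) h2.2.ge]
  · intro σ hσ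
    have h1 := (hψ σ hσ).1
    obtain ⟨h2, h3⟩ := ht _ _ _ h1
    have h4 : insert (t (ψ σ)) σ ∈ dualComplex (boundaryComplex T) α :=
      hdown _ (hψ σ hσ).2 _ (Finset.insert_subset h2 h1.subset)
    exact ⟨h4, (hsame _ h4 (ψ σ) (c σ) ⟨h1.mem_faces, Finset.insert_subset h2 h1.subset,
      h1.sum_eq, h1.sum_smul_eq, fun v hv hvσ => h1.pos v hv fun h =>
        hvσ (Finset.mem_insert_of_mem h)⟩).2.symm⟩
  · intro σ hσ
    have h1 := (hψ σ hσ).1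
    obtain ⟨h2, h3⟩ := ht _ _ _ h1
    refine (hsame _ (hdown σ hσ _ (Finset.erase_subset _ _)) (ψ σ) (c σ) ⟨h1.mem_faces,
      (Finset.erase_subset _ _).trans h1.subset, h1.sum_eq, h1.sum_smul_eq, fun v hv hvσ => ?_⟩).2.symm
    by_cases hvt : v = t (ψ σ)
    · rwa [hvt]
    · exact h1.pos v hv fun h => hvσ (Finset.mem_erase.2 ⟨hvt, h⟩)

theorem isMirrorPair_boundaryComplex (hQ : IsPolarPair Q Δ) {T' : Triangulation Q}
    {μ μ' : Lat d → ℤ} (hμ : T.IsInducedBy μ) (hμ' : T'.IsInducedBy μ') :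
    IsMirrorPair (boundaryComplex T') (boundaryComplex T) where
  empty_mem' := ⟨Finset.notMem_empty _, T'.zero_mem⟩
  empty_mem := ⟨Finset.notMem_empty _, T.zero_mem⟩
  zero_notMem' α h := h.1
  zero_notMem α h := h.1
  down_closed' α h α' hα := ⟨fun h0 => h.1 (hα h0), T'.insert_zero_mem_mono h.2 hα⟩
  down_closed α h α' hα := ⟨fun h0 => h.1 (hα h0), T.insert_zero_mem_mono h.2 hα⟩
  dual' α h := exists_isDualOn_of_mem_faces T' h.2
  dual α h := exists_isDualOn_of_mem_faces T h.2
  acyclic' β h := isAcyclic_dualComplex hQ.symm T hμ' h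
  acyclic α h := isAcyclic_dualComplex hQ T' hμ h

end DualComplex

/-! ### The cells of the tropical toric variety -/

section ClosedCells

variable {d : ℕ} {Q Δ : Set (Fin d → ℝ)} {T' : Triangulation Q} {T : Triangulation Δ}
  {μ : Lat d → ℤ} {τ σ : Finset (Lat d)}

theorem mem_dualSemigroup_iff {m : Lat d} : m ∈ dualSemigroup τ ↔ ∀ u ∈ τ, 0 ≤ m ⬝ᵥ u := by
  classical
  constructor
  · intro h u hu
    have := h (toReal u) ⟨fun v => if v = u then 1 else 0, fun v _ => by positivity, by
      simp [ite_smul, hu]⟩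
    rw [toReal_dotProduct] at this
    exact_mod_cast this
  · rintro h _ ⟨c, hc, rfl⟩
    rw [dotProduct_sum]
    refine Finset.sum_nonneg fun u hu => ?_
    rw [dotProduct_smul, toReal_dotProduct, smul_eq_mul]
    exact mul_nonneg (hc u hu) (by exact_mod_cast h u hu)

theorem mem_conePerp_iff {m : Lat d} : m ∈ conePerp τ ↔ ∀ u ∈ τ, m ⬝ᵥ u = 0 := by
  classical
  constructor
  · intro h u hu
    have := h (toReal u) ⟨fun v => if v = u then 1 else 0, fun v _ => by positivity, by
      simp [ite_smul, hu]⟩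
    rw [toReal_dotProduct] at this
    exact_mod_cast this
  · rintro h _ ⟨c, hc, rfl⟩
    rw [dotProduct_sum]
    refine Finset.sum_eq_zero fun u hu => ?_
    rw [dotProduct_smul, toReal_dotProduct, h u hu, Int.cast_zero, smul_zero]

theorem eval_torusPoint (x : Fin d → ℝ) (m : Lat d) :
    (torusPoint T' x).eval m = ((x ⬝ᵥ toReal m : ℝ) : EReal) := by
  have h : m ∈ conePerp (torusPoint T' x).simplex :=
    mem_conePerp_iff.2 fun u hu => by
      rw [Finset.mem_singleton.1 hu, dotProduct_zero]
  rw [ToricPoint.eval, dif_pos h]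
  rfl

/-- The limit of `x + t v` for `v` in the relative interior of the cone over `τ`. -/
def orbitPoint (T' : Triangulation Q) (hτ : τ ∈ T'.faces) (h0 : 0 ∈ τ) (x : Fin d → ℝ) :
    ToricPoint T' where
  simplex := τ
  mem_faces := hτ
  zero_mem := h0
  val :=
    { toFun := fun m => x ⬝ᵥ toReal (m : Lat d)
      map_zero' := by simp
      map_add' := fun a b => by simp [toReal_add] }

theorem eval_orbitPoint_of_mem (hτ : τ ∈ T'.faces) (h0 : 0 ∈ τ) (x : Fin d → ℝ) {m : Lat d}
    (hm : m ∈ conePerp τ) :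
    (orbitPoint T' hτ h0 x).eval m = ((x ⬝ᵥ toReal m : ℝ) : EReal) := by
  have h : m ∈ conePerp (orbitPoint T' hτ h0 x).simplex := hm
  rw [ToricPoint.eval, dif_pos h]
  rfl

theorem eval_of_notMem {q : ToricPoint T'} {m : Lat d} (hm : m ∉ conePerp q.simplex) :
    q.eval m = ⊤ := by
  rw [ToricPoint.eval, dif_neg hm]

theorem isOpen_eval_mem (hτ : τ ∈ T'.faces) (h0 : 0 ∈ τ) {m : Lat d} (hm : m ∈ dualSemigroup τ)
    {O : Set EReal} (hO : IsOpen O) : IsOpen {q ∈ chart T' τ | q.eval m ∈ O} :=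
  TopologicalSpace.isOpen_generateFrom_of_mem ⟨τ, hτ, h0, m, hm, O, hO, rfl⟩

/-- Along the ray, an m in the semigroup of a chart containing the orbit of τ has a constant pairing
if it is orthogonal to τ, and one tending to +∞ otherwise. -/
theorem tendsto_torusPoint (hτ : τ ∈ T'.faces) (h0 : 0 ∈ τ) (x : Fin d → ℝ) :
    Filter.Tendsto (fun t : ℝ => torusPoint T' (x + t • ∑ u ∈ τ, toReal u)) Filter.atTop
      (nhds (orbitPoint T' hτ h0 x)) := by
  rw [TopologicalSpace.tendsto_nhds_generateFrom_iff]
  rintro _ ⟨τ', hτ', h0', m, hm, O, hO, rfl⟩ ⟨hq1, hq2⟩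
  have hsub : τ ⊆ τ' := hq1
  have hval : ∀ t : ℝ, (x + t • ∑ u ∈ τ, toReal u) ⬝ᵥ toReal m =
      x ⬝ᵥ toReal m + t * ((∑ u ∈ τ, m ⬝ᵥ u : ℤ) : ℝ) := by
    intro t
    rw [add_dotProduct, smul_dotProduct, sum_dotProduct, smul_eq_mul]
    congr 2
    push_cast
    refine Finset.sum_congr rfl fun u _ => ?_
    rw [toReal_dotProduct, dotProduct_comm]
  have hpos : ∀ u ∈ τ, 0 ≤ m ⬝ᵥ u := fun u hu => mem_dualSemigroup_iff.1 hm u (hsub hu)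
  have hchart : ∀ t : ℝ, torusPoint T' (x + t • ∑ u ∈ τ, toReal u) ∈ chart T' τ' :=
    fun t => Finset.singleton_subset_iff.2 h0'
  have hev : ∀ᶠ t : ℝ in Filter.atTop,
      (torusPoint T' (x + t • ∑ u ∈ τ, toReal u)).eval m ∈ O := by
    by_cases hmτ : m ∈ conePerp τ
    · rw [eval_orbitPoint_of_mem hτ h0 x hmτ] at hq2
      refine Filter.Eventually.of_forall fun t => ?_
      rw [eval_torusPoint, hval, Finset.sum_eq_zero (mem_conePerp_iff.1 hmτ)]
      simpa using hq2
    · rw [eval_of_notMem (show m ∉ conePerp (orbitPoint T' hτ h0 x).simplex from hmτ)] at hq2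
      have hsum : 0 < ∑ u ∈ τ, m ⬝ᵥ u := by
        refine lt_of_le_of_ne (Finset.sum_nonneg hpos) fun h => hmτ ?_
        exact mem_conePerp_iff.2 ((Finset.sum_eq_zero_iff_of_nonneg hpos).1 h.symm)
      have hlim : Filter.Tendsto (fun t : ℝ =>
          ((x ⬝ᵥ toReal m + t * ((∑ u ∈ τ, m ⬝ᵥ u : ℤ) : ℝ) : ℝ) : EReal)) Filter.atTop
          (nhds ⊤) := by
        rw [EReal.tendsto_coe_nhds_top_iff]
        exact Filter.tendsto_atTop_add_const_left _ _
          (Filter.tendsto_id.atTop_mul_const (by exact_mod_cast hsum))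
      filter_upwards [hlim.eventually (hO.mem_nhds hq2)] with t ht
      rw [eval_torusPoint, hval]
      exact ht
  filter_upwards [hev] with t ht
  exact ⟨hchart t, ht⟩

variable (hQ : IsPolarPair Q Δ)
include hQ

/-- By polarity, nonzero u ∈ τ are at most 1 on Δ and equal to 1 on σ, so adding multiples of them
keeps the points of σ maximal. -/
theorem add_smul_mem_dualCell (hτ : τ ∈ T'.faces) (hσ : σ ∈ T.faces)
    (h1 : ∀ u ∈ τ.erase 0, ∀ b ∈ σ, u ⬝ᵥ b = 1) {x : Fin d → ℝ} (hx : x ∈ dualCell Δ μ σ) {t : ℝ}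
    (ht : 0 ≤ t) : x + t • ∑ u ∈ τ, toReal u ∈ dualCell Δ μ σ := by
  intro y hy
  refine ⟨(hx y hy).1, fun z hz => ?_⟩
  have h2 := (hx y hy).2 z hz
  have h3 : (∑ u ∈ τ, toReal u) ⬝ᵥ toReal z ≤ (∑ u ∈ τ, toReal u) ⬝ᵥ toReal y := by
    rw [sum_dotProduct, sum_dotProduct]
    refine Finset.sum_le_sum fun u hu => ?_
    by_cases hu0 : u = 0
    · simp [hu0]
    · rw [toReal_dotProduct u y, h1 u (Finset.mem_erase.2 ⟨hu0, hu⟩) y hy, Int.cast_one]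
      exact hQ.le_one _ (T'.toReal_mem hτ hu) _ hz
  have h4 := mul_le_mul_of_nonneg_left h3 ht
  simp only [add_dotProduct, smul_dotProduct, smul_eq_mul]
  linarith

theorem orbitPoint_mem_closedCell (hτ : τ ∈ T'.faces) (h0 : 0 ∈ τ) (hσ : σ ∈ T.faces)
    (h1 : ∀ u ∈ τ.erase 0, ∀ b ∈ σ, u ⬝ᵥ b = 1) {x : Fin d → ℝ} (hx : x ∈ dualCell Δ μ σ) :
    orbitPoint T' hτ h0 x ∈ closedCell T' Δ μ τ σ := by
  refine ⟨mem_closure_of_tendsto (tendsto_torusPoint hτ h0 x) ?_, subset_closure rfl⟩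
  filter_upwards [Filter.eventually_ge_atTop (0 : ℝ)] with t ht
  exact ⟨_, add_smul_mem_dualCell hQ hτ hσ h1 hx ht, rfl⟩

/-- If u·b < 1, take a lattice point z of Δ pairing to 1 with the nonzero vertices of the simplex of
the limit point q. Then z - b is a nonnegative exponent which is infinite at q, while on the cell
dual to σ it is bounded by μ(z) - μ(b). Conversely, the cell contains rays in the direction of C(τ),
whose limits lie in the orbit. -/
theorem closedCell_nonempty_iff (hμ : T.IsInducedBy μ) (hτ : τ ∈ T'.faces) (h0 : 0 ∈ τ)
    (hσ : σ ∈ T.faces) : (closedCell T' Δ μ τ σ).Nonempty ↔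
      ∀ u ∈ τ.erase 0, ∀ b ∈ σ, u ⬝ᵥ b = 1 := by
  constructor
  · rintro ⟨q, hq1, hq2⟩ u hu b hb
    have hτq : τ ⊆ q.simplex := by
      have hopen := isOpen_eval_mem q.mem_faces q.zero_mem (m := 0)
        (mem_dualSemigroup_iff.2 fun u _ => by simp) isOpen_univ
      obtain ⟨q', hq', hq''⟩ := mem_closure_iff.1 hq2 _ hopen
        ⟨(subset_rfl : q.simplex ⊆ q.simplex), Set.mem_univ _⟩
      rw [← (show q'.simplex = τ from hq'')]
      exact hq'.1
    have huq : u ∈ q.simplex.erase 0 := Finset.erase_subset_erase _ hτq hu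
    obtain ⟨z, hz, hz1⟩ := hQ.exists_dual_vertex T' (α := q.simplex.erase 0)
      (T'.down_closed _ q.mem_faces _ (Finset.erase_subset _ _) ⟨u, huq⟩) (Finset.notMem_erase _ _)
    have hbΔ := T.toReal_mem hσ hb
    by_contra hne
    have hlt : u ⬝ᵥ b < 1 := lt_of_le_of_ne
      (hQ.lattice_le_one (T'.toReal_mem hτ (Finset.mem_of_mem_erase hu)) hbΔ) hne
    have hval : ∀ v ∈ q.simplex, v ≠ 0 → (z - b) ⬝ᵥ v = 1 - v ⬝ᵥ b := by
      intro v hv hv0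
      rw [sub_dotProduct, dotProduct_comm z, hz1 v (Finset.mem_erase.2 ⟨hv0, hv⟩),
        dotProduct_comm b]
    have hm : z - b ∈ dualSemigroup q.simplex := mem_dualSemigroup_iff.2 fun v hv => by
      by_cases hv0 : v = 0
      · simp [hv0]
      · rw [hval v hv hv0, sub_nonneg]
        exact hQ.lattice_le_one (T'.toReal_mem q.mem_faces hv) hbΔ
    have hmq : z - b ∉ conePerp q.simplex := fun h => by
      have h1 := mem_conePerp_iff.1 h u (Finset.mem_of_mem_erase huq)
      rw [hval u (Finset.mem_of_mem_erase huq) (Finset.ne_of_mem_erase huq)] at h1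
      omega
    obtain ⟨_, hq', x, hx, rfl⟩ := mem_closure_iff.1 hq1 _
      (isOpen_eval_mem q.mem_faces q.zero_mem hm
        (isOpen_Ioi (a := (((μ z - μ b : ℤ) : ℝ) : EReal))))
      ⟨(subset_rfl : q.simplex ⊆ q.simplex), by
        rw [eval_of_notMem hmq]
        exact EReal.coe_lt_top _⟩
    have h2 := hq'.2
    rw [eval_torusPoint, Set.mem_Ioi, EReal.coe_lt_coe_iff, toReal_sub, dotProduct_sub] at h2
    have h3 := (hx b hb).2 z hz
    push_cast at h2
    linarith
  · intro h1
    obtain ⟨x, hx⟩ := (hμ σ).1 hσ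
    exact ⟨_, orbitPoint_mem_closedCell hQ hτ h0 hσ h1 (x := x) fun y hy => (hx y).1 hy⟩

/-- If σ = {b}, start from an x at which b is the only maximizer: the limit point in the orbit of τ
has a neighbourhood whose torus points still have b as only maximizer, so it is not in the closure
of the hypersurface. -/
theorem closedCell_subset_tropicalCY_iff (hμ : T.IsInducedBy μ) (hτ : τ ∈ T'.faces) (h0 : 0 ∈ τ)
    (hσ : σ ∈ T.faces) (h1 : ∀ u ∈ τ.erase 0, ∀ b ∈ σ, u ⬝ᵥ b = 1) :
    closedCell T' Δ μ τ σ ⊆ tropicalCY T' Δ μ ↔ 2 ≤ σ.card := by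
  constructor
  · intro h
    by_contra hcard
    have hpos := (T.nonempty σ hσ).card_pos
    obtain ⟨b, rfl⟩ := Finset.card_eq_one.1 (show σ.card = 1 by omega)
    obtain ⟨x, hx⟩ := (hμ {b}).1 hσ
    have hb := (hx b).1 (Finset.mem_singleton_self b)
    have hmem := h (orbitPoint_mem_closedCell hQ hτ h0 hσ h1 (x := x) fun y hy => (hx y).1 hy)
    set q := orbitPoint T' hτ h0 x with hq
    have hm : ∀ y : Lat d, toReal y ∈ Δ → b - y ∈ dualSemigroup τ := by
      intro y hy
      refine mem_dualSemigroup_iff.2 fun u hu => ?_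
      by_cases hu0 : u = 0
      · simp [hu0]
      · rw [sub_dotProduct, dotProduct_comm b, h1 u (Finset.mem_erase.2 ⟨hu0, hu⟩) b
          (Finset.mem_singleton_self b), dotProduct_comm y, sub_nonneg]
        exact hQ.lattice_le_one (T'.toReal_mem hτ hu) hy
    have hfin : {y : Lat d | toReal y ∈ Δ ∧ y ≠ b}.Finite :=
      T.finite_latticePoints.subset fun y hy => hy.1
    -- The strict inequalities in favour of b are open conditions on the evaluations at b - y, which
    -- lie in the semigroup of τ; there are finitely many.
    have hopen : IsOpen (⋂ y ∈ {y : Lat d | toReal y ∈ Δ ∧ y ≠ b},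
        {q ∈ chart T' τ | q.eval (b - y) ∈ Set.Ioi (((μ b - μ y : ℤ) : ℝ) : EReal)}) :=
      hfin.isOpen_biInter fun y hy => isOpen_eval_mem hτ h0 (hm y hy.1) isOpen_Ioi
    obtain ⟨_, hq', x', ⟨y₁, y₂, hne, hy₁, hy₂⟩, rfl⟩ := mem_closure_iff.1 hmem _ hopen (by
      refine Set.mem_iInter₂.2 fun y hy => ⟨(subset_rfl : τ ⊆ τ), ?_⟩
      by_cases hyp : b - y ∈ conePerp τ
      · rw [eval_orbitPoint_of_mem hτ h0 x hyp, Set.mem_Ioi, EReal.coe_lt_coe_iff, toReal_sub,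
          dotProduct_sub]
        have h2 := hb.2 y hy.1
        have h3 : x ⬝ᵥ toReal y - μ y ≠ x ⬝ᵥ toReal b - μ b := by
          intro h3
          refine hy.2 (Finset.mem_singleton.1 ((hx y).2 ⟨hy.1, fun w hw => ?_⟩))
          rw [h3]
          exact hb.2 w hw
        have h4 := lt_of_le_of_ne h2 h3
        push_cast
        linarith
      · rw [eval_of_notMem (show b - y ∉ conePerp (orbitPoint T' hτ h0 x).simplex from hyp)]
        exact EReal.coe_lt_top _)
    have key : ∀ y : Lat d, toReal y ∈ Δ → y ≠ b →
        x' ⬝ᵥ toReal y - μ y < x' ⬝ᵥ toReal b - μ b := by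
      intro y hy hyb
      have h2 := (Set.mem_iInter₂.1 hq' y ⟨hy, hyb⟩).2
      rw [eval_torusPoint, Set.mem_Ioi, EReal.coe_lt_coe_iff, toReal_sub, dotProduct_sub] at h2
      push_cast at h2
      linarith
    have hmax : ∀ y, IsMaximizer Δ μ x' y → y = b := by
      intro y hy
      by_contra hyb
      exact absurd (hy.2 b hb.1) (key y hy.1 hyb).not_ge
    exact hne ((hmax y₁ hy₁).trans (hmax y₂ hy₂).symm)
  · intro h
    obtain ⟨y₁, hy₁, y₂, hy₂, hne⟩ := Finset.one_lt_card.1 h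
    refine Set.inter_subset_left.trans (closure_mono (Set.image_mono fun x hx => ?_))
    exact ⟨y₁, y₂, hne, hx y₁ hy₁, hx y₂ hy₂⟩

end ClosedCells

/-! ### The lattices generated by the cones -/

section ConeSpan

variable {d : ℕ} {Q : Set (Fin d → ℝ)} {T' : Triangulation Q} {τ : Finset (Lat d)}

theorem toReal_zsmul (n : ℤ) (v : Lat d) : toReal (n • v) = (n : ℝ) • toReal v := by
  funext i
  simp [toReal]

theorem cone_subset_vectorSpan (h0 : 0 ∈ τ) :
    cone τ ⊆ vectorSpan ℝ (toReal '' (τ : Set (Lat d))) := by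
  rintro _ ⟨c, -, rfl⟩
  refine Submodule.sum_mem _ fun v hv => Submodule.smul_mem _ _ ?_
  have := vsub_mem_vectorSpan ℝ (Set.mem_image_of_mem toReal (Finset.mem_coe.2 hv))
    (Set.mem_image_of_mem toReal (Finset.mem_coe.2 h0))
  simpa using this

theorem mem_coneSpan_of_mem {v : Lat d} (hv : v ∈ τ) : v ∈ coneSpan τ := by
  classical
  refine Submodule.subset_span ⟨fun w => if w = v then 1 else 0, fun w _ => by positivity, ?_⟩
  simp [ite_smul, hv]

theorem vectorSpan_le_span (h : (0 : Lat d) ∈ τ) :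
    vectorSpan ℤ (τ : Set (Lat d)) ≤ Submodule.span ℤ (τ : Set (Lat d)) := by
  refine Submodule.span_le.2 ?_
  rintro _ ⟨a, ha, b, hb, rfl⟩
  exact Submodule.sub_mem _ (Submodule.subset_span ha) (Submodule.subset_span hb)

theorem mem_span_of_toReal_mem (hτ : τ ∈ T'.faces) (h0 : 0 ∈ τ) {x : Lat d}
    (hx : toReal x ∈ vectorSpan ℝ (toReal '' (τ : Set (Lat d)))) :
    x ∈ Submodule.span ℤ (τ : Set (Lat d)) :=
  vectorSpan_le_span h0 (T'.unimodular τ hτ x hx)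

/-- This is unimodularity of the triangulation at a simplex containing 0. -/
theorem coneSpan_eq_span (hτ : τ ∈ T'.faces) (h0 : 0 ∈ τ) :
    coneSpan τ = Submodule.span ℤ (τ : Set (Lat d)) := by
  refine le_antisymm (Submodule.span_le.2 fun x hx => ?_) (Submodule.span_le.2 fun x hx => ?_)
  · exact mem_span_of_toReal_mem hτ h0 (cone_subset_vectorSpan h0 hx)
  · exact mem_coneSpan_of_mem hx

theorem toReal_mem_vectorSpan (h0 : 0 ∈ τ) {x : Lat d} (hx : x ∈ coneSpan τ) :
    toReal x ∈ vectorSpan ℝ (toReal '' (τ : Set (Lat d))) := by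
  induction hx using Submodule.span_induction with
  | mem x hx => exact cone_subset_vectorSpan h0 hx
  | zero =>
    rw [toReal_zero]
    exact Submodule.zero_mem _
  | add x y _ _ hx hy =>
    rw [toReal_add]
    exact Submodule.add_mem _ hx hy
  | smul n x _ hx =>
    rw [toReal_zsmul]
    exact Submodule.smul_mem _ _ hx

theorem mem_coneSpan_of_zsmul_mem (hτ : τ ∈ T'.faces) (h0 : 0 ∈ τ) {n : ℤ} (hn : n ≠ 0) {x : Lat d}
    (hx : n • x ∈ coneSpan τ) : x ∈ coneSpan τ := by
  rw [coneSpan_eq_span hτ h0]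
  refine mem_span_of_toReal_mem hτ h0 ?_
  have h1 := toReal_mem_vectorSpan h0 hx
  rw [toReal_zsmul] at h1
  exact (Submodule.smul_mem_iff _ (by exact_mod_cast hn)).1 h1

/-- The sublattice consists of all lattice vectors in its real span, so the quotient is
torsion-free. Freeness provides the section and the integral basis used for `theta`. -/
theorem free_quotient_coneSpan (hτ : τ ∈ T'.faces) (h0 : 0 ∈ τ) :
    Module.Free ℤ (Lat d ⧸ coneSpan τ) := by
  have : Module.IsTorsionFree ℤ (Lat d ⧸ coneSpan τ) := by
    refine Module.IsTorsionFree.of_smul_eq_zero fun n x h => ?_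
    by_contra! hcon
    obtain ⟨x, rfl⟩ := Submodule.mkQ_surjective _ x
    refine hcon.2 ?_
    rw [Submodule.mkQ_apply, Submodule.Quotient.mk_eq_zero]
    refine mem_coneSpan_of_zsmul_mem hτ h0 hcon.1 ?_
    rwa [← map_smul, Submodule.mkQ_apply, Submodule.Quotient.mk_eq_zero] at h
  exact Module.free_of_finite_type_torsion_free'

end ConeSpan

/-! ### Products of lattice vectors -/

section ConeWedge

variable {d : ℕ} {α : Finset (Lat d)}

/-- The product with `lift 0` and the vectors in `α`. -/
def coneWedge (α : Finset (Lat d)) : Module.End ℚ (Fock d) := wedgeProd lift α * wedge (lift 0)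

theorem coneWedge_apply (a : Fock d) : coneWedge α a = wedgeProd lift α (wedge (lift 0) a) := rfl

theorem coneWedge_wedge (x : Extended d) (a : Fock d) :
    coneWedge α (wedge x a) = (-1 : ℤ) ^ (α.card + 1) • wedge x (coneWedge α a) := by
  rw [coneWedge_apply, coneWedge_apply, wedge_wedge, map_neg, wedge_wedgeProd, smul_smul, pow_succ]
  rw [mul_assoc, mul_comm (-1), ← mul_assoc, ← mul_pow]
  simp

theorem wedge_coneWedge_of_mem {u : Lat d} (hu : u ∈ insert 0 α) (a : Fock d) :
    wedge (lift u) (coneWedge α a) = 0 := by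
  rcases Finset.mem_insert.1 hu with rfl | hu
  · rw [coneWedge_apply, wedge_wedgeProd, wedge_self, map_zero, smul_zero]
  · exact wedge_wedgeProd_of_mem hu _

/-- Thus `coneWedge` depends only on vectors modulo the span of the cone, which lets exterior powers
of the quotient map to `Fock`. -/
theorem coneWedge_wedge_of_mem_span {x : Extended d}
    (hx : x ∈ Submodule.span ℚ (lift '' (insert 0 α : Finset (Lat d)))) (a : Fock d) :
    coneWedge α (wedge x a) = 0 := by
  induction hx using Submodule.span_induction with
  | mem x hx =>
    obtain ⟨u, hu, rfl⟩ := hx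
    rw [coneWedge_wedge, wedge_coneWedge_of_mem hu, smul_zero]
  | zero => simp
  | add x y _ _ hx hy => rw [map_add, LinearMap.add_apply, map_add, hx, hy, add_zero]
  | smul c x _ hx => rw [map_smul, LinearMap.smul_apply, map_smul, hx, smul_zero]

theorem coneWedge_insert {u : Lat d} (hu : u ∉ α) (a : Fock d) :
    coneWedge (insert u α) a = ((insertSign u α : ℤˣ) : ℤ) • wedge (lift u) (coneWedge α a) := by
  rw [coneWedge_apply, wedgeProd_insert hu]
  rfl

theorem coneWedge_mem_degreePart {k l : ℤ} {a : Fock d} (h : a ∈ degreePart d k)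
    (hl : l = k + 1 + α.card) : coneWedge α a ∈ degreePart d l :=
  wedgeProd_mem_degreePart (wedge_mem_degreePart _ h rfl) hl

theorem wedgeProd_insert_zero (h0 : 0 ∉ α) (a : Fock d) :
    ∃ ε : ℤˣ, wedgeProd lift (insert 0 α) a = ε • coneWedge α a := by
  refine ⟨insertSign 0 α * (-1) ^ α.card, ?_⟩
  rw [wedgeProd_insert h0, wedge_wedgeProd, smul_smul, ← coneWedge_apply, Units.smul_def]
  push_cast
  rfl

/-- With a dual system, the kernel of multiplication by the product of the f v is the ideal they
generate, on which Φ vanishes. -/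
theorem map_eq_zero_of_wedgeProd_eq_zero {V : Type*} [Encodable V] [DecidableEq V]
    {m f : V → Extended d} {σ : Finset V} (h : IsDualOn m f σ) {W : Type*} [AddCommGroup W]
    [Module ℚ W] (Φ : Fock d →ₗ[ℚ] W) (hΦ : ∀ v ∈ σ, ∀ a, Φ (wedge (f v) a) = 0) {a : Fock d}
    (ha : wedgeProd f σ a = 0) : Φ a = 0 := by
  induction σ using Finset.induction_on generalizing a with
  | empty =>
    have : a = 0 := by simpa using ha
    rw [this, map_zero]
  | insert v s hv ih =>
    have hself := Finset.mem_insert_self v s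
    rw [wedgeProd_insert hv, ← Units.smul_def, smul_eq_zero_iff_eq, wedge_wedgeProd] at ha
    have h1 : wedgeProd f s (wedge (f v) a) = 0 := by
      rcases neg_one_pow_eq_or ℤ s.card with h6 | h6 <;> rw [h6] at ha <;> simpa using ha
    have h2 := contract_wedgeProd (f := f) (σ := s) (x := m v) (by
      intro u hu
      rw [h v hself u (Finset.mem_insert_of_mem hu), if_neg]
      rintro rfl
      exact hv hu) (wedge (f v) a)
    rw [h1, map_zero, eq_comm] at h2
    have h3 : wedgeProd f s (contract (m v) (wedge (f v) a)) = 0 := by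
      rcases neg_one_pow_eq_or ℤ s.card with h6 | h6 <;> rw [h6] at h2 <;> simpa using h2
    have h4 := ih (h.mono (Finset.subset_insert _ _))
      (fun u hu => hΦ u (Finset.mem_insert_of_mem hu)) h3
    rwa [contract_wedge, h v hself v hself, if_pos rfl, one_smul, map_sub, hΦ v hself,
      sub_zero] at h4

/-- The product of a family of vectors. -/
def multiVec {p : ℕ} (v : Fin p → Extended d) : Fock d := ExteriorAlgebra.ιMulti ℚ p v

theorem multiVec_eq_prod {p : ℕ} (v : Fin p → Extended d) :
    multiVec v = (List.ofFn fun i => vec d (v i)).prod := ExteriorAlgebra.ιMulti_apply v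

theorem multiVec_succ {p : ℕ} (v : Fin (p + 1) → Extended d) :
    multiVec v = wedge (v 0) (multiVec (Matrix.vecTail v)) := ExteriorAlgebra.ιMulti_succ_apply v

theorem multiVec_zero (v : Fin 0 → Extended d) : multiVec v = 1 :=
  ExteriorAlgebra.ιMulti_zero_apply v

theorem multiVec_mem_degreePart {p : ℕ} (v : Fin p → Extended d) :
    multiVec v ∈ degreePart d p :=
  powerPart_le_degreePart p (ExteriorAlgebra.ιMulti_range ℚ p ⟨v, rfl⟩)

theorem contract_multiVec {p : ℕ} {v : Fin p → Extended d} {x : Extended d}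
    (h : ∀ i, extendedForm d x (v i) = 0) : contract x (multiVec v) = 0 := by
  induction p with
  | zero => rw [multiVec_zero, contract_one]
  | succ p ih =>
    rw [multiVec_succ, contract_wedge, h, zero_smul, ih (v := Matrix.vecTail v) fun i => h i.succ, map_zero, sub_zero]

theorem coneWedge_multiVec_congr {p : ℕ} {v w : Fin p → Extended d}
    (h : ∀ i, v i - w i ∈ Submodule.span ℚ (lift '' (insert 0 α : Finset (Lat d)))) :
    coneWedge α (multiVec v) = coneWedge α (multiVec w) := by
  induction p with
  | zero => rw [multiVec_zero, multiVec_zero]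
  | succ p ih =>
    have h1 := coneWedge_wedge_of_mem_span (h 0) (multiVec (Matrix.vecTail v))
    rw [map_sub, LinearMap.sub_apply, map_sub, sub_eq_zero] at h1
    rw [multiVec_succ, multiVec_succ, h1, coneWedge_wedge, coneWedge_wedge,
      ih (v := Matrix.vecTail v) (w := Matrix.vecTail w) fun i => h i.succ]

/-- The inclusion of the lattice vectors at height zero. -/
def flat (d : ℕ) : Lat d →ₗ[ℤ] Extended d where
  toFun v := (fun i => (v i : ℚ), 0)
  map_add' u v := by
    ext <;> simp
  map_smul' n v := by
    ext <;> simp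

theorem flat_apply (v : Lat d) : flat d v = (fun i => (v i : ℚ), 0) := rfl

theorem flat_eq (v : Lat d) : flat d v = lift v - lift 0 := by
  ext <;> simp [flat_apply, lift]

theorem extendedForm_flat (u v : Lat d) :
    extendedForm d (lift u) (flat d v) = ((u ⬝ᵥ v : ℤ) : ℚ) := by
  simp [extendedForm_apply, lift, flat_apply, dotProduct]

theorem flat_mem_span {Q : Set (Fin d → ℝ)} {T' : Triangulation Q} (hα : insert 0 α ∈ T'.faces)
    {x : Lat d} (hx : x ∈ coneSpan (insert 0 α)) :
    flat d x ∈ Submodule.span ℚ (lift '' (insert 0 α : Finset (Lat d))) := by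
  rw [coneSpan_eq_span hα (Finset.mem_insert_self _ _)] at hx
  induction hx using Submodule.span_induction with
  | mem x hx =>
    rw [flat_eq]
    exact Submodule.sub_mem _ (Submodule.subset_span ⟨x, hx, rfl⟩)
      (Submodule.subset_span ⟨0, Finset.mem_insert_self _ _, rfl⟩)
  | zero =>
    rw [map_zero]
    exact Submodule.zero_mem _
  | add x y _ _ hx hy =>
    rw [map_add]
    exact Submodule.add_mem _ hx hy
  | smul n x _ hx =>
    rw [map_smul]
    exact zsmul_mem hx _

/-- The map on exterior algebras induced by an additive map. -/
def fockLift {E : Type} [AddCommGroup E] (g : E →ₗ[ℤ] Extended d) :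
    ExteriorAlgebra ℤ E →ₐ[ℤ] Fock d :=
  ExteriorAlgebra.lift ℤ ⟨(vec d).toAddMonoidHom.toIntLinearMap ∘ₗ g,
    fun _ => ExteriorAlgebra.ι_sq_zero _⟩

theorem fockLift_ιMulti {E : Type} [AddCommGroup E] (g : E →ₗ[ℤ] Extended d) {p : ℕ}
    (v : Fin p → E) : fockLift g (ExteriorAlgebra.ιMulti ℤ p v) = multiVec (g ∘ v) := by
  rw [ExteriorAlgebra.ιMulti_apply, map_list_prod, multiVec_eq_prod, List.map_ofFn]
  congr 2
  funext i
  exact ExteriorAlgebra.lift_ι_apply ℤ _ _ _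

end ConeWedge

/-! ### The multitangent spaces inside the Fock space -/

section Theta

variable {d : ℕ} {Q : Set (Fin d → ℝ)} {T' : Triangulation Q} {α σ : Finset (Lat d)} {p : ℕ}

open scoped Classical in
/-- A linear section of the projection to a quotient (zero if there is none). -/
def quotientSection (C : Submodule ℤ (Lat d)) : (Lat d ⧸ C) →ₗ[ℤ] Lat d :=
  if h : ∃ s : (Lat d ⧸ C) →ₗ[ℤ] Lat d, C.mkQ ∘ₗ s = LinearMap.id then h.choose else 0

theorem mkQ_quotientSection (hα : insert 0 α ∈ T'.faces) (e : Lat d ⧸ coneSpan (insert 0 α)) :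
    (coneSpan (insert 0 α)).mkQ (quotientSection (coneSpan (insert 0 α)) e) = e := by
  have hfree := free_quotient_coneSpan hα (Finset.mem_insert_self _ _)
  have h : ∃ s : (Lat d ⧸ coneSpan (insert 0 α)) →ₗ[ℤ] Lat d,
      (coneSpan (insert 0 α)).mkQ ∘ₗ s = LinearMap.id :=
    Module.projective_lifting_property _ _ (Submodule.mkQ_surjective _)
  rw [quotientSection, dif_pos h]
  exact LinearMap.congr_fun h.choose_spec e

/-- The embedding of the exterior power of `N / ⟨C(τ)⟩`, `τ = α ∪ {0}`, into the Fock space. -/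
def theta (p : ℕ) (α : Finset (Lat d)) :
    (⋀[ℤ]^p (Lat d ⧸ coneSpan (insert 0 α))) →ₗ[ℤ] Fock d :=
  (coneWedge α).toAddMonoidHom.toIntLinearMap ∘ₗ
    (fockLift (flat d ∘ₗ quotientSection (coneSpan (insert 0 α)))).toLinearMap ∘ₗ
      Submodule.subtype _

theorem theta_ιMulti (e : Fin p → Lat d ⧸ coneSpan (insert 0 α)) :
    theta p α (exteriorPower.ιMulti ℤ p e) =
      coneWedge α (multiVec fun i => flat d (quotientSection _ (e i))) := by
  change coneWedge α (fockLift _ (ExteriorAlgebra.ιMulti ℤ p e)) = _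
  rw [fockLift_ιMulti]
  rfl

/-- The chosen section may be replaced by arbitrary representatives, since two of them differ by
elements of the span of the cone. -/
theorem theta_ιMulti_mkQ (hα : insert 0 α ∈ T'.faces) (v : Fin p → Lat d) :
    theta p α (exteriorPower.ιMulti ℤ p fun i => (coneSpan (insert 0 α)).mkQ (v i)) =
      coneWedge α (multiVec fun i => flat d (v i)) := by
  rw [theta_ιMulti]
  refine coneWedge_multiVec_congr fun i => ?_
  rw [← map_sub]
  refine flat_mem_span hα ?_
  rw [← Submodule.Quotient.mk_eq_zero, ← Submodule.mkQ_apply, map_sub, mkQ_quotientSection hα,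
    sub_self]

theorem linearMap_ext_ιMulti_mkQ {C : Submodule ℤ (Lat d)} {F : Type*} [AddCommGroup F]
    {f g : (⋀[ℤ]^p (Lat d ⧸ C)) →ₗ[ℤ] F}
    (h : ∀ v : Fin p → Lat d, f (exteriorPower.ιMulti ℤ p fun i => C.mkQ (v i)) =
      g (exteriorPower.ιMulti ℤ p fun i => C.mkQ (v i))) : f = g := by
  refine exteriorPower.linearMap_ext (AlternatingMap.ext fun e => ?_)
  choose v hv using fun i => Submodule.mkQ_surjective C (e i)
  have he : e = fun i => C.mkQ (v i) := funext fun i => (hv i).symm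
  rw [he]
  exact h v

/-- On representatives the projection changes nothing; only the ordered product in front acquires
the factor `lift u`. So the cosheaf maps become multiplications. -/
theorem theta_factor {u : Lat d} (hu : u ∉ α) (hα : insert 0 (insert u α) ∈ T'.faces)
    (hC : coneSpan (insert 0 α) ≤ coneSpan (insert 0 (insert u α)))
    (y : ⋀[ℤ]^p (Lat d ⧸ coneSpan (insert 0 α))) :
    theta p (insert u α) (exteriorPower.map p (Submodule.factor hC) y) =
      ((insertSign u α : ℤˣ) : ℤ) • wedge (lift u) (theta p α y) := by
  have hα' : insert 0 α ∈ T'.faces := T'.down_closed _ hα _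
    (Finset.insert_subset_insert _ (Finset.subset_insert _ _)) (Finset.insert_nonempty _ _)
  have key : theta p (insert u α) ∘ₗ exteriorPower.map p (Submodule.factor hC) =
      ((insertSign u α : ℤˣ) : ℤ) • ((wedge (lift u)).toAddMonoidHom.toIntLinearMap ∘ₗ
        theta p α) := by
    refine linearMap_ext_ιMulti_mkQ fun v => ?_
    rw [LinearMap.comp_apply, exteriorPower.map_apply_ιMulti]
    change theta p (insert u α) (exteriorPower.ιMulti ℤ p
      fun i => (coneSpan (insert 0 (insert u α))).mkQ (v i)) =
      ((insertSign u α : ℤˣ) : ℤ) • wedge (lift u) (theta p α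
        (exteriorPower.ιMulti ℤ p fun i => (coneSpan (insert 0 α)).mkQ (v i)))
    rw [theta_ιMulti_mkQ hα, theta_ιMulti_mkQ hα', coneWedge_insert hu]
  exact LinearMap.congr_fun key y

theorem theta_mem_tangentCoeff (y : ⋀[ℤ]^p (Lat d ⧸ coneSpan (insert 0 α))) :
    theta p α y ∈ tangentCoeff p α := by
  have hy : y ∈ Submodule.span ℤ (Set.range (exteriorPower.ιMulti ℤ p
      (M := Lat d ⧸ coneSpan (insert 0 α)))) := by
    rw [exteriorPower.ιMulti_span]
    trivial
  induction hy using Submodule.span_induction with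
  | mem x hx =>
    obtain ⟨e, rfl⟩ := hx
    rw [theta_ιMulti]
    exact ⟨coneWedge_mem_degreePart (multiVec_mem_degreePart _) rfl,
      mem_killedByWedge.2 fun u hu => wedge_coneWedge_of_mem hu _⟩
  | zero =>
    rw [map_zero]
    exact Submodule.zero_mem _
  | add x y _ _ hx hy =>
    rw [map_add]
    exact Submodule.add_mem _ hx hy
  | smul n x _ hx =>
    rw [map_smul]
    exact zsmul_mem hx _

/-! #### Linear independence -/

/-- The linear map from the extended space that is given on the lattice by an additive map. -/
def extendMap {k : ℕ} (ℓ : Lat d →ₗ[ℤ] (Fin k → ℤ)) : Extended d →ₗ[ℚ] (Fin k → ℚ) :=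
  (Matrix.of fun j i => (ℓ (Pi.single i 1) j : ℚ)).mulVecLin ∘ₗ LinearMap.fst ℚ _ _

theorem extendMap_flat {k : ℕ} (ℓ : Lat d →ₗ[ℤ] (Fin k → ℤ)) (v : Lat d) :
    extendMap ℓ (flat d v) = fun j => (ℓ v j : ℚ) := by
  funext j
  have h : ℓ v = ∑ i, v i • ℓ (Pi.single i 1) := by
    conv_lhs => rw [pi_eq_sum_univ' v, map_sum]
    refine Finset.sum_congr rfl fun i _ => ?_
    rw [map_smul]
  rw [h]
  simp [extendMap, flat_apply, Matrix.mulVec, dotProduct, mul_comm]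

theorem extendMap_lift {k : ℕ} (ℓ : Lat d →ₗ[ℤ] (Fin k → ℤ)) (v : Lat d) :
    extendMap ℓ (lift v) = fun j => (ℓ v j : ℚ) := by
  rw [← extendMap_flat]
  rfl

/-- A relation is one among the products of lifted basis vectors, after multiplication by
`coneWedge`. Applying the algebra map to ⋀ ℚ^k given by the coordinates on N/⟨C(τ)⟩, which kills the
vectors of the cone, yields a relation among standard basis elements. -/
theorem linearIndependent_theta (hα : insert 0 α ∈ T'.faces) (h0 : 0 ∉ α) {k : ℕ}
    (b : Module.Basis (Fin k) ℤ (Lat d ⧸ coneSpan (insert 0 α))) :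
    LinearIndependent ℚ fun I => theta p α (b.exteriorPower p I) := by
  obtain ⟨m, hm⟩ := exists_isDualOn_of_mem_faces T' hα
  let ℓ : Lat d →ₗ[ℤ] (Fin k → ℤ) := b.equivFun.toLinearMap ∘ₗ (coneSpan (insert 0 α)).mkQ
  let Φ : Fock d →ₐ[ℚ] ExteriorAlgebra ℚ (Fin k → ℚ) := ExteriorAlgebra.map (extendMap ℓ)
  have hΦw : ∀ x a, Φ (wedge x a) = ExteriorAlgebra.ι ℚ (extendMap ℓ x) * Φ a := by
    intro x a
    rw [wedge_apply, map_mul]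
    congr 1
    exact ExteriorAlgebra.map_apply_ι _ _
  have hΦ : ∀ u ∈ insert 0 α, ∀ a, Φ (wedge (lift u) a) = 0 := by
    intro u hu a
    have h1 : ℓ u = 0 := by
      change b.equivFun ((coneSpan (insert 0 α)).mkQ u) = 0
      rw [Submodule.mkQ_apply, (Submodule.Quotient.mk_eq_zero _).2 (mem_coneSpan_of_mem hu),
        map_zero]
    rw [hΦw, extendMap_lift, h1]
    have h2 : (fun j : Fin k => (((0 : Fin k → ℤ) j : ℤ) : ℚ)) = 0 := by
      funext j
      simp
    rw [h2, map_zero, zero_mul]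
  have hli := ((Pi.basisFun ℚ (Fin k)).exteriorPower p).linearIndependent
  have hli' := hli.map' (Submodule.subtype _) (Submodule.ker_subtype _)
  rw [linearIndependent_iff'] at hli' ⊢
  intro s g hg I hI
  refine hli' s g ?_ I hI
  let a : Set.powersetCard (Fin k) p → Fock d := fun I => multiVec fun i =>
    flat d (quotientSection (coneSpan (insert 0 α)) (b (Set.powersetCard.ofFinEmbEquiv.symm I i)))
  have h1 : ∀ I, theta p α (b.exteriorPower p I) = coneWedge α (a I) := by
    intro I
    rw [exteriorPower.basis_apply]
    exact theta_ιMulti _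
  have h2 : coneWedge α (∑ I ∈ s, g I • a I) = 0 := by
    rw [← hg, map_sum]
    refine Finset.sum_congr rfl fun I _ => ?_
    rw [map_smul, h1]
  obtain ⟨ε, hε⟩ := wedgeProd_insert_zero h0 (∑ I ∈ s, g I • a I)
  rw [h2, smul_zero] at hε
  have h3 := map_eq_zero_of_wedgeProd_eq_zero hm Φ.toLinearMap hΦ hε
  rw [AlgHom.toLinearMap_apply, map_sum] at h3
  rw [← h3]
  refine Finset.sum_congr rfl fun I _ => ?_
  rw [map_smul]
  congr 1
  rw [Function.comp_apply, exteriorPower.basis_apply]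
  change ExteriorAlgebra.ιMulti ℚ p _ = ExteriorAlgebra.map (extendMap ℓ) (ExteriorAlgebra.ιMulti ℚ p _)
  rw [ExteriorAlgebra.map_apply_ιMulti]
  congr 1
  funext i
  rw [Function.comp_apply, Function.comp_apply, extendMap_flat]
  funext j
  change _ = ((b.equivFun ((coneSpan (insert 0 α)).mkQ (quotientSection (coneSpan (insert 0 α)) _)) j : ℤ) : ℚ)
  rw [mkQ_quotientSection hα, Module.Basis.equivFun_self, Pi.basisFun_apply]
  simp [Pi.single_apply, eq_comm]

/-- The inclusion of the multitangent space. -/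
def multitangentIncl (p : ℕ) (C : Submodule ℤ (Lat d)) (E : Set (Submodule ℤ (Lat d))) :
    MultitangentModule p C E →ₗ[ℤ] ⋀[ℤ]^p (Lat d ⧸ C) :=
  Submodule.subtype (multitangent p C E)

theorem multitangentIncl_injective (C : Submodule ℤ (Lat d)) (E : Set (Submodule ℤ (Lat d))) :
    Function.Injective (multitangentIncl p C E) := Subtype.val_injective

theorem multitangentIncl_mem (C : Submodule ℤ (Lat d)) (E : Set (Submodule ℤ (Lat d)))
    (y : MultitangentModule p C E) : multitangentIncl p C E y ∈ multitangent p C E := Subtype.prop y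

/-- The embedding of the rational multitangent space into the Fock space. -/
def thetaRat (p : ℕ) (α : Finset (Lat d)) (E : Set (Submodule ℤ (Lat d))) :
    (ℚ ⊗[ℤ] MultitangentModule p (coneSpan (insert 0 α)) E) →ₗ[ℚ] Fock d :=
  LinearMap.liftBaseChange ℚ (theta p α ∘ₗ multitangentIncl p _ E)

theorem thetaRat_tmul (E : Set (Submodule ℤ (Lat d))) (c : ℚ)
    (y : MultitangentModule p (coneSpan (insert 0 α)) E) :
    thetaRat p α E (c ⊗ₜ y) = c • theta p α (multitangentIncl p _ E y) :=
  LinearMap.liftBaseChange_tmul _ _ _ _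

/-- On the full exterior power this is independence of the images of an integral basis; flatness of
ℚ passes to the multitangent subgroup. -/
theorem thetaRat_injective (hα : insert 0 α ∈ T'.faces) (h0 : 0 ∉ α)
    (E : Set (Submodule ℤ (Lat d))) : Function.Injective (thetaRat p α E) := by
  have hfree := free_quotient_coneSpan hα (Finset.mem_insert_self _ _)
  let b := Module.finBasis ℤ (Lat d ⧸ coneSpan (insert 0 α))
  let B := (b.exteriorPower p).baseChange ℚ
  have h1 : Function.Injective (LinearMap.liftBaseChange ℚ (theta p α)) := by
    have h2 := linearIndependent_theta (p := p) hα h0 b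
    have h3 : ∀ x, LinearMap.liftBaseChange ℚ (theta p α) x =
        Finsupp.linearCombination ℚ (fun I => theta p α (b.exteriorPower p I)) (B.repr x) := by
      intro x
      conv_lhs => rw [← B.linearCombination_repr x, Finsupp.apply_linearCombination]
      congr 2
      funext I
      simp [B]
    intro x y hxy
    rw [h3, h3] at hxy
    exact B.repr.injective (h2 hxy)
  have h4 : thetaRat p α E = LinearMap.liftBaseChange ℚ (theta p α) ∘ₗ
      LinearMap.baseChange ℚ (multitangentIncl p _ E) := by
    refine TensorProduct.AlgebraTensorModule.ext fun c y => ?_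
    rw [LinearMap.comp_apply, LinearMap.baseChange_tmul, LinearMap.liftBaseChange_tmul]
    exact thetaRat_tmul E c y
  rw [h4, LinearMap.coe_comp]
  refine h1.comp ?_
  exact Module.Flat.lTensor_preserves_injective_linearMap _ (multitangentIncl_injective _ _)

end Theta

/-! ### The image of the multitangent spaces -/

section Range

variable {d : ℕ} {Q : Set (Fin d → ℝ)} {T' : Triangulation Q} {α σ : Finset (Lat d)} {p : ℕ}

theorem contract_coneWedge {x : Extended d}
    (h : ∀ u ∈ insert 0 α, extendedForm d x (lift u) = 0) (a : Fock d) :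
    contract x (coneWedge α a) = (-1 : ℤ) ^ (α.card + 1) • coneWedge α (contract x a) := by
  rw [coneWedge_apply, contract_wedgeProd fun u hu => h u (Finset.mem_insert_of_mem hu),
    contract_wedge, h 0 (Finset.mem_insert_self _ _), zero_smul, zero_sub, map_neg, pow_succ,
    mul_neg_one, neg_smul, smul_neg]
  rfl

/-- On z the contractions with a and b agree, so the product contains the contraction with b twice.
-/
theorem contractProd_eq_zero_of_edge {a b : Lat d} (ha : a ∈ σ) (hb : b ∈ σ) (hab : a ≠ b)
    {z : Fock d} (hz : contract (lift a - lift b) z = 0) : contractProd lift σ z = 0 := by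
  obtain ⟨s, hs, rfl⟩ : ∃ s, a ∉ s ∧ insert a s = σ :=
    ⟨σ.erase a, Finset.notMem_erase _ _, Finset.insert_erase ha⟩
  have hbs : b ∈ s := Finset.mem_of_mem_insert_of_ne hb hab.symm
  rw [map_sub, LinearMap.sub_apply, sub_eq_zero] at hz
  rw [contractProd_insert hs, contract_contractProd, hz, ← contract_contractProd,
    contract_contractProd_of_mem hbs, smul_zero]

theorem extendedForm_edge {a b u : Lat d} (ha : u ⬝ᵥ a = 1) (hb : u ⬝ᵥ b = 1) :
    extendedForm d (lift a - lift b) (lift u) = 0 := by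
  rw [map_sub, LinearMap.sub_apply, extendedForm_comm, extendedForm_lift_eq_zero ha,
    extendedForm_comm, extendedForm_lift_eq_zero hb, sub_zero]

theorem extendedForm_edge_of_mem (h : ∀ u ∈ α, ∀ b ∈ σ, u ⬝ᵥ b = 1) {a b : Lat d} (ha : a ∈ σ)
    (hb : b ∈ σ) : ∀ u ∈ insert 0 α, extendedForm d (lift a - lift b) (lift u) = 0 := by
  intro u hu
  rcases Finset.mem_insert.1 hu with rfl | hu
  · rw [map_sub, LinearMap.sub_apply, extendedForm_lift_zero, extendedForm_lift_zero, sub_self]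
  · exact extendedForm_edge (h u hu a ha) (h u hu b hb)

theorem extendedForm_edge_flat {a b v : Lat d} :
    extendedForm d (lift a - lift b) (flat d v) = ((v ⬝ᵥ (a - b) : ℤ) : ℚ) := by
  rw [map_sub, LinearMap.sub_apply, extendedForm_flat, extendedForm_flat, dotProduct_sub,
    dotProduct_comm v, dotProduct_comm v]
  push_cast
  rfl

/-- The edge vector of λ is orthogonal to the lifts of τ and to λ^⊥ at height zero, so contraction
with it kills the image of ⋀^p(λ^⊥). -/
theorem contractProd_theta_eq_zero (hα : insert 0 α ∈ T'.faces)
    (h : ∀ u ∈ α, ∀ b ∈ σ, u ⬝ᵥ b = 1) {y : ⋀[ℤ]^p (Lat d ⧸ coneSpan (insert 0 α))}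
    (hy : y ∈ multitangent p (coneSpan (insert 0 α)) (edgePerps σ)) :
    contractProd lift σ (theta p α y) = 0 := by
  suffices hle : multitangent p (coneSpan (insert 0 α)) (edgePerps σ) ≤
      LinearMap.ker ((contractProd lift σ).toAddMonoidHom.toIntLinearMap ∘ₗ theta p α) from hle hy
  refine iSup₂_le ?_
  rintro V ⟨a, ha, b, hb, hab, rfl⟩
  rw [LinearMap.range_le_ker_iff]
  refine exteriorPower.linearMap_ext (AlternatingMap.ext fun e => ?_)
  choose v hv hve using fun i => (e i).2
  have he : (Submodule.subtype _) ∘ e = fun i => (coneSpan (insert 0 α)).mkQ (v i) :=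
    funext fun i => (hve i).symm
  change contractProd lift σ (theta p α (exteriorPower.map p _ (exteriorPower.ιMulti ℤ p e))) = 0
  rw [exteriorPower.map_apply_ιMulti, he, theta_ιMulti_mkQ hα]
  refine contractProd_eq_zero_of_edge ha hb hab ?_
  rw [contract_coneWedge (extendedForm_edge_of_mem h ha hb), contract_multiVec, map_zero, smul_zero]
  intro i
  rw [extendedForm_edge_flat, show v i ⬝ᵥ (a - b) = 0 from hv i, Int.cast_zero]

theorem thetaRat_mem (hα : insert 0 α ∈ T'.faces) (h : ∀ u ∈ α, ∀ b ∈ σ, u ⬝ᵥ b = 1)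
    (x : ℚ ⊗[ℤ] MultitangentModule p (coneSpan (insert 0 α)) (edgePerps σ)) :
    thetaRat p α (edgePerps σ) x ∈ tangentCoeff p α ∧
      contractProd lift σ (thetaRat p α (edgePerps σ) x) = 0 := by
  induction x using TensorProduct.induction_on with
  | zero =>
    rw [map_zero]
    exact ⟨Submodule.zero_mem _, map_zero _⟩
  | tmul c y =>
    rw [thetaRat_tmul, map_smul, contractProd_theta_eq_zero hα h (multitangentIncl_mem _ _ _),
      smul_zero]
    exact ⟨Submodule.smul_mem _ _ (theta_mem_tangentCoeff _), rfl⟩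
  | add x y hx hy =>
    rw [map_add, map_add, hx.2, hy.2, add_zero]
    exact ⟨Submodule.add_mem _ hx.1 hy.1, rfl⟩

/-- The projection to the vectors at height zero and orthogonal to `e`. -/
def edgeProjection (e : Extended d) : Extended d →ₗ[ℚ] Extended d :=
  LinearMap.id - (LinearMap.toSpanSingleton ℚ _ ((extendedForm d e e)⁻¹ • e)) ∘ₗ extendedForm d e -
    (LinearMap.toSpanSingleton ℚ _ (lift 0)) ∘ₗ LinearMap.snd ℚ _ _

theorem edgeProjection_apply (e y : Extended d) : edgeProjection e y =
    y - extendedForm d e y • (extendedForm d e e)⁻¹ • e - y.2 • lift 0 := rfl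

theorem extendedForm_edgeProjection {e : Extended d} (he : extendedForm d e e ≠ 0)
    (he2 : extendedForm d e (lift 0) = 0) (y : Extended d) :
    extendedForm d e (edgeProjection e y) = 0 := by
  rw [edgeProjection_apply, map_sub, map_sub, map_smul, map_smul, map_smul, he2]
  simp [he]

theorem edgeProjection_snd {e : Extended d} (he : e.2 = 0) (y : Extended d) :
    (edgeProjection e y).2 = 0 := by
  simp [edgeProjection_apply, he, lift]

/-- The induced endomorphism of the Fock space. -/
def fockProjection (e : Extended d) : Fock d →ₐ[ℚ] Fock d :=
  ExteriorAlgebra.map (edgeProjection e)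

theorem fockProjection_wedge (e x : Extended d) (a : Fock d) :
    fockProjection e (wedge x a) = wedge (edgeProjection e x) (fockProjection e a) := by
  rw [wedge_apply, map_mul, wedge_apply]
  congr 1
  exact ExteriorAlgebra.map_apply_ι _ _

theorem fockProjection_multiVec (e : Extended d) (v : Fin p → Extended d) :
    fockProjection e (multiVec v) = multiVec (edgeProjection e ∘ v) :=
  ExteriorAlgebra.map_apply_ιMulti _ _

theorem contract_fockProjection {e : Extended d} (he : extendedForm d e e ≠ 0)
    (he2 : extendedForm d e (lift 0) = 0) (a : Fock d) : contract e (fockProjection e a) = 0 := by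
  induction a using fock_induction with
  | h1 r => rw [AlgHom.commutes, contract_algebraMap]
  | hadd a b ha hb => rw [map_add, map_add, ha, hb, add_zero]
  | hw x a ha =>
    rw [fockProjection_wedge, contract_wedge, extendedForm_edgeProjection he he2, zero_smul, ha,
      map_zero, sub_zero]

/-- A vector and its projection differ by multiples of e and `lift 0`, and both are killed by the
product with e and the cone. -/
theorem wedge_coneWedge_fockProjection (e : Extended d) (a : Fock d) :
    wedge e (coneWedge α (fockProjection e a)) = wedge e (coneWedge α a) := by
  induction a using fock_induction with
  | h1 r => rw [AlgHom.commutes]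
  | hadd a b ha hb => simp only [map_add, ha, hb]
  | hw x a ha =>
    rw [fockProjection_wedge, coneWedge_wedge, coneWedge_wedge, map_zsmul, map_zsmul]
    congr 1
    rw [edgeProjection_apply, map_sub, map_sub, LinearMap.sub_apply, LinearMap.sub_apply, map_sub,
      map_sub, map_smul, map_smul, map_smul, LinearMap.smul_apply, LinearMap.smul_apply,
      LinearMap.smul_apply, wedge_coneWedge_of_mem (Finset.mem_insert_self _ _), smul_zero,
      map_zero, sub_zero, map_smul, map_smul, wedge_self, smul_zero, smul_zero, sub_zero,
      wedge_wedge, ha, ← wedge_wedge]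

/-- Contract the previous identity with e: both sides become ⟨e, e⟩ times the element, as their
contractions with e vanish. -/
theorem coneWedge_fockProjection {e : Extended d} (he : extendedForm d e e ≠ 0)
    (heα : ∀ u ∈ insert 0 α, extendedForm d e (lift u) = 0) {a : Fock d}
    (ha : contract e (coneWedge α a) = 0) : coneWedge α (fockProjection e a) = coneWedge α a := by
  have h1 := congrArg (contract e) (wedge_coneWedge_fockProjection (α := α) e a)
  rw [contract_wedge, contract_wedge, ha, contract_coneWedge heα,
    contract_fockProjection he (heα 0 (Finset.mem_insert_self _ _))] at h1
  simp only [map_zero, smul_zero, sub_zero] at h1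
  exact smul_right_injective _ he h1

theorem extendedForm_edge_self_ne_zero {a b : Lat d} (hab : a ≠ b) :
    extendedForm d (lift a - lift b) (lift a - lift b) ≠ 0 := by
  have h1 : lift a - lift b = flat d (a - b) := by
    rw [map_sub, flat_eq, flat_eq, sub_sub_sub_cancel_right]
  rw [show extendedForm d (lift a - lift b) (lift a - lift b) =
    extendedForm d (lift a - lift b) (flat d (a - b)) by rw [← h1], extendedForm_edge_flat]
  intro h
  have h2 : (a - b) ⬝ᵥ (a - b) = 0 := by exact_mod_cast h
  exact hab (sub_eq_zero.1 (dotProduct_self_eq_zero.1 h2))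

theorem exists_flat_eq_smul {y : Extended d} (hy : y.2 = 0) :
    ∃ (N : ℤ) (v : Lat d), N ≠ 0 ∧ flat d v = (N : ℚ) • y := by
  obtain ⟨b, hb⟩ := IsLocalization.exist_integer_multiples_of_finite (nonZeroDivisors ℤ) y.1
  choose v hv using hb
  refine ⟨b, v, nonZeroDivisors.coe_ne_zero b, ?_⟩
  rw [flat_apply]
  refine Prod.ext (funext fun i => ?_) (by simp [hy])
  have := hv i
  simp only [algebraMap_int_eq, eq_intCast, zsmul_eq_mul] at this
  simpa using this

/-- Write x as `coneWedge` of some y up to sign. Since contraction with the edge kills x, y may be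
replaced by its projection, all of whose factors are rational vectors of height zero orthogonal to
the edge. Clearing denominators gives elements of ⋀^p(λ^⊥). -/
theorem mem_range_thetaRat_of_edge (hα : insert 0 α ∈ T'.faces) (h0 : 0 ∉ α)
    (h : ∀ u ∈ α, ∀ b ∈ σ, u ⬝ᵥ b = 1) {a b : Lat d} (ha : a ∈ σ) (hb : b ∈ σ) (hab : a ≠ b)
    {x : Fock d} (hx : x ∈ tangentCoeff p α) (hx0 : contract (lift a - lift b) x = 0) :
    x ∈ LinearMap.range (thetaRat p α (edgePerps σ)) := by
  obtain ⟨m, hm⟩ := exists_isDualOn_of_mem_faces T' hα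
  obtain ⟨y, hy, hdeg⟩ := exists_wedgeProd_eq hm (mem_killedByWedge.1 hx.2)
  have hyp : y ∈ powerPart d p := by
    refine degreePart_le_powerPart p (hdeg _ _ hx.1 ?_)
    rw [Finset.card_insert_of_notMem h0]
    push_cast
    ring
  obtain ⟨ε, hε⟩ := wedgeProd_insert_zero h0 y
  rw [hy] at hε
  have heα := extendedForm_edge_of_mem h ha hb
  have hee := extendedForm_edge_self_ne_zero hab
  obtain ⟨e, he⟩ : ∃ e, e = lift a - lift b := ⟨_, rfl⟩
  rw [← he] at heα hee hx0
  have hy0 : contract e (coneWedge α y) = 0 := by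
    rw [hε, Units.smul_def, map_zsmul, ← Units.smul_def, smul_eq_zero_iff_eq] at hx0
    exact hx0
  rw [hε, Units.smul_def, ← coneWedge_fockProjection hee heα hy0]
  refine zsmul_mem ?_ _
  have hspan : y ∈ Submodule.span ℚ (Set.range (ExteriorAlgebra.ιMulti ℚ p (M := Extended d))) := by
    rw [exteriorPower.ιMulti_span_fixedDegree]
    exact hyp
  clear hε hy hdeg hyp hy0
  induction hspan using Submodule.span_induction with
  | mem y hy =>
    obtain ⟨w, rfl⟩ := hy
    rw [show (ExteriorAlgebra.ιMulti ℚ p w : Fock d) = multiVec w from rfl,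
      fockProjection_multiVec]
    have he2 : e.2 = 0 := by
      rw [he]
      simp [lift]
    choose N v hN hv using fun i => exists_flat_eq_smul (edgeProjection_snd he2 (w i))
    have hvV : ∀ i, v i ∈ edgePerp a b := by
      intro i
      have h1 := extendedForm_edge_flat (a := a) (b := b) (v := v i)
      rw [hv, map_smul, ← he, extendedForm_edgeProjection hee
        (heα 0 (Finset.mem_insert_self _ _)), smul_zero] at h1
      change v i ⬝ᵥ (a - b) = 0
      exact_mod_cast h1.symm
    have h1 : edgeProjection e ∘ w = fun i => (N i : ℚ)⁻¹ • flat d (v i) := by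
      funext i
      rw [hv, smul_smul, inv_mul_cancel₀ (by exact_mod_cast hN i), one_smul]
      rfl
    have h2 : multiVec (edgeProjection e ∘ w) =
        (∏ i, (N i : ℚ)⁻¹) • multiVec fun i => flat d (v i) := by
      rw [h1]
      exact MultilinearMap.map_smul_univ (ExteriorAlgebra.ιMulti ℚ p).toMultilinearMap _ _
    rw [h2, map_smul]
    refine Submodule.smul_mem _ _ ?_
    have hmem : (exteriorPower.ιMulti ℤ p fun i => (coneSpan (insert 0 α)).mkQ (v i)) ∈
        multitangent p (coneSpan (insert 0 α)) (edgePerps σ) := by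
      refine (le_iSup₂_of_le (f := fun V (_ : V ∈ edgePerps σ) => LinearMap.range
        (exteriorPower.map p (V.map (coneSpan (insert 0 α)).mkQ).subtype)) (edgePerp a b)
        ⟨a, ha, b, hb, hab, rfl⟩ le_rfl) ?_
      refine ⟨exteriorPower.ιMulti ℤ p fun i => ⟨_, Submodule.mem_map_of_mem (hvV i)⟩, ?_⟩
      rw [exteriorPower.map_apply_ιMulti]
      rfl
    refine ⟨1 ⊗ₜ (⟨_, hmem⟩ : multitangent p (coneSpan (insert 0 α)) (edgePerps σ)), ?_⟩
    refine (thetaRat_tmul (edgePerps σ) 1 _).trans ?_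
    rw [one_smul]
    exact theta_ιMulti_mkQ hα v
  | zero =>
    rw [map_zero, map_zero]
    exact Submodule.zero_mem _
  | add y z _ _ hy hz =>
    rw [map_add, map_add]
    exact Submodule.add_mem _ hy hz
  | smul c y _ hy =>
    rw [map_smul, map_smul]
    exact Submodule.smul_mem _ _ hy

theorem mem_range_thetaRat_iff {Δ : Set (Fin d → ℝ)} (T : Triangulation Δ)
    (hα : insert 0 α ∈ T'.faces) (h0 : 0 ∉ α) (hσ : σ ∈ T.faces)
    (h : ∀ u ∈ α, ∀ b ∈ σ, u ⬝ᵥ b = 1) {x : Fock d} :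
    x ∈ LinearMap.range (thetaRat p α (edgePerps σ)) ↔
      x ∈ tangentCoeff p α ∧ contractProd lift σ x = 0 := by
  constructor
  · rintro ⟨y, rfl⟩
    exact thetaRat_mem hα h y
  rintro ⟨hx, hx0⟩
  obtain ⟨b₀, hb₀⟩ := T.nonempty σ hσ
  obtain ⟨s, hs, rfl⟩ : ∃ s, b₀ ∉ s ∧ insert b₀ s = σ :=
    ⟨σ.erase b₀, Finset.notMem_erase _ _, Finset.insert_erase hb₀⟩
  obtain ⟨m, hm⟩ := exists_isDualOn_of_mem_faces T hσ
  have hedge : ∀ b ∈ s, ∀ u ∈ insert 0 α, extendedForm d (lift b - lift b₀) (lift u) = 0 :=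
    fun b hb => extendedForm_edge_of_mem h (Finset.mem_insert_of_mem hb) hb₀
  have hm' : IsDualOn m (fun b => lift b - lift b₀) s := by
    intro u hu v hv
    have hub : u ≠ b₀ := fun h => hs (h ▸ hu)
    rw [map_sub, hm u (Finset.mem_insert_of_mem hu) v (Finset.mem_insert_of_mem hv),
      hm u (Finset.mem_insert_of_mem hu) b₀ hb₀, if_neg hub, sub_zero]
  -- This element is killed by multiplication with `lift 0` and by contraction with `lift b₀`, and
  -- these vectors pair to -1.
  have hx1 : contractProd (fun b => lift b - lift b₀) s x = 0 := by
    refine eq_zero_of_wedge_eq_zero (x := lift 0) (y := lift b₀) ?_ ?_ ?_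
    · rw [extendedForm_lift_zero]
      norm_num
    · rw [wedge_contractProd fun b hb => hedge b hb 0 (Finset.mem_insert_self _ _),
        mem_killedByWedge.1 hx.2 0 (Finset.mem_insert_self _ _), map_zero, smul_zero]
    · rw [contractProd_insert hs, ← Units.smul_def, smul_eq_zero_iff_eq] at hx0
      rw [contract_contractProd_sub hs]
      exact hx0
  refine mem_of_contractProd_eq_zero hm' (tangentCoeff p α) _ ?_ ?_ hx hx1
  · intro b hb a ha
    refine ⟨contract_mem_degreePart _ (wedge_mem_degreePart _ ha.1 rfl) (by ring),
      mem_killedByWedge.2 fun u hu => ?_⟩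
    have h1 := contract_wedge (lift b - lift b₀) (lift u) (wedge (m b) a)
    rw [hedge b hb u hu, zero_smul, zero_sub, wedge_wedge, mem_killedByWedge.1 ha.2 u hu, map_zero,
      neg_zero, map_zero, eq_comm, neg_eq_zero] at h1
    exact h1
  · intro b hb a ha hab
    exact mem_range_thetaRat_of_edge hα h0 h (Finset.mem_insert_of_mem hb) hb₀
      (fun h => hs (h ▸ hb)) ha hab

end Range

/-! ### Signatures -/

section Signatures

variable {V : Type} [Encodable V] [DecidableEq V]

/-- The product of a function of a finite set and an element over the initial segments. -/
def prefixProd (R : Finset V → V → ℤˣ) (φ : Finset V) : ℤˣ :=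
  ∏ e ∈ φ, R (φ.filter fun x => Encodable.encode x ≤ Encodable.encode e) e

theorem prefixProd_empty (R : Finset V → V → ℤˣ) : prefixProd R ∅ = 1 := Finset.prod_empty

theorem prefixProd_insert (R : Finset V → V → ℤˣ) {m : V} {φ : Finset V} (hm : m ∉ φ)
    (hmax : ∀ x ∈ φ, Encodable.encode x ≤ Encodable.encode m) :
    prefixProd R (insert m φ) = R (insert m φ) m * prefixProd R φ := by
  rw [prefixProd, Finset.prod_insert hm, Finset.filter_true_of_mem]
  · congr 1
    refine Finset.prod_congr rfl fun e he => ?_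
    rw [Finset.filter_insert, if_neg]
    intro h
    exact hm (Encodable.encode_injective (le_antisymm h (hmax e he)) ▸ he)
  · intro x hx
    rcases Finset.mem_insert.1 hx with rfl | hx
    · exact le_rfl
    · exact hmax x hx

theorem units_cocycle_aux {a b c e : ℤˣ} (h : a * b = c * e) : c = a * b * e := by
  rw [h, mul_assoc, Int.units_mul_self, mul_one]

/-- A multiplicative cocycle on the Boolean lattice of a finite set is a coboundary. -/
theorem eq_prefixProd_mul_prefixProd {R : Finset V → V → ℤˣ} {φ : Finset V}
    (hR : ∀ ψ ⊆ φ, ∀ e ∈ ψ, ∀ e' ∈ ψ, e ≠ e' →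
      R ψ e * R (ψ.erase e) e' = R ψ e' * R (ψ.erase e') e) :
    ∀ e ∈ φ, R φ e = prefixProd R φ * prefixProd R (φ.erase e) := by
  induction φ using Finset.induction_on_max_value (fun v : V => Encodable.encode v) with
  | empty => simp
  | insert m φ hm hmax ih =>
    intro e he
    rw [prefixProd_insert R hm hmax]
    by_cases hem : e = m
    · rw [hem, Finset.erase_insert hm, mul_assoc, Int.units_mul_self, mul_one]
    have heφ : e ∈ φ := Finset.mem_of_mem_insert_of_ne he hem
    have h1 := ih (fun ψ hψ => hR ψ (hψ.trans (Finset.subset_insert _ _))) e heφ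
    have h2 := hR _ subset_rfl m (Finset.mem_insert_self _ _) e he (Ne.symm hem)
    have h3 : (insert m φ).erase e = insert m (φ.erase e) :=
      Finset.erase_insert_of_ne (Ne.symm hem)
    rw [Finset.erase_insert hm, h3] at h2
    rw [h3, prefixProd_insert R (fun h => hm (Finset.mem_of_mem_erase h))
      fun x hx => hmax x (Finset.mem_of_mem_erase hx), units_cocycle_aux h2, h1]
    ac_rfl

end Signatures

/-! ### Cocycles of signs on the poset of cells are coboundaries. -/

section PairSignatures

variable {d : ℕ} {K' K : Set (Finset (Lat d))}

/-- The signs of the cellular complex. -/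
def standardSign : Pairs d → Lat d ⊕ Lat d → ℤˣ
  | t, Sum.inl u => -((-1) ^ t.toRight.card * insertSign u (t.toLeft.erase u))
  | t, Sum.inr b => -insertSign b (t.toRight.erase b)

theorem insertSign_erase_anticomm {V : Type} [Encodable V] [DecidableEq V] {σ : Finset V} {b b' : V}
    (hb : b ∈ σ) (hb' : b' ∈ σ) (hne : b ≠ b') :
    insertSign b (σ.erase b) * insertSign b' ((σ.erase b).erase b') =
      -(insertSign b' (σ.erase b') * insertSign b ((σ.erase b').erase b)) := by
  obtain ⟨s, h4, h5, hs⟩ : ∃ s, b ∉ s ∧ b' ∉ s ∧ σ = insert b (insert b' s) := by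
    refine ⟨(σ.erase b).erase b', by simp, by simp, ?_⟩
    rw [Finset.insert_erase (Finset.mem_erase.2 ⟨hne.symm, hb'⟩), Finset.insert_erase hb]
  have h1 : σ.erase b = insert b' s := by
    rw [hs, Finset.erase_insert (by simp [hne, h4])]
  have h2 : σ.erase b' = insert b s := by
    rw [hs, Finset.insert_comm, Finset.erase_insert (by simp [hne.symm, h5])]
  rw [h1, h2, Finset.erase_insert h4, Finset.erase_insert h5, mul_comm,
    insertSign_mul_insertSign hne.symm h5 h4, mul_comm]

/-- Thus the standard signs satisfy the same relation on intervals of length two as a balanced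
signature, and their product with one is a cocycle. -/
theorem standardSign_anticomm (t : Pairs d) {e e' : Lat d ⊕ Lat d} (he : e ∈ t) (he' : e' ∈ t)
    (hne : e ≠ e') : standardSign t e * standardSign (t.erase e) e' =
      -(standardSign t e' * standardSign (t.erase e') e) := by
  have hsign : ∀ b, b ∈ t.toRight →
      ((-1 : ℤˣ) ^ (t.toRight.erase b).card) = -(-1 : ℤˣ) ^ t.toRight.card := by
    intro b hb
    rw [← Finset.card_erase_add_one hb, pow_succ, mul_neg_one, neg_neg]
  rcases e with u | b <;> rcases e' with u' | b' <;> simp only [standardSign, toLeft_erase_inl,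
    toLeft_erase_inr, toRight_erase_inl, toRight_erase_inr]
  · have h := insertSign_erase_anticomm (σ := t.toLeft) (by simpa using he) (by simpa using he')
      (fun h => hne (congrArg Sum.inl h))
    rw [neg_mul_neg, neg_mul_neg, mul_mul_mul_comm, h, mul_neg, mul_mul_mul_comm]
  · rw [hsign b' (by simpa using he'), neg_mul_neg, neg_mul_neg, mul_comm]
    simp
  · rw [hsign b (by simpa using he), neg_mul_neg, neg_mul_neg, mul_comm]
    simp
  · rw [neg_mul_neg, neg_mul_neg]
    exact insertSign_erase_anticomm (by simpa using he) (by simpa using he')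
      (fun h => hne (congrArg Sum.inr h))

/-- The cocycle condition for a function on the cover relations of the poset of cells. -/
def IsPairCocycle (K' K : Set (Finset (Lat d))) (R : Pairs d → Lat d ⊕ Lat d → ℤˣ) : Prop :=
  ∀ t ∈ cellPairs K' K, ∀ e ∈ t, ∀ e' ∈ t, e ≠ e' → (t.erase e).erase e' ∈ cellPairs K' K →
    R t e * R (t.erase e) e' = R t e' * R (t.erase e') e

theorem disjSum_mem_cellPairs_mono (hK : IsMirrorPair K' K) {α α' σ σ' : Finset (Lat d)}
    (h : α.disjSum σ ∈ cellPairs K' K) (hα : α' ⊆ α) (hσ : σ' ⊆ σ) (hne : σ' ≠ ∅) :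
    α'.disjSum σ' ∈ cellPairs K' K := by
  obtain ⟨h1, h2, -⟩ := disjSum_mem_cellPairs.1 h
  exact disjSum_mem_cellPairs.2 ⟨hK.down_closed' _ h1 _ hα, dualComplex_mono hK hα hσ h2, hne⟩

theorem empty_disjSum_mem_cellPairs (hK : IsMirrorPair K' K) {σ : Finset (Lat d)} :
    (∅ : Finset (Lat d)).disjSum σ ∈ cellPairs K' K ↔ σ.erase 0 ∈ K ∧ σ ≠ ∅ := by
  rw [disjSum_mem_cellPairs]
  refine ⟨fun h => ⟨h.2.1.1, h.2.2⟩, fun h => ⟨hK.empty_mem', ⟨h.1, by simp⟩, h.2⟩⟩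

/-- Every multiplicative cocycle on the poset of cells is a coboundary. -/
theorem IsPairCocycle.exists_eq_mul (hK : IsMirrorPair K' K) {R : Pairs d → Lat d ⊕ Lat d → ℤˣ}
    (hR : IsPairCocycle K' K R) : ∃ η : Pairs d → ℤˣ, ∀ t ∈ cellPairs K' K, ∀ e ∈ t,
      t.erase e ∈ cellPairs K' K → R t e = η t * η (t.erase e) := by
  classical
  have cocycle : ∀ {α σ : Finset (Lat d)}, α.disjSum σ ∈ cellPairs K' K → ∀ {e e'},
      e ∈ α.disjSum σ → e' ∈ α.disjSum σ → e ≠ e' →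
      ((α.disjSum σ).erase e).erase e' ∈ cellPairs K' K →
      R (α.disjSum σ) e * R ((α.disjSum σ).erase e) e' =
        R (α.disjSum σ) e' * R ((α.disjSum σ).erase e') e :=
    fun h _ _ he he' hne h' => hR _ h _ he _ he' hne h'
  -- Keeping 0 in σ lets one remove all other vertices without reaching σ = ∅, which is not a cell;
  -- so the Boolean case applies to these simplices.
  let C : Finset (Lat d) → ℤˣ :=
    prefixProd fun β b => R ((∅ : Finset (Lat d)).disjSum (insert 0 β)) (Sum.inr b)
  -- A simplex without 0 is joined to the potential C by the cover relation that removes 0 from its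
  -- cone.
  let B : Finset (Lat d) → ℤˣ := fun σ => if 0 ∈ σ then C (σ.erase 0) else
    C σ * R ((∅ : Finset (Lat d)).disjSum (insert 0 σ)) (Sum.inr 0)
  let A : Finset (Lat d) → Finset (Lat d) → ℤˣ := fun σ =>
    prefixProd fun α u => R (α.disjSum σ) (Sum.inl u)
  have hA0 : ∀ σ, A σ ∅ = 1 := fun σ => prefixProd_empty _
  have hC : ∀ β ∈ K, ∀ b ∈ β,
      R ((∅ : Finset (Lat d)).disjSum (insert 0 β)) (Sum.inr b) = C β * C (β.erase b) := by
    intro β hβ b hb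
    refine eq_prefixProd_mul_prefixProd
      (R := fun β b => R ((∅ : Finset (Lat d)).disjSum (insert 0 β)) (Sum.inr b)) ?_ b hb
    intro ψ hψ e he e' he' hne
    have h0 : 0 ∉ ψ := fun h => hK.zero_notMem _ hβ (hψ h)
    have he0 : (0 : Lat d) ≠ e := fun h => h0 (h ▸ he)
    have he0' : (0 : Lat d) ≠ e' := fun h => h0 (h ▸ he')
    have hcell : ∀ ψ' ⊆ ψ, (∅ : Finset (Lat d)).disjSum (insert 0 ψ') ∈ cellPairs K' K := by
      intro ψ' hψ'
      refine (empty_disjSum_mem_cellPairs hK).2 ⟨?_, Finset.insert_ne_empty _ _⟩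
      rw [Finset.erase_insert fun h => h0 (hψ' h)]
      exact hK.down_closed _ hβ _ (hψ'.trans hψ)
    have h1 := cocycle (hcell ψ subset_rfl) (e := Sum.inr e) (e' := Sum.inr e')
      (by simp [he]) (by simp [he']) (fun h => hne (Sum.inr_injective h)) (by
        rw [disjSum_erase_inr, disjSum_erase_inr, Finset.erase_insert_of_ne he0,
          Finset.erase_insert_of_ne he0']
        exact hcell _ ((Finset.erase_subset _ _).trans (Finset.erase_subset _ _)))
    rwa [disjSum_erase_inr, disjSum_erase_inr, Finset.erase_insert_of_ne he0,
      Finset.erase_insert_of_ne he0'] at h1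
  have hA : ∀ α σ, α.disjSum σ ∈ cellPairs K' K → ∀ u ∈ α,
      R (α.disjSum σ) (Sum.inl u) = A σ α * A σ (α.erase u) := by
    intro α σ hcell u hu
    have hσ := (disjSum_mem_cellPairs.1 hcell).2.2
    refine eq_prefixProd_mul_prefixProd (R := fun α u => R (α.disjSum σ) (Sum.inl u)) ?_ u hu
    intro ψ hψ e he e' he' hne
    have h1 := cocycle (disjSum_mem_cellPairs_mono hK hcell hψ subset_rfl hσ) (e := Sum.inl e)
      (e' := Sum.inl e') (by simp [he]) (by simp [he']) (fun h => hne (Sum.inl_injective h)) (by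
        rw [disjSum_erase_inl, disjSum_erase_inl]
        exact disjSum_mem_cellPairs_mono hK hcell (((Finset.erase_subset _ _).trans
          (Finset.erase_subset _ _)).trans hψ) subset_rfl hσ)
    rwa [disjSum_erase_inl, disjSum_erase_inl] at h1
  have hB : ∀ σ, (∅ : Finset (Lat d)).disjSum σ ∈ cellPairs K' K → ∀ b ∈ σ, σ.erase b ≠ ∅ →
      R ((∅ : Finset (Lat d)).disjSum σ) (Sum.inr b) = B σ * B (σ.erase b) := by
    intro σ hcell b hb hne
    have hσK := ((empty_disjSum_mem_cellPairs hK).1 hcell).1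
    by_cases h0 : 0 ∈ σ
    · have hB1 : B σ = C (σ.erase 0) := if_pos h0
      by_cases hb0 : b = 0
      · subst hb0
        have hB2 : B (σ.erase 0) = C (σ.erase 0) * R ((∅ : Finset (Lat d)).disjSum σ)
            (Sum.inr 0) := by
          simp only [B]
          rw [if_neg (Finset.notMem_erase _ _), Finset.insert_erase h0]
        rw [hB1, hB2, ← mul_assoc, Int.units_mul_self, one_mul]
      · have hB2 : B (σ.erase b) = C ((σ.erase 0).erase b) := by
          simp only [B]
          rw [if_pos (Finset.mem_erase.2 ⟨Ne.symm hb0, h0⟩), Finset.erase_right_comm]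
        rw [hB1, hB2, ← hC _ hσK b (Finset.mem_erase.2 ⟨hb0, hb⟩), Finset.insert_erase h0]
    · have hb0 : (0 : Lat d) ≠ b := fun h => h0 (h ▸ hb)
      rw [Finset.erase_eq_of_notMem h0] at hσK
      have hB1 : B σ = C σ * R ((∅ : Finset (Lat d)).disjSum (insert 0 σ)) (Sum.inr 0) :=
        if_neg h0
      have hB2 : B (σ.erase b) = C (σ.erase b) *
          R ((∅ : Finset (Lat d)).disjSum (insert 0 (σ.erase b))) (Sum.inr 0) :=
        if_neg fun h => h0 (Finset.mem_of_mem_erase h)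
      have hcell' : (∅ : Finset (Lat d)).disjSum (insert 0 σ) ∈ cellPairs K' K := by
        refine (empty_disjSum_mem_cellPairs hK).2 ⟨?_, Finset.insert_ne_empty _ _⟩
        rwa [Finset.erase_insert h0]
      have h1 := cocycle hcell' (e := Sum.inr b) (e' := Sum.inr 0) (by simp [hb]) (by simp)
        (fun h => hb0 (Sum.inr_injective h).symm) (by
          rw [disjSum_erase_inr, disjSum_erase_inr]
          refine disjSum_mem_cellPairs_mono hK hcell subset_rfl ?_ ?_
          · rw [Finset.erase_insert_of_ne hb0, Finset.erase_insert
              fun h => h0 (Finset.mem_of_mem_erase h)]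
            exact Finset.erase_subset _ _
          · rwa [Finset.erase_insert_of_ne hb0, Finset.erase_insert
              fun h => h0 (Finset.mem_of_mem_erase h)])
      rw [disjSum_erase_inr, disjSum_erase_inr, Finset.erase_insert_of_ne hb0,
        Finset.erase_insert h0, hC _ hσK b hb, mul_comm (R _ (Sum.inr 0))] at h1
      rw [hB1, hB2, units_cocycle_aux h1]
      ac_rfl
  -- A was built from removals in α with σ fixed, B from removals in σ with α = ∅. The squares
  -- removing one element on each side propagate the formula to all α.
  have hmix : ∀ α σ, α.disjSum σ ∈ cellPairs K' K → ∀ b ∈ σ, σ.erase b ≠ ∅ →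
      R (α.disjSum σ) (Sum.inr b) = A σ α * B σ * (A (σ.erase b) α * B (σ.erase b)) := by
    intro α
    induction α using Finset.induction_on with
    | empty =>
      intro σ hcell b hb hne
      rw [hA0, hA0, one_mul, one_mul, hB σ hcell b hb hne]
    | insert u α hu ih =>
      intro σ hcell b hb hne
      have hσ := (disjSum_mem_cellPairs.1 hcell).2.2
      have hcell1 := disjSum_mem_cellPairs_mono hK hcell (Finset.subset_insert u α) subset_rfl hσ
      have hcell2 := disjSum_mem_cellPairs_mono hK hcell subset_rfl (Finset.erase_subset b σ) hne
      have h1 := cocycle hcell (e := Sum.inl u) (e' := Sum.inr b) (by simp) (by simp [hb])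
        (by simp) (by
          rw [disjSum_erase_inl, disjSum_erase_inr, Finset.erase_insert hu]
          exact disjSum_mem_cellPairs_mono hK hcell1 subset_rfl (Finset.erase_subset _ _) hne)
      rw [disjSum_erase_inl, disjSum_erase_inr, Finset.erase_insert hu, ih σ hcell1 b hb hne,
        hA _ _ hcell u (Finset.mem_insert_self _ _), hA _ _ hcell2 u (Finset.mem_insert_self _ _),
        Finset.erase_insert hu] at h1
      rw [units_cocycle_aux h1]
      generalize A σ (insert u α) = x1
      generalize A σ α = x2
      generalize A (σ.erase b) (insert u α) = x3
      generalize A (σ.erase b) α = x4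
      generalize B σ = x5
      generalize B (σ.erase b) = x6
      calc _ = (x2 * x2) * (x4 * x4) * (x1 * x5 * (x3 * x6)) := by
            ac_rfl
        _ = _ := by rw [Int.units_mul_self, Int.units_mul_self, one_mul, one_mul]
  refine ⟨fun t => A t.toRight t.toLeft * B t.toRight, fun t ht e he hte => ?_⟩
  obtain ⟨α, σ, rfl⟩ : ∃ α σ : Finset (Lat d), t = α.disjSum σ :=
    ⟨_, _, (Finset.toLeft_disjSum_toRight).symm⟩
  rcases e with u | b
  · have hu : u ∈ α := by simpa using he
    simp only [disjSum_erase_inl, Finset.toLeft_disjSum, Finset.toRight_disjSum]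
    rw [hA _ _ ht u hu, mul_mul_mul_comm, Int.units_mul_self, mul_one]
  · have hb : b ∈ σ := by simpa using he
    rw [disjSum_erase_inr] at hte
    simp only [disjSum_erase_inr, Finset.toLeft_disjSum, Finset.toRight_disjSum]
    exact hmix _ _ ht b hb (disjSum_mem_cellPairs.1 hte).2.2

end PairSignatures

/-! ### The poset of cells -/

section CellPoset

variable {d : ℕ} {Q Δ : Set (Fin d → ℝ)} {T' : Triangulation Q} {T : Triangulation Δ}
  {μ : Lat d → ℤ}

theorem covBy_of_erase_eq {P V : Type*} [PartialOrder P] [DecidableEq V] {f : P → Finset V}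
    (hf : ∀ x y, x ≤ y ↔ f y ⊆ f x) {x y : P} {e : V} (he : e ∈ f x) (h : (f x).erase e = f y) :
    x ⋖ y := by
  refine ⟨lt_of_le_not_ge ((hf x y).2 (h ▸ Finset.erase_subset _ _)) fun hyx => ?_, ?_⟩
  · exact Finset.notMem_erase e (f x) (h ▸ (hf y x).1 hyx he)
  · intro z hxz hzy
    have h1 := (hf x z).1 hxz.le
    have h2 := (hf z y).1 hzy.le
    by_cases hez : e ∈ f z
    · refine hxz.not_ge ((hf z x).2 ?_)
      rw [← Finset.insert_erase he, h]
      exact Finset.insert_subset hez h2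
    · refine hzy.not_ge ((hf y z).2 ?_)
      rw [← h]
      exact Finset.subset_erase.2 ⟨h1, hez⟩

/-- The pair of finite sets that describes a cell. -/
def Cell.pair (c : Cell T' T μ) : Pairs d := (c.τ.erase 0).disjSum c.σ

theorem Cell.insert_zero (c : Cell T' T μ) : insert 0 (c.τ.erase 0) = c.τ :=
  Finset.insert_erase c.zero_mem

@[simp]
theorem Cell.toLeft_pair (c : Cell T' T μ) : c.pair.toLeft = c.τ.erase 0 :=
  Finset.toLeft_disjSum

@[simp]
theorem Cell.toRight_pair (c : Cell T' T μ) : c.pair.toRight = c.σ :=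
  Finset.toRight_disjSum

theorem Cell.card_pair (c : Cell T' T μ) : (c.pair.card : ℤ) = d + 1 - c.dim := by
  have h := Finset.card_pos.2 ⟨0, c.zero_mem⟩
  rw [Cell.pair, Finset.card_disjSum, Finset.card_erase_of_mem c.zero_mem, Cell.dim]
  push_cast [Nat.cast_sub h]
  ring

theorem Cell.le_iff {x y : Cell T' T μ} : x ≤ y ↔ y.pair ⊆ x.pair := by
  constructor
  · rintro ⟨h1, h2⟩
    exact Finset.disjSum_mono (Finset.erase_subset_erase _ h1) h2
  · intro h
    have h1 := toLeft_mono h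
    have h2 := toRight_mono h
    rw [Cell.toLeft_pair, Cell.toLeft_pair] at h1
    rw [Cell.toRight_pair, Cell.toRight_pair] at h2
    refine ⟨?_, h2⟩
    rw [← x.insert_zero, ← y.insert_zero]
    exact Finset.insert_subset_insert _ h1

theorem Cell.pair_injective : Function.Injective (Cell.pair : Cell T' T μ → Pairs d) :=
  fun _ _ h => le_antisymm (Cell.le_iff.2 h.ge) (Cell.le_iff.2 h.le)

variable (hQ : IsPolarPair Q Δ) (hμ : T.IsInducedBy μ)
include hQ hμ

theorem Cell.dotProduct_eq_one (c : Cell T' T μ) : ∀ u ∈ c.τ.erase 0, ∀ b ∈ c.σ, u ⬝ᵥ b = 1 :=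
  (closedCell_nonempty_iff hQ hμ c.τ_mem c.zero_mem c.σ_mem).1 c.nonempty

theorem Cell.pair_mem (c : Cell T' T μ) :
    c.pair ∈ cellPairs (boundaryComplex T') (boundaryComplex T) := by
  rw [Cell.pair, disjSum_mem_cellPairs, mem_dualComplex_boundaryComplex]
  refine ⟨⟨Finset.notMem_erase _ _, ?_⟩, ⟨T.insert_zero _ c.σ_mem, c.dotProduct_eq_one hQ hμ⟩,
    (T.nonempty _ c.σ_mem).ne_empty⟩
  rw [c.insert_zero]
  exact c.τ_mem

/-- Together with `Cell.pair_mem`, this makes the geometric cells the combinatorial pairs with σ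
nonempty. -/
theorem exists_cell_pair_eq {t : Pairs d}
    (ht : t ∈ cellPairs (boundaryComplex T') (boundaryComplex T)) :
    ∃ c : Cell T' T μ, c.pair = t := by
  obtain ⟨α, σ, rfl⟩ : ∃ α σ : Finset (Lat d), t = α.disjSum σ :=
    ⟨_, _, (Finset.toLeft_disjSum_toRight).symm⟩
  rw [disjSum_mem_cellPairs, mem_dualComplex_boundaryComplex] at ht
  obtain ⟨⟨h0, h1⟩, ⟨h2, h3⟩, h4⟩ := ht
  have hσ : σ ∈ T.faces := (T.eq_empty_or_mem_faces h2).resolve_left h4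
  refine ⟨⟨insert 0 α, σ, h1, Finset.mem_insert_self _ _, hσ, ?_⟩, ?_⟩
  · rw [closedCell_nonempty_iff hQ hμ h1 (Finset.mem_insert_self _ _) hσ, Finset.erase_insert h0]
    exact h3
  · change ((insert 0 α).erase 0).disjSum σ = _
    rw [Finset.erase_insert h0]

theorem Cell.subset_tropicalCY_iff (c : Cell T' T μ) :
    closedCell T' Δ μ c.τ c.σ ⊆ tropicalCY T' Δ μ ↔ 2 ≤ c.σ.card :=
  closedCell_subset_tropicalCY_iff hQ hμ c.τ_mem c.zero_mem c.σ_mem (c.dotProduct_eq_one hQ hμ)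

/-- A balanced signature differs from the standard signs by a coboundary. -/
theorem IsBalanced.exists_eq_mul
    (hK : IsMirrorPair (boundaryComplex T') (boundaryComplex T))
    {s : Cell T' T μ → Cell T' T μ → ℤˣ} (hs : IsBalanced Cell.dim s) :
    ∃ η : Pairs d → ℤˣ, ∀ x y : Cell T' T μ, ∀ e ∈ x.pair, x.pair.erase e = y.pair →
      s x y = η x.pair * η y.pair * standardSign x.pair e := by
  classical
  -- The signature is transported to pairs of finite sets; its value 1 away from cells is a default.
  let S : Pairs d × Pairs d → ℤˣ := Function.extend (Prod.map Cell.pair Cell.pair)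
    (fun c : Cell T' T μ × Cell T' T μ => s c.1 c.2) 1
  have hS : ∀ x y : Cell T' T μ, S (x.pair, y.pair) = s x y := fun x y =>
    (Cell.pair_injective.prodMap Cell.pair_injective).extend_apply _ _ (x, y)
  have hcov : ∀ x y : Cell T' T μ, ∀ e ∈ x.pair, x.pair.erase e = y.pair → x ⋖ y :=
    fun x y e he h => covBy_of_erase_eq (f := Cell.pair) (fun _ _ => Cell.le_iff) he h
  have hR : IsPairCocycle (boundaryComplex T') (boundaryComplex T)
      fun t e => S (t, t.erase e) * standardSign t e := by
    intro t ht e he e' he' hne hy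
    have hmem : ∀ t', (t.erase e).erase e' ⊆ t' → t' ⊆ t →
        t' ∈ cellPairs (boundaryComplex T') (boundaryComplex T) := fun t' h1 h2 =>
      ⟨validPairs_mono hK h2 ht.1, fun h => hy.2 (Finset.subset_empty.1
        ((toRight_mono h1).trans_eq h))⟩
    have he1 : e' ∈ t.erase e := Finset.mem_erase.2 ⟨hne.symm, he'⟩
    have he2 : e ∈ t.erase e' := Finset.mem_erase.2 ⟨hne, he⟩
    obtain ⟨x, rfl⟩ := exists_cell_pair_eq hQ hμ ht
    obtain ⟨y, hy'⟩ := exists_cell_pair_eq hQ hμ hy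
    obtain ⟨w₁, hw₁⟩ := exists_cell_pair_eq hQ hμ
      (hmem _ (Finset.erase_subset _ _) (Finset.erase_subset e _))
    obtain ⟨w₂, hw₂⟩ := exists_cell_pair_eq hQ hμ
      (hmem _ (Finset.erase_right_comm.trans_subset (Finset.erase_subset _ _))
        (Finset.erase_subset e' _))
    have hc1 := hcov x w₁ e he hw₁.symm
    have hc2 := hcov x w₂ e' he' hw₂.symm
    have hc3 := hcov w₁ y e' (hw₁ ▸ he1) (by rw [hw₁, hy'])
    have hc4 := hcov w₂ y e (hw₂ ▸ he2) (by rw [hw₂, hy', Finset.erase_right_comm])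
    have hne' : w₁ ≠ w₂ := by
      intro h
      have : e' ∈ w₂.pair := by
        rw [← h, hw₁]
        exact he1
      rw [hw₂] at this
      exact Finset.notMem_erase _ _ this
    have hdim : y.dim - x.dim = 2 := by
      have h1 := y.card_pair
      have h2 := x.card_pair
      have h3 := Finset.card_erase_add_one he
      have h4 := Finset.card_erase_add_one he1
      rw [← hy'] at h4
      lia
    have hb := hs x y w₁ w₂ hdim hne' hc1 hc3 hc2 hc4
    have hst := standardSign_anticomm x.pair he he' hne
    dsimp only
    rw [Finset.erase_right_comm (a := e') (b := e), ← hy', ← hw₁, ← hw₂, hS, hS, hS, hS]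
    rw [← hw₁, ← hw₂] at hst
    rw [mul_mul_mul_comm, hst, mul_mul_mul_comm (s x w₂)]
    have hb' : s x w₁ * s w₁ y = -(s x w₂ * s w₂ y) := by
      rw [← mul_one (s x w₁ * s w₁ y), ← Int.units_mul_self (s x w₂ * s w₂ y), ← mul_assoc, hb,
        neg_one_mul]
    rw [hb', neg_mul_neg]
  obtain ⟨η, hη⟩ := hR.exists_eq_mul hK
  refine ⟨η, fun x y e he h => ?_⟩
  have h1 := hη _ (x.pair_mem hQ hμ) e he (h ▸ y.pair_mem hQ hμ)
  rw [h, hS] at h1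
  rw [← h1, mul_assoc, Int.units_mul_self, mul_one]

end CellPoset

/-! ### The embedding of the multitangent spaces -/

section CellEmbedding

variable {d : ℕ} {Q Δ : Set (Fin d → ℝ)} {T' : Triangulation Q} {T : Triangulation Δ}
  {μ : Lat d → ℤ} {p : ℕ}

/-- The map of rational multitangent spaces induced by a projection. -/
def multitangentRatMap (p : ℕ) {C C' : Submodule ℤ (Lat d)} {E E' : Set (Submodule ℤ (Lat d))}
    (hC : C ≤ C') (hE : E ⊆ E') :
    ℚ ⊗[ℤ] MultitangentModule p C E →ₗ[ℚ] ℚ ⊗[ℤ] MultitangentModule p C' E' :=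
  (multitangentMap p hC hE).baseChange ℚ

theorem multitangentRatMap_tmul {C C' : Submodule ℤ (Lat d)} {E E' : Set (Submodule ℤ (Lat d))}
    (hC : C ≤ C') (hE : E ⊆ E') (c : ℚ) (y : MultitangentModule p C E) :
    multitangentRatMap p hC hE (c ⊗ₜ y) = c ⊗ₜ multitangentMap p hC hE y := rfl

theorem thetaRat_map_self {α : Finset (Lat d)} {E E' : Set (Submodule ℤ (Lat d))} (hE : E ⊆ E')
    (z : ℚ ⊗[ℤ] MultitangentModule p (coneSpan (insert 0 α)) E) :
    thetaRat p α E' (multitangentRatMap p le_rfl hE z) = thetaRat p α E z := by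
  induction z using TensorProduct.induction_on with
  | zero => simp only [map_zero]
  | add a b ha hb => simp only [map_add, ha, hb]
  | tmul c y =>
    rw [multitangentRatMap_tmul, thetaRat_tmul, thetaRat_tmul]
    have h : Submodule.factor (le_refl (coneSpan (insert 0 α))) = LinearMap.id :=
      Submodule.linearMap_qext _ rfl
    change c • theta p α (exteriorPower.map p (Submodule.factor (le_refl _))
      (multitangentIncl p _ E y)) = _
    rw [h, exteriorPower.map_id, LinearMap.id_apply]

theorem thetaRat_map_insert {α : Finset (Lat d)} {u : Lat d} (hu : u ∉ α)
    (hα : insert 0 (insert u α) ∈ T'.faces)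
    (hC : coneSpan (insert 0 α) ≤ coneSpan (insert 0 (insert u α)))
    {E E' : Set (Submodule ℤ (Lat d))} (hE : E ⊆ E')
    (z : ℚ ⊗[ℤ] MultitangentModule p (coneSpan (insert 0 α)) E) :
    thetaRat p (insert u α) E' (multitangentRatMap p hC hE z) =
      ((insertSign u α : ℤˣ) : ℤ) • wedge (lift u) (thetaRat p α E z) := by
  induction z using TensorProduct.induction_on with
  | zero => simp only [map_zero, smul_zero]
  | add a b ha hb => simp only [map_add, ha, hb, smul_add]
  | tmul c y =>
    rw [multitangentRatMap_tmul, thetaRat_tmul, thetaRat_tmul]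
    change c • theta p (insert u α) (exteriorPower.map p (Submodule.factor hC)
      (multitangentIncl p _ E y)) = _
    rw [theta_factor hu hα hC, map_smul, smul_comm]

theorem Cell.coneSpan_insert (c : Cell T' T μ) :
    coneSpan (insert 0 (c.τ.erase 0)) = coneSpan c.τ := by
  rw [c.insert_zero]

/-- The embedding of the multitangent space of a cell into the Fock space. -/
def Cell.embedding (p : ℕ) (c : Cell T' T μ) :
    (ℚ ⊗[ℤ] MultitangentModule p (coneSpan c.τ) (edgePerps c.σ)) →ₗ[ℚ] Fock d :=
  thetaRat p (c.τ.erase 0) (edgePerps c.σ) ∘ₗ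
    multitangentRatMap p c.coneSpan_insert.ge subset_rfl

theorem multitangentRatMap_comp {C₁ C₂ C₃ : Submodule ℤ (Lat d)}
    {E₁ E₂ E₃ : Set (Submodule ℤ (Lat d))}
    (hC : C₁ ≤ C₂) (hE : E₁ ⊆ E₂) (hC' : C₂ ≤ C₃) (hE' : E₂ ⊆ E₃)
    (z : ℚ ⊗[ℤ] MultitangentModule p C₁ E₁) :
    multitangentRatMap p hC' hE' (multitangentRatMap p hC hE z) =
      multitangentRatMap p (hC.trans hC') (hE.trans hE') z := by
  induction z using TensorProduct.induction_on with
  | zero => simp only [map_zero]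
  | add a b ha hb => simp only [map_add, ha, hb]
  | tmul c y =>
    rw [multitangentRatMap_tmul, multitangentRatMap_tmul, multitangentRatMap_tmul,
      multitangentMap_trans p hC hE hC' hE']
    rfl

theorem multitangentRatMap_self {C : Submodule ℤ (Lat d)} {E : Set (Submodule ℤ (Lat d))}
    (hC : C ≤ C) (hE : E ⊆ E) (z : ℚ ⊗[ℤ] MultitangentModule p C E) :
    multitangentRatMap p hC hE z = z := by
  induction z using TensorProduct.induction_on with
  | zero => simp only [map_zero]
  | add a b ha hb => simp only [map_add, ha, hb]
  | tmul c y =>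
    rw [multitangentRatMap_tmul, multitangentMap_refl]
    rfl

theorem Cell.embedding_apply (c : Cell T' T μ)
    (z : ℚ ⊗[ℤ] MultitangentModule p (coneSpan c.τ) (edgePerps c.σ)) :
    c.embedding p z = thetaRat p (c.τ.erase 0) (edgePerps c.σ)
      (multitangentRatMap p c.coneSpan_insert.ge subset_rfl z) := rfl

theorem Cell.embedding_injective (c : Cell T' T μ) : Function.Injective (c.embedding p) := by
  have h : insert 0 (c.τ.erase 0) ∈ T'.faces := by
    rw [c.insert_zero]
    exact c.τ_mem
  refine (thetaRat_injective h (Finset.notMem_erase _ _) _).comp (Function.LeftInverse.injective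
    (g := multitangentRatMap p c.coneSpan_insert.le subset_rfl) fun z => ?_)
  rw [multitangentRatMap_comp, multitangentRatMap_self]

theorem Cell.mem_range_embedding_iff (hQ : IsPolarPair Q Δ) (hμ : T.IsInducedBy μ)
    (c : Cell T' T μ) {x : Fock d} : (∃ z, c.embedding p z = x) ↔
      x ∈ tangentCoeff p c.pair.toLeft ∧ contractProd lift c.pair.toRight x = 0 := by
  have h : insert 0 (c.τ.erase 0) ∈ T'.faces := by
    rw [c.insert_zero]
    exact c.τ_mem
  rw [c.toLeft_pair, c.toRight_pair, ← mem_range_thetaRat_iff T h (Finset.notMem_erase _ _) c.σ_mem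
    (c.dotProduct_eq_one hQ hμ)]
  constructor
  · rintro ⟨z, rfl⟩
    exact ⟨_, rfl⟩
  · rintro ⟨z, rfl⟩
    refine ⟨multitangentRatMap p c.coneSpan_insert.le subset_rfl z, ?_⟩
    rw [c.embedding_apply, multitangentRatMap_comp, multitangentRatMap_self]

/-- The signs in `standardSign` are those for which the cosheaf map becomes minus the operator of
the cellular complex, the sign of the differential of the mapping cone. -/
theorem Cell.embedding_map {x y : Cell T' T μ} {e : Lat d ⊕ Lat d} (he : e ∈ x.pair)
    (h : x.pair.erase e = y.pair) (hC : coneSpan y.τ ≤ coneSpan x.τ)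
    (hE : edgePerps y.σ ⊆ edgePerps x.σ)
    (z : ℚ ⊗[ℤ] MultitangentModule p (coneSpan y.τ) (edgePerps y.σ)) :
    ((standardSign x.pair e : ℤˣ) : ℤ) •
      x.embedding p (multitangentRatMap p hC hE z) =
      -cellOp e x.pair (y.embedding p z) := by
  obtain ⟨w, rfl⟩ : ∃ w, multitangentRatMap p y.coneSpan_insert.le subset_rfl w = z :=
    ⟨multitangentRatMap p y.coneSpan_insert.ge subset_rfl z, by
      rw [multitangentRatMap_comp, multitangentRatMap_self]⟩
  rw [x.embedding_apply, y.embedding_apply]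
  rw [multitangentRatMap_comp, multitangentRatMap_comp,
    multitangentRatMap_comp, multitangentRatMap_self]
  have hx : insert 0 (x.τ.erase 0) ∈ T'.faces := by
    rw [x.insert_zero]
    exact x.τ_mem
  have hleft := congrArg Finset.toLeft h
  rcases e with u | b
  · have hu : u ∈ x.τ.erase 0 := by
      rw [← x.toLeft_pair]
      exact Finset.mem_toLeft.2 he
    rw [toLeft_erase_inl, x.toLeft_pair, y.toLeft_pair] at hleft
    have hins : x.τ.erase 0 = insert u (y.τ.erase 0) := by
      rw [← hleft, Finset.insert_erase hu]
    have hnot : u ∉ y.τ.erase 0 := by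
      rw [← hleft]
      exact Finset.notMem_erase _ _
    have key : ∀ α, α = insert u (y.τ.erase 0) → ∀ hC' : coneSpan (insert 0 (y.τ.erase 0)) ≤
        coneSpan (insert 0 α), insert 0 α ∈ T'.faces →
        thetaRat p α (edgePerps x.σ) (multitangentRatMap p hC' hE w) =
        ((insertSign u (y.τ.erase 0) : ℤˣ) : ℤ) •
          wedge (lift u) (thetaRat p (y.τ.erase 0) (edgePerps y.σ) w) := by
      rintro α rfl hC' hα
      exact thetaRat_map_insert hnot hα hC' hE w
    rw [key _ hins _ hx]
    simp only [standardSign, cellOp, x.toLeft_pair, x.toRight_pair, hleft, LinearMap.smul_apply]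
    rw [smul_smul, ← neg_smul]
    congr 1
    push_cast
    rw [neg_mul, mul_assoc, ← Units.val_mul, Int.units_mul_self, Units.val_one, mul_one]
  · rw [toLeft_erase_inr, x.toLeft_pair, y.toLeft_pair] at hleft
    have key : ∀ α, α = y.τ.erase 0 → ∀ hC' : coneSpan (insert 0 (y.τ.erase 0)) ≤
        coneSpan (insert 0 α),
        thetaRat p α (edgePerps x.σ) (multitangentRatMap p hC' hE w) =
          thetaRat p (y.τ.erase 0) (edgePerps y.σ) w := by
      rintro α rfl hC'
      exact thetaRat_map_self hE w
    rw [key _ hleft]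
    simp [standardSign, cellOp]

end CellEmbedding

/-! ### Tropical homology as the cohomology of the mapping cone -/

section Comparison

variable {d : ℕ} {Q Δ : Set (Fin d → ℝ)} {T' : Triangulation Q} {T : Triangulation Δ}
  {μ : Lat d → ℤ}

/-- The pair of finite sets that describes a cell of the hypersurface. -/
def HypersurfaceCell.pair (c : HypersurfaceCell T' T μ) : Pairs d := c.val.pair

/-- The dimension of a cell of the hypersurface. -/
def HypersurfaceCell.dim (c : HypersurfaceCell T' T μ) : ℤ := c.val.dim

theorem HypersurfaceCell.pair_injective :
    Function.Injective (HypersurfaceCell.pair : HypersurfaceCell T' T μ → Pairs d) :=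
  fun _ _ h => Subtype.ext (Cell.pair_injective h)

variable (T' T μ) in
/-- The rational multitangent cosheaf on the cells of the hypersurface. -/
abbrev rationalCosheaf (p : ℕ) : Cosheaf ℚ (HypersurfaceCell T' T μ) :=
  ((multitangentCosheaf T' T μ p).baseChange ℚ).restrict
    (fun c : HypersurfaceCell T' T μ => c.val) (fun _ _ h => h)

/-- The embedding of the stalks of the rational multitangent cosheaf into the Fock space. -/
def HypersurfaceCell.embedding (p : ℕ) (c : HypersurfaceCell T' T μ) :
    (rationalCosheaf T' T μ p).obj c →ₗ[ℚ] Fock d :=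
  c.val.embedding p

theorem HypersurfaceCell.embedding_injective (p : ℕ) (c : HypersurfaceCell T' T μ) :
    Function.Injective (c.embedding p) := c.val.embedding_injective

theorem HypersurfaceCell.embedding_map {p : ℕ} {x y : HypersurfaceCell T' T μ}
    {e : Lat d ⊕ Lat d} (he : e ∈ x.pair) (h : x.pair.erase e = y.pair) (hxy : x ≤ y)
    (z : (rationalCosheaf T' T μ p).obj y) :
    ((standardSign x.pair e : ℤˣ) : ℤ) • x.embedding p ((rationalCosheaf T' T μ p).map hxy z) =
      -cellOp e x.pair (y.embedding p z) :=
  Cell.embedding_map he h (coneSpan_mono hxy.1) (edgePerps_mono hxy.2) z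

theorem HypersurfaceCell.le_iff {x y : HypersurfaceCell T' T μ} : x ≤ y ↔ y.pair ⊆ x.pair :=
  Cell.le_iff

theorem HypersurfaceCell.card_pair (c : HypersurfaceCell T' T μ) :
    (c.pair.card : ℤ) = d + 1 - c.dim := Cell.card_pair _

open scoped Classical in
/-- The map from the chains to functions on pairs of finite sets. -/
def chainEmbedding (p : ℕ) (η : Pairs d → ℤˣ) (q : ℤ) :
    Chains (rationalCosheaf T' T μ p) HypersurfaceCell.dim q →ₗ[ℚ] (Pairs d → Fock d) :=
  DirectSum.toModule ℚ {c : HypersurfaceCell T' T μ // c.dim = q} (Pairs d → Fock d) fun c =>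
    ((η c.1.pair : ℤˣ) : ℤ) • LinearMap.single ℚ (fun _ => Fock d) c.1.pair ∘ₗ c.1.embedding p

variable {p : ℕ} {η : Pairs d → ℤˣ} {q : ℤ}

open scoped Classical in
theorem chainEmbedding_lof (c : {c : HypersurfaceCell T' T μ // c.dim = q})
    (z : (rationalCosheaf T' T μ p).obj c.1) :
    chainEmbedding p η q (DirectSum.lof ℚ {c : HypersurfaceCell T' T μ // c.dim = q}
      (fun c => (rationalCosheaf T' T μ p).obj c.1) c z) =
      Pi.single c.1.pair (((η c.1.pair : ℤˣ) : ℤ) • c.1.embedding p z) := by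
  rw [chainEmbedding, DirectSum.toModule_lof, Pi.single_smul]
  rfl

theorem chainEmbedding_apply_pair (z : Chains (rationalCosheaf T' T μ p) HypersurfaceCell.dim q)
    (c : {c : HypersurfaceCell T' T μ // c.dim = q}) :
    chainEmbedding p η q z c.1.pair = ((η c.1.pair : ℤˣ) : ℤ) • c.1.embedding p (z c) := by
  classical
  induction z using DirectSum.induction_on with
  | zero => simp
  | add a b ha hb => rw [map_add, Pi.add_apply, ha, hb, DirectSum.add_apply, map_add, smul_add]
  | of c' w =>
    have h := chainEmbedding_lof (η := η) c' w
    rw [DirectSum.lof_eq_of] at h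
    rw [h]
    by_cases hc : c' = c
    · subst hc
      rw [Pi.single_eq_same, DirectSum.of_eq_same]
    · rw [DirectSum.of_eq_of_ne _ _ _ (Ne.symm hc), map_zero, smul_zero, Pi.single_eq_of_ne]
      exact fun h => hc (Subtype.ext (HypersurfaceCell.pair_injective h.symm))

theorem chainEmbedding_apply_of_forall_ne
    (z : Chains (rationalCosheaf T' T μ p) HypersurfaceCell.dim q) {t : Pairs d}
    (ht : ∀ c : HypersurfaceCell T' T μ, c.dim = q → c.pair ≠ t) :
    chainEmbedding p η q z t = 0 := by
  classical
  induction z using DirectSum.induction_on with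
  | zero => simp
  | add a b ha hb => rw [map_add, Pi.add_apply, ha, hb, add_zero]
  | of c' w =>
    have h := chainEmbedding_lof (η := η) c' w
    rw [DirectSum.lof_eq_of] at h
    rw [h, Pi.single_eq_of_ne (ht _ c'.2).symm]

theorem chainEmbedding_injective : Function.Injective
    (chainEmbedding (T' := T') (T := T) (μ := μ) p η q) := by
  rw [injective_iff_map_eq_zero]
  intro z hz
  refine DirectSum.ext_component (R := ℚ) fun c => ?_
  have h := chainEmbedding_apply_pair (η := η) z c
  rw [hz, Pi.zero_apply] at h
  apply c.1.embedding_injective p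
  change c.1.embedding p (z c) = c.1.embedding p 0
  rw [map_zero]
  rcases Int.units_eq_one_or (η c.1.pair) with h1 | h1 <;> rw [h1] at h <;> simpa using h.symm

open scoped Classical in
theorem boundaryMap_lof {P : Type} [PartialOrder P] [Finite P] (F : Cosheaf ℚ P) (dim : P → ℤ)
    (s : P → P → ℤˣ) (q r : ℤ) [Fintype {y : P // dim y = r}] (x : {x : P // dim x = q})
    (z : F.obj x.1) : boundaryMap F dim s q r
      (DirectSum.lof ℚ {x : P // dim x = q} (fun x => F.obj x.1) x z) =
    ∑ y : {y : P // dim y = r}, if h : (y : P) ⋖ (x : P) then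
        ((s y x : ℤˣ) : ℤ) • DirectSum.lof ℚ {y : P // dim y = r} (fun y => F.obj y.1) y
          (F.map h.le z) else 0 := by
  rw [boundaryMap, DirectSum.toModule_lof, LinearMap.sum_apply]
  refine Finset.sum_congr (Finset.ext fun y => by simp) fun y _ => ?_
  split_ifs <;> rfl

variable (hQ : IsPolarPair Q Δ) (hμ : T.IsInducedBy μ)
include hQ hμ

theorem exists_hypersurfaceCell_pair_eq {t : Pairs d}
    (ht : t ∈ cellPairs (boundaryComplex T') (boundaryComplex T)) (h2 : 2 ≤ t.toRight.card) :
    ∃ c : HypersurfaceCell T' T μ, c.pair = t := by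
  obtain ⟨c, rfl⟩ := exists_cell_pair_eq hQ hμ ht
  rw [c.toRight_pair] at h2
  exact ⟨⟨c, (c.subset_tropicalCY_iff hQ hμ).2 h2⟩, rfl⟩

theorem HypersurfaceCell.two_le_card (c : HypersurfaceCell T' T μ) :
    2 ≤ c.pair.toRight.card := by
  rw [HypersurfaceCell.pair, Cell.toRight_pair]
  exact (c.val.subset_tropicalCY_iff hQ hμ).1 c.2

/-- For a chain on one cell x, both sides are supported on the cells whose pair has one more
element. Those cells are in the hypersurface too, as σ can only grow, and the weights η absorb the
difference of signatures. -/
theorem chainEmbedding_boundaryMap {s : Cell T' T μ → Cell T' T μ → ℤˣ}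
    (hη : ∀ x y : Cell T' T μ, ∀ e ∈ x.pair, x.pair.erase e = y.pair →
      s x y = η x.pair * η y.pair * standardSign x.pair e) {r : ℤ} (hr : r = q - 1)
    (z : Chains (rationalCosheaf T' T μ p) HypersurfaceCell.dim q) :
    chainEmbedding p η r (boundaryMap (rationalCosheaf T' T μ p) HypersurfaceCell.dim
      (fun y x => s y.val x.val) q r z) =
      -coboundary (cellPairs (boundaryComplex T') (boundaryComplex T)) cellOp
        (chainEmbedding p η q z) := by
  classical
  induction z using DirectSum.induction_on with
  | zero => simp only [map_zero, neg_zero]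
  | add a b ha hb => simp only [map_add, ha, hb, neg_add]
  | of x z =>
  rw [← DirectSum.lof_eq_of ℚ]
  have : Fintype {y : HypersurfaceCell T' T μ // y.dim = r} := Fintype.ofFinite _
  have hb := boundaryMap_lof (rationalCosheaf T' T μ p) HypersurfaceCell.dim
    (fun y x => s y.val x.val) q r x z
  have hc := chainEmbedding_lof (η := η) x z
  have hd : ∀ (y : {y : HypersurfaceCell T' T μ // y.dim = r}) (h : y.1 ⋖ x.1),
      chainEmbedding p η r (((s y.1.val x.1.val : ℤˣ) : ℤ) • DirectSum.lof ℚ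
        {y : HypersurfaceCell T' T μ // y.dim = r} (fun y => (rationalCosheaf T' T μ p).obj y.1) y
          ((rationalCosheaf T' T μ p).map h.le z)) =
      ((s y.1.val x.1.val : ℤˣ) : ℤ) • Pi.single y.1.pair (((η y.1.pair : ℤˣ) : ℤ) •
        y.1.embedding p ((rationalCosheaf T' T μ p).map h.le z)) := by
    intro y h
    rw [map_zsmul, chainEmbedding_lof]
  refine (congrArg (chainEmbedding p η r) hb).trans ?_
  rw [map_sum, hc]
  funext t
  rw [Finset.sum_apply, Pi.neg_apply]
  by_cases ht : t ∈ cellPairs (boundaryComplex T') (boundaryComplex T) ∧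
      ∃ e ∈ t, t.erase e = x.1.pair
  · obtain ⟨htc, e, he, hte⟩ := ht
    have h2 : 2 ≤ t.toRight.card := (x.1.two_le_card hQ hμ).trans
      (Finset.card_le_card (toRight_mono (hte ▸ Finset.erase_subset e t)))
    obtain ⟨y, rfl⟩ := exists_hypersurfaceCell_pair_eq hQ hμ htc h2
    have hcov : y ⋖ x.1 := covBy_of_erase_eq (f := HypersurfaceCell.pair)
      (fun _ _ => HypersurfaceCell.le_iff) he hte
    have hdim : y.dim = r := by
      have h3 := Finset.card_erase_add_one he
      have h4 := y.card_pair
      have h5 := x.1.card_pair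
      have h6 := x.2
      rw [hte] at h3
      lia
    rw [Finset.sum_eq_single ⟨y, hdim⟩, dif_pos hcov, hd ⟨y, hdim⟩ hcov, Pi.smul_apply,
      Pi.single_eq_same, coboundary_apply _ _ htc, Finset.sum_eq_single e, hte, Pi.single_eq_same,
      map_zsmul, ← smul_neg]
    · dsimp only
      rw [← HypersurfaceCell.embedding_map he hte hcov.le, smul_smul, smul_smul,
        hη y.val x.1.val e he hte, ← Units.val_mul, ← Units.val_mul]
      congr 2
      change η y.pair * η x.1.pair * _ * η y.pair = η x.1.pair * _
      calc _ = η y.pair * η y.pair * (η x.1.pair * standardSign y.val.pair e) := by ac_rfl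
        _ = _ := by rw [Int.units_mul_self, one_mul]; rfl
    · intro e' he' hne
      rw [Pi.single_eq_of_ne, map_zero]
      rw [← hte]
      intro h
      exact Finset.notMem_erase e' y.pair (h ▸ Finset.mem_erase.2 ⟨hne, he'⟩)
    · exact fun h => absurd he h
    · intro y' _ hne
      by_cases h : y'.1 ⋖ x.1
      · rw [dif_pos h, hd y' h, Pi.smul_apply, Pi.single_eq_of_ne, smul_zero]
        exact fun h => hne (Subtype.ext (HypersurfaceCell.pair_injective h.symm))
      · rw [dif_neg h, map_zero, Pi.zero_apply]
    · exact fun h => absurd (Finset.mem_univ _) h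
  · have hR : coboundary (cellPairs (boundaryComplex T') (boundaryComplex T)) cellOp
        (Pi.single x.1.pair (((η x.1.pair : ℤˣ) : ℤ) • x.1.embedding p z)) t = 0 := by
      by_cases htc : t ∈ cellPairs (boundaryComplex T') (boundaryComplex T)
      · rw [coboundary_apply _ _ htc]
        refine Finset.sum_eq_zero fun e he => ?_
        rw [Pi.single_eq_of_ne fun h => ht ⟨htc, e, he, h⟩, map_zero]
      · exact coboundary_apply_of_notMem _ _ htc
    rw [hR, neg_zero]
    refine Finset.sum_eq_zero fun y _ => ?_
    by_cases h : y.1 ⋖ x.1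
    · rw [dif_pos h, hd y h, Pi.smul_apply, Pi.single_eq_of_ne, smul_zero]
      rintro rfl
      have hsub := HypersurfaceCell.le_iff.1 h.le
      have h4 := y.1.card_pair
      have h5 := x.1.card_pair
      have h6 := x.2
      have h7 := y.2
      obtain ⟨e, he⟩ : ∃ e, y.1.pair \ x.1.pair = {e} := by
        rw [← Finset.card_eq_one, Finset.card_sdiff_of_subset hsub]
        lia
      have he1 : e ∈ y.1.pair \ x.1.pair := he ▸ Finset.mem_singleton_self e
      refine ht ⟨y.1.val.pair_mem hQ hμ, e, (Finset.mem_sdiff.1 he1).1, ?_⟩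
      rw [Finset.erase_eq, ← he, Finset.sdiff_sdiff_eq_self hsub]
    · rw [dif_neg h, map_zero, Pi.zero_apply]

theorem contractMap_chainEmbedding
    (z : Chains (rationalCosheaf T' T μ p) HypersurfaceCell.dim q) :
    contractMap (boundaryComplex T') (boundaryComplex T) (chainEmbedding p η q z) = 0 := by
  classical
  funext t
  by_cases ht : t ∈ cellPairs (boundaryComplex T') (boundaryComplex T)
  swap
  · exact contractMap_apply_of_notMem ht _
  rw [contractMap_apply ht, Pi.zero_apply]
  by_cases h : ∃ c : HypersurfaceCell T' T μ, c.dim = q ∧ c.pair = t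
  · obtain ⟨c, hc, rfl⟩ := h
    rw [chainEmbedding_apply_pair z ⟨c, hc⟩, map_zsmul]
    have := ((c.val.mem_range_embedding_iff hQ hμ).1 ⟨z ⟨c, hc⟩, rfl⟩).2
    exact (congrArg _ this).trans (smul_zero _)
  · rw [chainEmbedding_apply_of_forall_ne z fun c hc hct => h ⟨c, hc, hct⟩, map_zero]

theorem chainEmbedding_mem (hK : IsMirrorPair (boundaryComplex T') (boundaryComplex T)) {k : ℤ}
    (hk : k = d + 1 - q) (z : Chains (rationalCosheaf T' T μ p) HypersurfaceCell.dim q) :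
    LinearMap.inl ℚ _ (Pairs d → Fock d) (chainEmbedding p η q z) ∈ (coneComplex hK p).C k := by
  refine ⟨mem_sections_of (fun t ht _ => ?_) fun t ht => ?_, Submodule.zero_mem _⟩
  · change chainEmbedding p η q z t ∈ _
    by_cases h : ∃ c : HypersurfaceCell T' T μ, c.dim = q ∧ c.pair = t
    · obtain ⟨c, hc, rfl⟩ := h
      rw [chainEmbedding_apply_pair z ⟨c, hc⟩]
      exact zsmul_mem ((c.val.mem_range_embedding_iff hQ hμ).1 ⟨z ⟨c, hc⟩, rfl⟩).1 _
    · rw [chainEmbedding_apply_of_forall_ne z fun c hc hct => h ⟨c, hc, hct⟩]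
      exact Submodule.zero_mem _
  · refine chainEmbedding_apply_of_forall_ne z fun c hc hct => ht ⟨?_, ?_⟩
    · rw [← hct]
      exact c.val.pair_mem hQ hμ
    · rw [← hct, c.card_pair, hc, hk]

/-- On cells with |σ| ≥ 2, the kernel of the contraction map is F_p ⊗ ℚ; on the ambient cells with
|σ| = 1 it is zero, so nothing is lost outside of the hypersurface. -/
theorem exists_chainEmbedding_eq (hK : IsMirrorPair (boundaryComplex T') (boundaryComplex T))
    {k : ℤ} (hk : k = d + 1 - q) {x : (Pairs d → Fock d) × (Pairs d → Fock d)}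
    (hx : x ∈ (coneComplex hK p).C k) (hx2 : x.2 = 0)
    (hx1 : contractMap (boundaryComplex T') (boundaryComplex T) x.1 = 0) :
    ∃ z : Chains (rationalCosheaf T' T μ p) HypersurfaceCell.dim q,
      LinearMap.inl ℚ _ (Pairs d → Fock d) (chainEmbedding p η q z) = x := by
  classical
  have hcontr : ∀ t ∈ cellPairs (boundaryComplex T') (boundaryComplex T),
      contractProd lift t.toRight (x.1 t) = 0 := by
    intro t ht
    rw [← contractMap_apply ht, hx1, Pi.zero_apply]
  have hpre : ∀ c : {c : HypersurfaceCell T' T μ // c.dim = q},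
      ∃ w : (rationalCosheaf T' T μ p).obj c.1,
        c.1.embedding p w = ((η c.1.pair : ℤˣ) : ℤ) • x.1 c.1.pair := by
    intro c
    refine (c.1.val.mem_range_embedding_iff hQ hμ).2 ⟨zsmul_mem (hx.1.1 _) _, ?_⟩
    rw [map_zsmul]
    exact (congrArg _ (hcontr _ (c.1.val.pair_mem hQ hμ))).trans (smul_zero _)
  choose w hw using hpre
  have : Fintype {c : HypersurfaceCell T' T μ // c.dim = q} := Fintype.ofFinite _
  obtain ⟨z, hz⟩ : ∃ z : Chains (rationalCosheaf T' T μ p) HypersurfaceCell.dim q,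
      ∀ c, z c = w c := ⟨DFinsupp.equivFunOnFintype.symm w, fun c => rfl⟩
  refine ⟨z, Prod.ext (funext fun t => ?_) hx2.symm⟩
  change chainEmbedding p η q _ t = x.1 t
  by_cases h : ∃ c : HypersurfaceCell T' T μ, c.dim = q ∧ c.pair = t
  · obtain ⟨c, hc, rfl⟩ := h
    rw [chainEmbedding_apply_pair _ ⟨c, hc⟩, hz]
    refine (congrArg _ (hw ⟨c, hc⟩)).trans ?_
    rw [smul_smul, ← Units.val_mul, Int.units_mul_self, Units.val_one, one_smul]
  · rw [chainEmbedding_apply_of_forall_ne _ fun c hc hct => h ⟨c, hc, hct⟩]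
    by_cases ht : t ∈ cellPairs (boundaryComplex T') (boundaryComplex T) ∧ (t.card : ℤ) = k
    swap
    · exact (hx.1.2 t ht).symm
    by_cases h2 : 2 ≤ t.toRight.card
    · obtain ⟨c, rfl⟩ := exists_hypersurfaceCell_pair_eq hQ hμ ht.1 h2
      refine absurd ⟨c, ?_, rfl⟩ h
      have := c.card_pair
      lia
    -- For σ = {b} the value is killed by contraction with `lift b` and by multiplication with `lift
    -- 0`, which pair to -1.
    · obtain ⟨b, hb⟩ : ∃ b, t.toRight = {b} := by
        rw [← Finset.card_eq_one]
        have := Finset.card_pos.2 (Finset.nonempty_iff_ne_empty.2 ht.1.2)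
        lia
      have h3 := hcontr t ht.1
      have h4 := mem_killedByWedge.1 (hx.1.1 t).2 0 (Finset.mem_insert_self _ _)
      have h5 : contract (lift b) (x.1 t) = 0 := by
        rw [hb] at h3
        have h6 := contractProd_insert (f := lift) (Finset.notMem_empty b) (x.1 t)
        rw [insert_empty_eq, h3, contractProd_empty, Module.End.one_apply] at h6
        rcases Int.units_eq_one_or (insertSign b ∅) with h7 | h7 <;> rw [h7] at h6 <;>
          simpa using h6.symm
      have h6 := contract_wedge (lift b) (lift 0) (x.1 t)
      rw [h4, h5, map_zero, map_zero, extendedForm_lift_zero] at h6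
      exact Eq.symm (by simpa using h6)

/-- Tropical homology is the cohomology of the mapping cone. -/
theorem rank_tropicalHomology (hK : IsMirrorPair (boundaryComplex T') (boundaryComplex T))
    {s : Cell T' T μ → Cell T' T μ → ℤˣ} (hs : IsBalanced Cell.dim s) (p : ℕ) (q : ℤ) :
    Module.rank ℚ (TropicalHomology T' T μ s p q) = (coneComplex hK p).rank (d + 1 - q) := by
  obtain ⟨η, hη⟩ := hs.exists_eq_mul hQ hμ hK
  let X := coneComplex hK (p : ℤ)
  let φ : ∀ q k : ℤ, k = d + 1 - q →
      (Chains (rationalCosheaf T' T μ p) HypersurfaceCell.dim q →ₗ[ℚ] X.C k) := fun q k hk =>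
    (LinearMap.inl ℚ _ (Pairs d → Fock d) ∘ₗ chainEmbedding p η q).codRestrict (X.C k)
      fun z => chainEmbedding_mem hQ hμ hK hk z
  have hinj : ∀ (q k : ℤ) hk, Function.Injective (φ q k hk) := by
    intro q k hk z z' h
    exact chainEmbedding_injective (congrArg Prod.fst (congrArg Subtype.val h))
  have hcomm : ∀ (q r k l : ℤ) (hk : k = d + 1 - q) (hl : l = d + 1 - r) (hkl : l = k + 1)
      (z : Chains (rationalCosheaf T' T μ p) HypersurfaceCell.dim q),
      φ r l hl (boundaryMap (rationalCosheaf T' T μ p) HypersurfaceCell.dim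
        (fun y x => s y.val x.val) q r z) = X.d k l hkl (φ q k hk z) := by
    intro q r k l hk hl hkl z
    refine Subtype.ext (Prod.ext ?_ ?_)
    · exact chainEmbedding_boundaryMap hQ hμ hη (by linarith) z
    · have h := coneComplex_snd_D (p := p) hK
        (LinearMap.inl ℚ _ (Pairs d → Fock d) (chainEmbedding p η q z)) rfl
      exact (h.trans (contractMap_chainEmbedding hQ hμ z)).symm
  -- After subtracting a boundary, x has no second component; as that of its differential also
  -- vanishes, its first component is in the kernel of the contraction map, hence a chain of F_p.
  have hex : ∀ (q r k l m : ℤ) (hk : k = d + 1 - q) (hl : l = d + 1 - r) (hkl : l = k + 1)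
      (hmk : k = m + 1) (x : X.C k) (z : Chains (rationalCosheaf T' T μ p) HypersurfaceCell.dim r),
      X.d k l hkl x = φ r l hl z → ∃ w y, x = φ q k hk w + X.d m k hmk y := by
    intro q r k l m hk hl hkl hmk x z h
    obtain rfl : m = k - 1 := by linarith
    obtain ⟨y, hy, hy2⟩ := exists_coneComplex_reduction hK x.2
    have hDy : X.D y ∈ X.C k := hmk ▸ X.map_mem _ _ hy
    have hxy : (x : (Pairs d → Fock d) × (Pairs d → Fock d)) - X.D y ∈ X.C k :=
      sub_mem x.2 hDy
    have hD : X.D (x - X.D y) = X.D x := by rw [map_sub, X.sq_zero _ _ hy, sub_zero]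
    have h1 : (X.D (x : (Pairs d → Fock d) × (Pairs d → Fock d))).2 = 0 :=
      congrArg Prod.snd (congrArg Subtype.val h)
    rw [← hD] at h1
    obtain ⟨w, hw⟩ := exists_chainEmbedding_eq (η := η) hQ hμ hK hk hxy hy2
      ((coneComplex_snd_D hK _ hy2).symm.trans h1)
    refine ⟨w, ⟨y, hy⟩, Subtype.ext ?_⟩
    exact (sub_eq_iff_eq_add.1 hw.symm)
  exact rank_homology_eq_of_quotient_exact _ _
    (X.d (d + 1 - q - 1 - 1) (d + 1 - q - 1) (by ring)) (X.d (d + 1 - q - 1) (d + 1 - q) (by ring))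
    (X.d (d + 1 - q) (d + 1 - q + 1) rfl)
    (φ (q + 1) (d + 1 - q - 1) (by ring)) (φ q (d + 1 - q) rfl)
    (φ (q - 1) (d + 1 - q + 1) (by ring))
    (fun x => Subtype.ext (X.sq_zero _ _ x.2)) (fun x => Subtype.ext (X.sq_zero _ _ x.2))
    (hcomm (q + 1) q _ _ (by ring) rfl (by ring)) (hcomm q (q - 1) _ _ rfl (by ring) rfl)
    (hinj _ _ (by ring)) (hinj _ _ rfl)
    (hex q (q - 1) _ _ _ rfl (by ring) rfl (by ring))
    (hex (q + 1) q _ _ _ (by ring) rfl (by ring) (by ring))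

end Comparison

end TropicalMirror

end

open TropicalMirror in
theorem mainTheorem2 (n : ℕ) (Δ : Set (Fin (n + 1) → ℝ)) (hΔ : IsReflexive Δ)
    (T : Triangulation Δ) (T' : Triangulation (polarDual Δ))
    (μ μ' : (Fin (n + 1) → ℤ) → ℤ) (hμ : T.IsInducedBy μ) (hμ' : T'.IsInducedBy μ')
    (s : Cell T' T μ → Cell T' T μ → ℤˣ) (hs : IsBalanced Cell.dim s)
    (s' : Cell T T' μ' → Cell T T' μ' → ℤˣ) (hs' : IsBalanced Cell.dim s')
    (p q : ℕ) (hp : p ≤ n) :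
    Module.rank ℚ (TropicalHomology T' T μ s p q) =
      Module.rank ℚ (TropicalHomology T T' μ' s' (n - p) q) := by
  have hQ := isPolarPair_of_isReflexive hΔ
  have hK := isMirrorPair_boundaryComplex hQ hμ hμ'
  rw [rank_tropicalHomology hQ hμ hK hs, rank_tropicalHomology hQ.symm hμ' hK.symm hs',
    ← rank_augmentedComplex, ← rank_augmentedComplex, ← rank_symmetricComplex,
    ← rank_symmetricComplex]
  -- Both sides are taken in degree d + 1 - q, so q is the same; what remains is n - p = d - 1 - p
  -- for d = n + 1.
  refine rank_symmetricComplex_symm ?_ hK _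
  push_cast [hp]
  ring
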